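/- Let $k$ be an algebraically closed field of characteristic zero and let $S=\{F=0\}\subset\mathbb P^3$ be a nonsingular cubic surface over $k$. A \emph{double-six} on $S$ consists of two sets of six lines $A_1,\dots,A_6;\,B_1,\dots,B_6$ on $S$ such that the $A_i$ are mutually skew, the $B_j$ are mutually skew, and $A_i$ meets $B_j$ if and only if $i\neq j$ (double-sixes are considered up to renumbering the indices and interchanging the two sixes). \emph{Cremona hexahedral equations} of $S$ consist of linear forms $Z_0,\dots,Z_5$ and constants $\beta_0,\dots,\beta_5$ in $k$, not all equal, such that $(Z_0:\dots:Z_5)$ embeds $\mathbb P^3$ in $\mathbb P^5$ with image the subspace $\sum Z_i=\sum\beta_iZ_i=0$, and such that $\sum Z_i^3$ is a nonzero multiple of $F$ on $\mathbb P^3$. They determine the double-six formed by the lines of $S$ that are different from the fifteen lines $Z_a+Z_b=Z_c+Z_d=Z_e+Z_f=0$, where $\{a,b\},\{c,d\},\{e,f\}$ runs over the partitions of $\{0,\dots,5\}$ into pairs. The \emph{Cremona plane} of $(S,\Delta)$, for a double-six $\Delta$ on $S$, is the plane $\sum\beta_i^2Z_i=0$ in $\mathbb P^3$, formed from Cremona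 hexahedral equations of $S$ that determine $\Delta$. For a general nonsingular cubic surface $S$ (that is, for all nonsingular $F$ outside some proper hypersurface of the $20$-dimensional space of cubic forms in four variables): $S$ has exactly $36$ double-sixes; each of them has a well-defined Cremona plane (it exists and is unique); and the $36$ Cremona planes are pairwise distinct. Consequently, whenever $S$ is the closure of the image of the rational map $\mu=(c_0:c_1:c_2:c_3):\mathbb P^2\dashrightarrow\mathbb P^3$ defined by a basis $c_0,\dots,c_3$ of the space of plane cubic forms vanishing at six distinct points $P_1,\dots,P_6$, the $36$ cubic curves through $P_1,\dots,P_6$ that are the pullbacks by $\mu$ of the $36$ Cremona planes (the pullback of $\sum a_iy_i=0$ being $\sum a_ic_i=0$) are pairwise distinct members of the linear system of plane cubics through $P_1,\dots,P_6$. -/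

import Mathlib

open MvPolynomial

noncomputable section

namespace CubicSurface

variable {k : Type*} [Field k]

/-- The surface `F = 0` in projective 3-space is nonsingular: the partial derivatives of `F` have no
common zero on it. -/
def Nonsingular (F : MvPolynomial (Fin 4) k) : Prop :=
  ∀ x : Fin 4 → k, x ≠ 0 → eval x F = 0 → ∃ i, eval x (pderiv i F) ≠ 0

/-- A line of projective 3-space, i.e. a two-dimensional subspace of `k⁴`, that lies on the surface
`F = 0`. -/
def IsLineOn (F : MvPolynomial (Fin 4) k) (L : Submodule k (Fin 4 → k)) : Prop :=
  Module.finrank k L = 2 ∧ ∀ x ∈ L, eval x F = 0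

/-- `D` is the set of the twelve lines of a double-six `(A₁, …, A₆; B₁, …, B₆)` on the surface
`F = 0`. The set of lines determines the double-six up to renumbering the indices and interchanging
the two sixes (a line of `D` is disjoint from the other lines of its own six and from just one line
of the other six). -/
def IsDoubleSix (F : MvPolynomial (Fin 4) k) (D : Set (Submodule k (Fin 4 → k))) : Prop :=
  ∃ A B : Fin 6 → Submodule k (Fin 4 → k),
    (∀ i, IsLineOn F (A i)) ∧ (∀ i, IsLineOn F (B i)) ∧
    (∀ i j, i ≠ j → A i ⊓ A j = ⊥) ∧ (∀ i j, i ≠ j → B i ⊓ B j = ⊥) ∧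
    (∀ i j, A i ⊓ B j ≠ ⊥ ↔ i ≠ j) ∧
    D = Set.range A ∪ Set.range B

/-- Cremona hexahedral equations of the surface `F = 0`: the linear forms `Z₀, …, Z₅` embed
projective 3-space in projective 5-space as the subspace `∑ Zᵢ = ∑ βᵢ Zᵢ = 0`, and the surface is
cut out there by `∑ Zᵢ³ = 0`. -/
structure IsHexahedral (F : MvPolynomial (Fin 4) k)
    (Z : Fin 6 → Module.Dual k (Fin 4 → k)) (β : Fin 6 → k) : Prop where
  injective : ∀ x, (∀ i, Z i x = 0) → x = 0
  sum_eq_zero : ∑ i, Z i = 0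
  sum_smul_eq_zero : ∑ i, β i • Z i = 0
  independent : ∃ i j, β i ≠ β j
  sum_cubes : ∃ c : k, c ≠ 0 ∧ ∀ x, ∑ i, (Z i x) ^ 3 = c * eval x F

/-- The line `Z_a + Z_b = Z_c + Z_d = Z_e + Z_f = 0`, where `{a,b}, {c,d}, {e,f}` is the partition of
the six indices given by `s`. There are fifteen such partitions. -/
def hexLine (Z : Fin 6 → Module.Dual k (Fin 4 → k)) (s : Equiv.Perm (Fin 6)) :
    Submodule k (Fin 4 → k) :=
  LinearMap.ker (Z (s 0) + Z (s 1)) ⊓ LinearMap.ker (Z (s 2) + Z (s 3)) ⊓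
    LinearMap.ker (Z (s 4) + Z (s 5))

/-- The lines of the surface `F = 0` other than the fifteen lines `hexLine Z s`. These are the
twelve lines of the double-six determined by hexahedral equations with linear forms `Z`. -/
def hexDoubleSix (F : MvPolynomial (Fin 4) k) (Z : Fin 6 → Module.Dual k (Fin 4 → k)) :
    Set (Submodule k (Fin 4 → k)) :=
  {L | IsLineOn F L ∧ ∀ s, L ≠ hexLine Z s}

/-- `Ξ` is a Cremona plane of the pair consisting of the surface `F = 0` and the double-six `D`:
it is a plane (a three-dimensional subspace of `k⁴`), and it is given by `∑ βᵢ² Zᵢ = 0` for some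
Cremona hexahedral equations of the surface that determine `D`. -/
def IsCremonaPlane (F : MvPolynomial (Fin 4) k) (D : Set (Submodule k (Fin 4 → k)))
    (Ξ : Submodule k (Fin 4 → k)) : Prop :=
  Module.finrank k Ξ = 3 ∧
    ∃ (Z : Fin 6 → Module.Dual k (Fin 4 → k)) (β : Fin 6 → k),
      IsHexahedral F Z β ∧ D = hexDoubleSix F Z ∧ Ξ = LinearMap.ker (∑ i, β i ^ 2 • Z i)

/-- The space of plane cubic forms vanishing at the points `P i`. -/
def cubicsThrough (P : Fin 6 → Projectivization k (Fin 3 → k)) :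
    Submodule k (MvPolynomial (Fin 3) k) where
  carrier := {C | C.IsHomogeneous 3 ∧ ∀ i, eval (P i).rep C = 0}
  zero_mem' := ⟨isHomogeneous_zero _ _ _, by simp⟩
  add_mem' := fun ha hb => ⟨ha.1.add hb.1, fun i => by simp [ha.2 i, hb.2 i]⟩
  smul_mem' := fun r C hC =>
    ⟨(homogeneousSubmodule (Fin 3) k 3).smul_mem r hC.1, fun i => by simp [hC.2 i]⟩

/-- The surface `F = 0` is the (closure of the) image of the rational map `μ = (c₀ : c₁ : c₂ : c₃)`
from the plane to 3-space defined by a basis `c` of the space of cubics through the six distinct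
points `P i`: the ideal of the forms vanishing on the image of `μ` is generated by `F`. -/
structure IsImage (F : MvPolynomial (Fin 4) k) (P : Fin 6 → Projectivization k (Fin 3 → k))
    (c : Fin 4 → MvPolynomial (Fin 3) k) : Prop where
  distinct : Function.Injective P
  linearIndependent : LinearIndependent k c
  span_eq : Submodule.span k (Set.range c) = cubicsThrough P
  ker_eq : RingHom.ker (aeval c : MvPolynomial (Fin 4) k →ₐ[k] MvPolynomial (Fin 3) k) =
    Ideal.span {F}

/-- The pullback of a plane `Ξ` by the rational map `(c₀ : c₁ : c₂ : c₃)`. If `Ξ` is given by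
`∑ aᵢ yᵢ = 0`, this is the one-dimensional space spanned by the cubic form `∑ aᵢ cᵢ`, i.e. the cubic
curve `∑ aᵢ cᵢ = 0` as a member of the linear system spanned by `c`. -/
def pullbackCubic (c : Fin 4 → MvPolynomial (Fin 3) k) (Ξ : Submodule k (Fin 4 → k)) :
    Submodule k (MvPolynomial (Fin 3) k) :=
  Ξ.dualAnnihilator.map
    (∑ i, (LinearMap.applyₗ (Pi.single i 1 : Fin 4 → k)).smulRight (c i) :
      Module.Dual k (Fin 4 → k) →ₗ[k] MvPolynomial (Fin 3) k)

/-- The property `p` holds for a general cubic form in four variables: it holds for all cubic forms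
outside a proper hypersurface `G = 0` of the 20-dimensional space of cubic forms. -/
def ForGeneralCubic (p : MvPolynomial (Fin 4) k → Prop) : Prop :=
  ∃ G : MvPolynomial {m : Fin 4 →₀ ℕ // m.degree = 3} k, G ≠ 0 ∧
    ∀ F : MvPolynomial (Fin 4) k, F.IsHomogeneous 3 → eval (fun m => F.coeff m.1) G ≠ 0 → p F

end CubicSurface

end

/-! Generality enters only once. Normalised by `β₄ = 0`, `β₅ = 1`, hexahedral equations depend on
four linear forms and four constants, hence on 20 parameters, as many as a cubic form has
coefficients. The derivative of this parametrisation is invertible at one point, so a general cubic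
form has hexahedral equations. The parameters at which some conjugate of `hexDisc` vanishes form a
hypersurface, and so their image lies in a hypersurface; for general `F` these quantities are
therefore nonzero for all hexahedral equations of `F` at once (`exists_generic_hexahedral`).

From there on the surface is fixed. Splitting the six forms into two triples and taking the pairwise
sums inside each triple turns `∑ Zᵢ³` into a multiple of `u₀u₁u₂ + v₀v₁v₂`. The linear relations `∑
aᵢuᵢ + ∑ bⱼvⱼ = 0` form a pencil, on which nonsingularity makes the three roots of the binary cubic
`∏ aᵢ - ∏ bⱼ` distinct. The nine lines `uᵢ = vⱼ = 0` and six lines for each root are all the lines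
of the surface (`IsMarking.eq_cellLine_or_eq_rootLine`). Their incidences are then known, and a
finite computation yields the 36 double-sixes, each of which avoids a 3 × 3 grid of lines with
coplanar rows and columns.

Every such grid arises from an expression `u₀u₁u₂ + v₀v₁v₂`, and the choice of one root gives
hexahedral equations whose double-six consists of the twelve lines of the other two roots. This
proves that Cremona planes exist. For uniqueness, the fifteen lines outside the double-six determine
the planes `Z_a + Z_b = 0`, hence the `Zᵢ` up to renumbering and a common factor, and the `βᵢ` up to
an affine substitution, which merely rescales `∑ βᵢ² Zᵢ` because of the two linear relations
(`IsHexahedral.ker_eq_of_hexDoubleSix_eq`).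

Two different double-sixes are of one of two kinds (`double_six_types`). If they avoid a common
grid, they belong to two roots of one pencil, and equality of their planes would contradict the
simplicity of a root (`IsMarking.ker_ne_ker`). Otherwise some line `L` outside both meets the same
lines of each. After renumbering, both systems of equations then have the same three planes `Xᵢ = 0`
through `L`, where the `Xᵢ` are the sums of the pairs `Z₀, Z₁`; `Z₂, Z₃`; `Z₄, Z₅`, and with the
differences `Yᵢ` of these pairs the cubic is `X₀X₁X₂ + ∑ XᵢYᵢ²` up to a constant. If the Cremona
planes agree and `hexDisc` does not vanish, the `Yᵢ` of the two systems agree up to signs and a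
common factor (`exists_sign`), so the double-sixes coincide. The pullbacks are distinct because the
`cᵢ` are linearly independent. -/

noncomputable section
namespace CubicSurface

/-! ### Jacobian criterion and images of polynomial maps -/

variable {k : Type*} [Field k] {σ τ : Type}

theorem pderiv_aeval_eq_sum [Fintype τ] (φ : τ → MvPolynomial σ k) (p : MvPolynomial τ k) (j : σ) :
    pderiv j (aeval φ p) = ∑ m, aeval φ (pderiv m p) * pderiv j (φ m) := by
  classical
  induction p using MvPolynomial.induction_on with
  | C a => simp
  | add p q hp hq => simp only [map_add, hp, hq, add_mul, Finset.sum_add_distrib]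
  | mul_X p n hp =>
    have h : ∀ m, aeval φ (pderiv m (p * X n)) * pderiv j (φ m) =
        (aeval φ (pderiv m p) * pderiv j (φ m)) * φ n +
          if n = m then aeval φ p * pderiv j (φ n) else 0 := by
      intro m
      rw [pderiv_mul, pderiv_X]
      by_cases h : n = m
      · subst h; simp; ring
      · have h' : ¬ m = n := fun e => h e.symm
        simp [h]; ring
    rw [Finset.sum_congr rfl fun m _ => h m, Finset.sum_add_distrib, ← Finset.sum_mul, ← hp,
      map_mul, pderiv_mul, aeval_X, Finset.sum_ite_eq]
    simp

theorem eq_C_of_pderiv_eq_zero [CharZero k] (p : MvPolynomial τ k) (h : ∀ m, pderiv m p = 0) :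
    p = C (coeff 0 p) := by
  classical
  ext d
  rw [coeff_C]
  split_ifs with hd
  · rw [← hd]
  · obtain ⟨m, hm⟩ : ∃ m, d m ≠ 0 := by
      by_contra hc
      push Not at hc
      exact hd (Finsupp.ext fun m => (hc m).symm)
    have h1 := congrArg (coeff (d - Finsupp.single m 1)) (h m)
    rw [coeff_pderiv] at h1
    have e : d - Finsupp.single m 1 + Finsupp.single m 1 = d := by
      ext i
      by_cases hi : m = i
      · subst hi; simp; omega
      · simp [hi]
    rw [e] at h1
    simp only [coeff_zero, mul_eq_zero] at h1
    rcases h1 with h1 | h1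
    · exact h1
    · exfalso
      exact Nat.cast_add_one_ne_zero _ h1

theorem totalDegree_pderiv_lt (p : MvPolynomial τ k) (m : τ) (h : pderiv m p ≠ 0) :
    (pderiv m p).totalDegree < p.totalDegree := by
  classical
  rw [totalDegree, Finset.sup_lt_iff]
  · intro d hd
    rw [mem_support_iff, coeff_pderiv] at hd
    have h1 : d + Finsupp.single m 1 ∈ p.support := by
      rw [mem_support_iff]; exact left_ne_zero_of_mul hd
    refine lt_of_lt_of_le ?_ (le_totalDegree h1)
    rw [Finsupp.sum_add_index' (by simp) (by simp)]
    simp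
  · by_contra hc
    simp only [bot_eq_zero', not_lt, nonpos_iff_eq_zero] at hc
    rw [totalDegree_eq_zero_iff_eq_C] at hc
    rw [hc] at h
    simp at h

/-- The Jacobian criterion for algebraic independence. -/
theorem algebraicIndependent_of_jacobian [Fintype σ] [Fintype τ]
    [CharZero k] [DecidableEq τ] (φ : τ → MvPolynomial σ k)
    (x : σ → k) (d : τ → σ → k)
    (hd : ∀ m m', ∑ j, d m j * eval x (pderiv j (φ m')) = if m = m' then 1 else 0) :
    AlgebraicIndependent k φ := by
  rw [algebraicIndependent_iff]
  intro p
  induction h : p.totalDegree using Nat.strong_induction_on generalizing p with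
  | _ n ih =>
  intro hp
  subst h
  -- The Jacobian matrix contracted with the constant directions `d`. It specialises to the identity
  -- at `x`, so its determinant is a nonzero polynomial.
  let J : Matrix τ τ (MvPolynomial σ k) := fun m' m => ∑ j, C (d m j) * pderiv j (φ m')
  have hJ : J.det ≠ 0 := by
    intro h0
    have h1 := congrArg (eval x) h0
    rw [RingHom.map_det, map_zero] at h1
    have h2 : (eval x).mapMatrix J = 1 := by
      ext m' m
      rw [RingHom.mapMatrix_apply, Matrix.map_apply, Matrix.one_apply]
      simp only [J, map_sum, map_mul, eval_C, hd]
      exact if_congr eq_comm rfl rfl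
    rw [h2, Matrix.det_one] at h1
    exact one_ne_zero h1
  -- Differentiating `p(φ) = 0` by the chain rule. Since `J` is nonsingular, the partial derivatives
  -- of `p` are again relations, of smaller degree, so they vanish and `p` is constant.
  have hw : Matrix.vecMul (fun m => aeval φ (pderiv m p)) J = 0 := by
    ext1 m
    simp only [Matrix.vecMul, dotProduct, J, Pi.zero_apply, Finset.mul_sum]
    rw [Finset.sum_comm]
    refine Finset.sum_eq_zero fun j _ => ?_
    have := pderiv_aeval_eq_sum φ p j
    rw [hp, map_zero] at this
    rw [Finset.sum_congr rfl fun m' _ => mul_left_comm _ _ _, ← Finset.mul_sum, ← this, mul_zero]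
  have h0 := Matrix.eq_zero_of_det_mem_nonZeroDivisors_of_vecMul_eq_zero
    (mem_nonZeroDivisors_of_ne_zero hJ) hw
  have h1 : ∀ m, pderiv m p = 0 := fun m => by
    by_contra hne
    exact hne (ih _ (totalDegree_pderiv_lt p m hne) _ rfl (congrFun h0 m))
  have h2 := eq_C_of_pderiv_eq_zero p h1
  rw [h2, aeval_C, algebraMap_eq, C_eq_zero] at hp
  rw [h2, hp, C_0]

theorem eval_aeval_eq (φ : τ → MvPolynomial σ k) (x : σ → k) (p : MvPolynomial τ k) :
    eval x (aeval φ p) = eval (fun m => eval x (φ m)) p := by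
  rw [← coe_aeval_eq_eval, ← coe_aeval_eq_eval, RingHom.coe_coe, RingHom.coe_coe,
    comp_aeval_apply]

/-- Lying over: some prime of `B` lies over the maximal ideal `ker ev`, and its residue field is
integral over `k`, hence equal to `k`. -/
theorem exists_ringHom_extension [IsAlgClosed k] {A B : Type*} [CommRing A] [CommRing B]
    [Algebra k A] [Algebra A B] [Algebra.IsIntegral A B]
    (hinj : Function.Injective (algebraMap A B)) (ev : A →ₐ[k] k) :
    ∃ χ : B →+* k, ∀ a, χ (algebraMap A B a) = ev a := by
  have hmax : (RingHom.ker ev).IsMaximal := RingHom.ker_isMaximal_of_surjective _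
    fun c => ⟨algebraMap k A c, ev.commutes c⟩
  obtain ⟨Q, hQ, hQc⟩ := Ideal.exists_ideal_over_maximal_of_isIntegral (S := B) (RingHom.ker ev)
    (by rw [(RingHom.injective_iff_ker_eq_bot _).1 hinj]; exact bot_le)
  let := Ideal.Quotient.field Q
  let : Algebra k (B ⧸ Q) :=
    ((Ideal.Quotient.mk Q).comp ((algebraMap A B).comp (algebraMap k A))).toAlgebra
  have hker : ∀ a : A, Ideal.Quotient.mk Q (algebraMap A B a) =
      algebraMap k (B ⧸ Q) (ev a) := by
    intro a
    have h1 : a - algebraMap k A (ev a) ∈ RingHom.ker ev := by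
      rw [RingHom.mem_ker, map_sub, ev.commutes]; simp
    rw [← hQc, Ideal.mem_comap, map_sub] at h1
    exact (Ideal.Quotient.mk_eq_mk_iff_sub_mem _ _).2 h1
  have hint2 : Algebra.IsIntegral k (B ⧸ Q) := by
    refine ⟨fun z => ?_⟩
    obtain ⟨b, rfl⟩ := Ideal.Quotient.mk_surjective z
    obtain ⟨p, hp, hpb⟩ := Algebra.IsIntegral.isIntegral (R := A) b
    refine ⟨p.map ev.toRingHom, hp.map _, ?_⟩
    rw [Polynomial.eval₂_map]
    have h3 : (algebraMap k (B ⧸ Q)).comp ev.toRingHom =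
        (Ideal.Quotient.mk Q).comp (algebraMap A B) := by
      ext a; exact (hker a).symm
    rw [h3, ← Polynomial.hom_eval₂, hpb, map_zero]
  have hbij := IsAlgClosed.algebraMap_bijective_of_isIntegral (k := k) (K := B ⧸ Q)
  let E := RingEquiv.ofBijective _ hbij
  refine ⟨(E.symm : (B ⧸ Q) →+* k).comp (Ideal.Quotient.mk Q), fun a => ?_⟩
  simp only [RingHom.comp_apply, hker]
  exact E.symm_apply_apply (ev a)

/-- Turns a character of a subring into a point. The subring contains `g` and all `g Xᵢ`, so a power
of `g` times any polynomial lies in it, and the character is evaluation at the point with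
coordinates `χ(g Xᵢ) / χ(g)`. -/
theorem exists_eval_of_ringHom {B : Type*} [CommRing B] (ι : B →+* MvPolynomial σ k) (χ : B →+* k)
    (cst : k →+* B) (hι : ∀ c, ι (cst c) = C c) (hχ : ∀ c, χ (cst c) = c) (g : B) (hg : χ g ≠ 0)
    (t : σ → B) (ht : ∀ i, ι (t i) = ι g * X i) (f : MvPolynomial σ k) :
    ∃ (N : ℕ) (b : B), ι b = ι g ^ N * f ∧
      χ b = χ g ^ N * eval (fun i => χ (t i) / χ g) f := by
  induction f using MvPolynomial.induction_on with
  | C a => exact ⟨0, cst a, by simp [hι], by simp [hχ]⟩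
  | add p q hp hq =>
    obtain ⟨N, b, h1, h2⟩ := hp
    obtain ⟨M, b', h1', h2'⟩ := hq
    refine ⟨N + M, g ^ M * b + g ^ N * b', ?_, ?_⟩
    · simp only [map_add, map_mul, map_pow, h1, h1']; ring
    · simp only [map_add, map_mul, map_pow, h2, h2']; ring
  | mul_X p i hp =>
    obtain ⟨N, b, h1, h2⟩ := hp
    refine ⟨N + 1, b * t i, ?_, ?_⟩
    · simp only [map_mul, h1, ht]; ring
    · simp only [map_mul, h2, eval_X]; rw [pow_succ]; field_simp

/-- If there are as many algebraically independent polynomials as there are variables, then the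
corresponding polynomial map hits all points outside a hypersurface. -/
theorem exists_eval_eq_of_algebraicIndependent [Fintype σ] [Fintype τ]
    [IsAlgClosed k] (φ : τ → MvPolynomial σ k)
    (hφ : AlgebraicIndependent k φ) (hc : Fintype.card τ = Fintype.card σ) :
    ∃ G : MvPolynomial τ k, G ≠ 0 ∧
      ∀ y : τ → k, eval y G ≠ 0 → ∃ x : σ → k, ∀ m, eval x (φ m) = y m := by
  classical
  have hb : IsTranscendenceBasis k φ := by
    apply hφ.isTranscendenceBasis_of_lift_trdeg_le_of_finite
    rw [MvPolynomial.trdeg_of_isDomain]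
    simp [Cardinal.mk_fintype, hc]
  have halg := hb.isAlgebraic
  -- A common denominator: every `g Xᵢ` is integral over `k[φ]`. The exceptional hypersurface is `g
  -- = 0`, with `g` written as a polynomial in the `φ`.
  obtain ⟨g, hg0, hg⟩ := Algebra.IsAlgebraic.exists_integral_multiples
    (Algebra.adjoin k (Set.range φ)) (Finset.univ.image (X : σ → MvPolynomial σ k))
  let A := Algebra.adjoin k (Set.range φ)
  let e : MvPolynomial τ k ≃ₐ[k] A := hφ.aevalEquiv
  have he : ∀ p, (e p : MvPolynomial σ k) = aeval φ p := fun p => hφ.algebraMap_aevalEquiv p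
  refine ⟨e.symm g, by simpa using hg0, fun y hy => ?_⟩
  let ev : A →ₐ[k] k := (aeval y).comp e.symm.toAlgHom
  let B := Algebra.adjoin A (Set.range fun i : σ => g • (X i : MvPolynomial σ k))
  have hint : Algebra.IsIntegral A B := by
    apply Algebra.IsIntegral.adjoin
    rintro _ ⟨i, rfl⟩
    exact hg _ (by simp)
  have hinj : Function.Injective (algebraMap A B) := by
    intro a b hab
    exact Subtype.ext (congrArg (fun z : B => (z : MvPolynomial σ k)) hab)
  obtain ⟨χ, hχ⟩ := exists_ringHom_extension (A := A) (B := B) hinj ev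
  let ι : B →+* MvPolynomial σ k := B.val.toRingHom
  have hιA : ∀ a : A, ι (algebraMap A B a) = a := fun _ => rfl
  let t : σ → B := fun i => ⟨g • X i, Algebra.subset_adjoin ⟨i, rfl⟩⟩
  have hg' : χ (algebraMap A B g) ≠ 0 := by rw [hχ]; exact hy
  refine ⟨fun i => χ (t i) / χ (algebraMap A B g), fun m => ?_⟩
  obtain ⟨N, b, h1, h2⟩ := exists_eval_of_ringHom ι χ ((algebraMap A B).comp (algebraMap k A))
    (fun c => rfl) (fun c => by rw [RingHom.comp_apply, hχ, ev.commutes]; rfl)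
    (algebraMap A B g) hg' t (fun i => rfl) (φ m)
  have hb3 : b = algebraMap A B (g ^ N * e (X m)) := by
    apply Subtype.ext
    refine h1.trans ?_
    rw [hιA]
    show _ = ((g ^ N * e (X m) : A) : MvPolynomial σ k)
    simp [he]
  have h5 : ev (e (X m)) = y m := by simp [ev]
  rw [hb3, map_mul, map_pow, map_mul, map_pow, hχ (e (X m)), h5] at h2
  exact (mul_left_cancel₀ (pow_ne_zero _ hg') h2).symm

/-- The image of a hypersurface under a polynomial map to a space of at least the same dimension is
contained in a hypersurface. -/
theorem exists_eval_eq_zero_of_hypersurface [Fintype σ] [Fintype τ]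
    (φ : τ → MvPolynomial σ k)
    (hc : Fintype.card σ ≤ Fintype.card τ) (H : MvPolynomial σ k) (hH : H ≠ 0) :
    ∃ G : MvPolynomial τ k, G ≠ 0 ∧
      ∀ x : σ → k, eval x H = 0 → eval (fun m => eval x (φ m)) G = 0 := by
  -- `H` together with the `φ` are more polynomials than there are variables.
  have hdep : ¬ AlgebraicIndependent k (fun o : Option τ => o.elim H φ) := by
    intro h
    have := h.lift_cardinalMk_le_trdeg
    rw [MvPolynomial.trdeg_of_isDomain] at this
    simp [Cardinal.mk_fintype] at this
    norm_cast at this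
    omega
  rw [algebraicIndependent_iff] at hdep
  push Not at hdep
  obtain ⟨P, hP, hP0⟩ := hdep
  let Φ : MvPolynomial τ k →ₐ[k] MvPolynomial σ k := aeval φ
  have hcomp : ∀ p : MvPolynomial (Option τ) k, aeval (fun o : Option τ => o.elim H φ) p =
      Polynomial.eval₂ (Φ : MvPolynomial τ k →+* MvPolynomial σ k) H (optionEquivLeft k τ p) := by
    intro p
    induction p using MvPolynomial.induction_on with
    | C a => simp [optionEquivLeft_C]
    | add p q hp hq => simp only [map_add, hp, hq, Polynomial.eval₂_add]
    | mul_X p n hp =>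
      simp only [map_mul, hp, Polynomial.eval₂_mul, aeval_X]
      cases n <;> simp [optionEquivLeft_X_none, optionEquivLeft_X_some, Φ]
  rw [hcomp] at hP
  have hP1 : optionEquivLeft k τ P ≠ 0 := by simpa using hP0
  -- Viewing the relation as a polynomial in the variable standing for `H`, the powers of that
  -- variable are divided out. The constant coefficient is then nonzero, and it vanishes on the `φ`
  -- wherever `H` does.
  obtain ⟨Q, hQ, hQd⟩ := Polynomial.exists_eq_pow_rootMultiplicity_mul_and_not_dvd _ hP1 0
  rw [hQ, Polynomial.eval₂_mul, Polynomial.eval₂_pow] at hP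
  simp only [Polynomial.C_0, sub_zero, Polynomial.eval₂_X, mul_eq_zero] at hP
  have hQ0 := hP.resolve_left (pow_ne_zero _ hH)
  refine ⟨Q.coeff 0, ?_, fun x hx => ?_⟩
  · rw [Polynomial.C_0, sub_zero, Polynomial.X_dvd_iff] at hQd
    exact hQd
  · have h1 := congrArg (eval x) hQ0
    rw [Polynomial.hom_eval₂, hx, map_zero, Polynomial.eval₂_at_zero] at h1
    rw [← h1]
    exact (eval_aeval_eq φ x _).symm
end CubicSurface
end

/-! ### The universal hexahedral cubic and its derivative -/

noncomputable section
namespace CubicSurface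

/-- The coefficients of the linear forms `Z₀, …, Z₃`, `Z₄ = ∑ (bᵢ - 1) Zᵢ`, `Z₅ = -∑ bᵢ Zᵢ`. They
satisfy `∑ Zᵢ = ∑ bᵢ Zᵢ = 0`, where `b₄ = 0` and `b₅ = 1`. -/
def hexCoeff {R : Type*} [CommRing R] (z : Fin 4 → Fin 4 → R) (b : Fin 4 → R) :
    Fin 6 → Fin 4 → R :=
  ![z 0, z 1, z 2, z 3, fun j => ∑ i, (b i - 1) * z i j, fun j => -∑ i, b i * z i j]

/-- The sum of the cubes of six linear forms. -/
def sumCubes {R : Type*} [CommRing R] (a : Fin 6 → Fin 4 → R) : MvPolynomial (Fin 4) R :=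
  ∑ i, (∑ j, C (a i j) * X j) ^ 3

/-- The derivative of `sumCubes` at `a` in the direction `a'`. -/
def sumCubesDeriv {R : Type*} [CommRing R] (a a' : Fin 6 → Fin 4 → R) : MvPolynomial (Fin 4) R :=
  ∑ i, 3 * (∑ j, C (a i j) * X j) ^ 2 * (∑ j, C (a' i j) * X j)

theorem map_sumCubes {R S : Type*} [CommRing R] [CommRing S] (f : R →+* S)
    (a : Fin 6 → Fin 4 → R) : map f (sumCubes a) = sumCubes fun i j => f (a i j) := by
  simp [sumCubes]

theorem map_hexCoeff {R S : Type*} [CommRing R] [CommRing S] (f : R →+* S)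
    (z : Fin 4 → Fin 4 → R) (b : Fin 4 → R) :
    (fun i j => f (hexCoeff z b i j)) = hexCoeff (fun i j => f (z i j)) (fun i => f (b i)) := by
  funext i j
  fin_cases i <;> simp [hexCoeff]

theorem eval_sumCubes {R : Type*} [CommRing R] (a : Fin 6 → Fin 4 → R) (x : Fin 4 → R) :
    eval x (sumCubes a) = ∑ i, (∑ j, a i j * x j) ^ 3 := by
  simp [sumCubes]

theorem isHomogeneous_sumCubes {R : Type*} [CommRing R] (a : Fin 6 → Fin 4 → R) :
    (sumCubes a).IsHomogeneous 3 := by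
  refine IsHomogeneous.sum _ _ _ fun i _ => ?_
  have h : (∑ j, C (a i j) * X j : MvPolynomial (Fin 4) R).IsHomogeneous 1 :=
    IsHomogeneous.sum _ _ _ fun j _ => by
      simpa using (isHomogeneous_C (Fin 4) (a i j)).mul (isHomogeneous_X R j)
  simpa using h.pow 3

-- Dual numbers give the derivative of the parametrisation without expanding its twenty
-- coefficients: `(p + εq)³ = p³ + 3εp²q`.
open DualNumber in
theorem sumCubes_add_eps {R : Type*} [CommRing R] (a a' : Fin 6 → Fin 4 → R) :
    sumCubes (fun i j => algebraMap R R[ε] (a i j) + a' i j • (ε : R[ε])) =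
      map (algebraMap R R[ε]) (sumCubes a) +
        C (ε : R[ε]) * map (algebraMap R R[ε]) (sumCubesDeriv a a') := by
  have h : (C (ε : R[ε]) : MvPolynomial (Fin 4) R[ε]) ^ 2 = 0 := by
    rw [← C_pow, pow_two, eps_mul_eps, C_0]
  simp only [sumCubes, sumCubesDeriv, map_sum, map_pow, map_mul, map_C, map_X]
  rw [Finset.mul_sum, ← Finset.sum_add_distrib]
  refine Finset.sum_congr rfl fun i _ => ?_
  have h2 : (∑ j, C (algebraMap R R[ε] (a i j) + a' i j • (ε : R[ε])) * X j :
      MvPolynomial (Fin 4) R[ε]) = (∑ j, C (algebraMap R R[ε] (a i j)) * X j) +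
        C ε * (∑ j, C (algebraMap R R[ε] (a' i j)) * X j) := by
    rw [Finset.mul_sum, ← Finset.sum_add_distrib]
    refine Finset.sum_congr rfl fun j _ => ?_
    rw [Algebra.smul_def, C_add, C_mul]; ring
  rw [h2]
  have h3 : map (algebraMap R R[ε]) (3 : MvPolynomial (Fin 4) R) = 3 := by simp
  rw [h3]
  generalize (∑ j, C (algebraMap R R[ε] (a i j)) * X j : MvPolynomial (Fin 4) R[ε]) = p
  generalize (∑ j, C (algebraMap R R[ε] (a' i j)) * X j : MvPolynomial (Fin 4) R[ε]) = q
  linear_combination (3 * p * q ^ 2 + C ε * q ^ 3) * h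

open DualNumber in
theorem aeval_add_eps {k : Type*} [Field k] {σ : Type} [Fintype σ] (x d : σ → k)
    (g : MvPolynomial σ k) :
    aeval (fun j => algebraMap k k[ε] (x j) + d j • (ε : k[ε])) g =
      algebraMap k k[ε] (eval x g) + (∑ j, d j * eval x (pderiv j g)) • (ε : k[ε]) := by
  classical
  have hε : (ε : k[ε]) * ε = 0 := eps_mul_eps
  induction g using MvPolynomial.induction_on with
  | C a => simp
  | add p q hp hq =>
    simp only [map_add, hp, hq, mul_add, Finset.sum_add_distrib, add_smul]; ring
  | mul_X p n hp =>
    have h : ∑ j, d j * eval x (pderiv j (p * X n)) =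
        (∑ j, d j * eval x (pderiv j p)) * x n + d n * eval x p := by
      rw [Finset.sum_mul]
      have : d n * eval x p = ∑ j, if n = j then d n * eval x p else 0 := by simp
      rw [this, ← Finset.sum_add_distrib]
      refine Finset.sum_congr rfl fun j _ => ?_
      rw [pderiv_mul, pderiv_X]
      by_cases h : n = j
      · subst h; simp; ring
      · simp [h]; ring
    rw [h, map_mul, hp, aeval_X, map_mul, eval_X]
    simp only [Algebra.smul_def, map_add, map_mul]
    linear_combination (algebraMap k k[ε] (∑ j, d j * eval x (pderiv j p))) *
      algebraMap k k[ε] (d n) * hε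

/-- The index set of the parameters `Zᵢⱼ` (`i < 4`), `bᵢ` of the hexahedral equations. -/
abbrev HexIndex := (Fin 4 × Fin 4) ⊕ Fin 4

/-- The index set of the coefficients of the cubic forms in four variables. -/
abbrev CubicIndex := {m : Fin 4 →₀ ℕ // m.degree = 3}

/-- The equivalence of exponents with multisets of three indices. -/
def cubicIndexEquiv : CubicIndex ≃ Sym (Fin 4) 3 where
  toFun m := ⟨Finsupp.toMultiset m.1, by rw [Finsupp.card_toMultiset]; exact m.2⟩
  invFun s := ⟨Multiset.toFinsupp s.1, by
    have h := s.2
    rw [← Multiset.toFinsupp_toMultiset s.1, Finsupp.card_toMultiset] at h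
    exact h⟩
  left_inv m := by ext1; simp
  right_inv s := by ext1; simp

instance : Fintype CubicIndex := Fintype.ofEquiv _ cubicIndexEquiv.symm

theorem card_cubicIndex : Fintype.card CubicIndex = 20 := by
  rw [Fintype.card_congr cubicIndexEquiv, Sym.card_sym_eq_multichoose,
    Fintype.card_fin, Nat.multichoose_eq]
  rfl

theorem cubicIndex_eq (m : CubicIndex) :
    ∃ i j l, m.1 = Finsupp.single i 1 + Finsupp.single j 1 + Finsupp.single l 1 := by
  obtain ⟨i, j, l, h⟩ := Multiset.card_eq_three.1 (cubicIndexEquiv m).2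
  refine ⟨i, j, l, ?_⟩
  have h2 : Multiset.toFinsupp (cubicIndexEquiv m).1 = m.1 :=
    congrArg Subtype.val (cubicIndexEquiv.symm_apply_apply m)
  rw [← h2, h]
  simp [← Multiset.singleton_add, add_assoc, Multiset.toFinsupp_singleton]

variable {k : Type*} [Field k]

/-- The coefficients of the universal hexahedral cubic. -/
def hexMap (m : CubicIndex) : MvPolynomial HexIndex k :=
  coeff m.1 (sumCubes (hexCoeff (fun i j => X (Sum.inl (i, j))) (fun i => X (Sum.inr i))))

theorem eval_hexMap (x : HexIndex → k) (m : CubicIndex) :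
    eval x (hexMap m) = coeff m.1 (sumCubes (hexCoeff (fun i j => x (Sum.inl (i, j)))
      (fun i => x (Sum.inr i)))) := by
  rw [hexMap, ← coeff_map, map_sumCubes, map_hexCoeff]
  simp

/-- The parameters of the base point `Zᵢ = xᵢ`, `b = (0, 0, 1, 1)`. -/
def basePoint : HexIndex → k :=
  Sum.elim (fun p => if p.1 = p.2 then 1 else 0) ![0, 0, 1, 1]

/-- The derivative of `hexCoeff` at `basePoint`. -/
def baseDeriv (w : Fin 4 → Fin 4 → k) (e : Fin 4 → k) : Fin 6 → Fin 4 → k :=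
  ![w 0, w 1, w 2, w 3, fun j => e j - w 0 j - w 1 j, fun j => -(e j + w 2 j + w 3 j)]

-- Both sides are the `ε`-part of one coefficient of the universal cubic at the base point displaced
-- by `ε (w, e)`: once by Taylor expansion of the coefficient polynomial, once by substitution into
-- the sum of cubes.
open DualNumber in
theorem sum_mul_eval_pderiv_hexMap (w : Fin 4 → Fin 4 → k) (e : Fin 4 → k) (m : CubicIndex) :
    ∑ j : HexIndex, Sum.elim (fun p => w p.1 p.2) e j * eval basePoint (pderiv j (hexMap m)) =
      coeff m.1 (sumCubesDeriv (hexCoeff (fun i j => if i = j then (1 : k) else 0)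
        ![0, 0, 1, 1]) (baseDeriv w e)) := by
  have hε : (ε : k[ε]) * ε = 0 := eps_mul_eps
  rw [hexMap]
  have h := aeval_add_eps basePoint (Sum.elim (fun p => w p.1 p.2) e)
    (coeff m.1 (sumCubes (hexCoeff (fun i j => X (Sum.inl (i, j))) (fun i => X (Sum.inr i)))))
  set D := Sum.elim (fun p : Fin 4 × Fin 4 => w p.1 p.2) e with hD
  have h1 : ∀ g : MvPolynomial (Fin 4) (MvPolynomial HexIndex k),
      aeval (fun j => algebraMap k k[ε] (basePoint j) + D j • (ε : k[ε])) (coeff m.1 g) =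
      coeff m.1 (map (aeval (fun j => algebraMap k k[ε] (basePoint j) + D j • (ε : k[ε])) :
        MvPolynomial HexIndex k →ₐ[k] k[ε]).toRingHom g) := fun g => by
    rw [coeff_map]; rfl
  rw [h1, map_sumCubes, map_hexCoeff] at h
  have h2 : hexCoeff
      (fun i j => (aeval (fun j => algebraMap k k[ε] (basePoint j) + D j • (ε : k[ε])) :
        MvPolynomial HexIndex k →ₐ[k] k[ε]).toRingHom (X (Sum.inl (i, j))))
      (fun i => (aeval (fun j => algebraMap k k[ε] (basePoint j) + D j • (ε : k[ε])) :
        MvPolynomial HexIndex k →ₐ[k] k[ε]).toRingHom (X (Sum.inr i))) =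
      fun i j => algebraMap k k[ε] (hexCoeff (fun i j => if i = j then (1 : k) else 0)
        ![0, 0, 1, 1] i j) + baseDeriv w e i j • (ε : k[ε]) := by
    funext i j
    have h3 : ∀ i j, (aeval (fun j => algebraMap k k[ε] (basePoint j) + D j • (ε : k[ε])) :
        MvPolynomial HexIndex k →ₐ[k] k[ε]).toRingHom (X (Sum.inl (i, j))) =
        algebraMap k k[ε] (if i = j then (1 : k) else 0) + w i j • (ε : k[ε]) := by
      intro i j
      simp [hD, basePoint]
    have h4 : ∀ i, (aeval (fun j => algebraMap k k[ε] (basePoint j) + D j • (ε : k[ε])) :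
        MvPolynomial HexIndex k →ₐ[k] k[ε]).toRingHom (X (Sum.inr i)) =
        algebraMap k k[ε] (![0, 0, 1, 1] i) + e i • (ε : k[ε]) := by
      intro i
      simp [hD, basePoint]
    simp only [h3, h4]
    simp only [Algebra.smul_def]
    have h6 : ∀ j, ∑ i, algebraMap k k[ε] (if i = j then (1 : k) else 0) *
        algebraMap k k[ε] (e i) = algebraMap k k[ε] (e j) := by
      intro j; simp
    have h7 := h6 j
    rw [Fin.sum_univ_four] at h7
    fin_cases i <;>
      simp only [hexCoeff, baseDeriv, Fin.sum_univ_four, Fin.zero_eta, Fin.mk_one, Fin.reduceFinMk,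
        Matrix.cons_val, map_add, map_sub, map_mul, map_neg, map_one, map_zero]
    · linear_combination (algebraMap k k[ε] (e 0) * algebraMap k k[ε] (w 0 j) +
        algebraMap k k[ε] (e 1) * algebraMap k k[ε] (w 1 j) +
        algebraMap k k[ε] (e 2) * algebraMap k k[ε] (w 2 j) +
        algebraMap k k[ε] (e 3) * algebraMap k k[ε] (w 3 j)) * hε + ε * h7
    · linear_combination -(algebraMap k k[ε] (e 0) * algebraMap k k[ε] (w 0 j) +
        algebraMap k k[ε] (e 1) * algebraMap k k[ε] (w 1 j) +
        algebraMap k k[ε] (e 2) * algebraMap k k[ε] (w 2 j) +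
        algebraMap k k[ε] (e 3) * algebraMap k k[ε] (w 3 j)) * hε - ε * h7
  rw [h2, sumCubes_add_eps] at h
  have h5 := congrArg TrivSqZeroExt.snd h
  simp only [coeff_add, coeff_C_mul, coeff_map] at h5
  simp only [TrivSqZeroExt.snd_add, TrivSqZeroExt.algebraMap_eq_inl', TrivSqZeroExt.snd_inl,
    TrivSqZeroExt.snd_smul, DualNumber.snd_eps, TrivSqZeroExt.snd_mul, TrivSqZeroExt.fst_inl,
    DualNumber.fst_eps] at h5
  simpa using h5.symm
end CubicSurface
end

/-! ### Surjectivity of the derivative at the base point -/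

noncomputable section
namespace CubicSurface
variable {k : Type*} [Field k]

theorem sumCubesDeriv_add (a a₁ a₂ : Fin 6 → Fin 4 → k) :
    sumCubesDeriv a (a₁ + a₂) = sumCubesDeriv a a₁ + sumCubesDeriv a a₂ := by
  simp only [sumCubesDeriv, Pi.add_apply, C_add, add_mul, mul_add, Finset.sum_add_distrib]

theorem sumCubesDeriv_smul (c : k) (a a₁ : Fin 6 → Fin 4 → k) :
    sumCubesDeriv a (c • a₁) = c • sumCubesDeriv a a₁ := by
  simp only [sumCubesDeriv, Pi.smul_apply, smul_eq_mul, C_mul, mul_assoc, ← Finset.mul_sum,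
    smul_eq_C_mul, mul_left_comm _ (C c)]

theorem baseDeriv_add (w w' : Fin 4 → Fin 4 → k) (e e' : Fin 4 → k) :
    baseDeriv (w + w') (e + e') = baseDeriv w e + baseDeriv w' e' := by
  funext i j
  fin_cases i <;> simp [baseDeriv] <;> ring

theorem baseDeriv_smul (c : k) (w : Fin 4 → Fin 4 → k) (e : Fin 4 → k) :
    baseDeriv (c • w) (c • e) = c • baseDeriv w e := by
  funext i j
  fin_cases i <;> simp [baseDeriv] <;> ring

/-- The space of the derivatives of the universal hexahedral cubic at the base point. -/
def baseTangent : Submodule k (MvPolynomial (Fin 4) k) where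
  carrier := {q | ∃ w e, sumCubesDeriv (hexCoeff (fun i j => if i = j then (1 : k) else 0)
    ![0, 0, 1, 1]) (baseDeriv w e) = q}
  zero_mem' := ⟨0, 0, by
    have := baseDeriv_smul (0 : k) 0 0
    rw [smul_zero, smul_zero, zero_smul] at this
    rw [this, ← zero_smul k (0 : Fin 6 → Fin 4 → k), sumCubesDeriv_smul, zero_smul]⟩
  add_mem' := by
    rintro _ _ ⟨w, e, rfl⟩ ⟨w', e', rfl⟩
    exact ⟨w + w', e + e', by rw [baseDeriv_add, sumCubesDeriv_add]⟩
  smul_mem' := by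
    rintro c _ ⟨w, e, rfl⟩
    exact ⟨c • w, c • e, by rw [baseDeriv_smul, sumCubesDeriv_smul]⟩

/-- At the base point `Z₄ = -(X₀ + X₁)` and `Z₅ = -(X₂ + X₃)`. Moving `Zᵢ` by a linear form moves by
its negative the form `Z₄` if `bᵢ = 0` and `Z₅` if `bᵢ = 1`. Moving `b` by `e` adds `∑ eⱼ Xⱼ` to
`Z₄` and subtracts it from `Z₅`. -/
theorem mem_baseTangent (w : Fin 4 → Fin 4 → k) (e : Fin 4 → k) :
    3 * (∑ i, (∑ j, C (w i j) * X j) *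
      (X i ^ 2 - if i < 2 then (X 0 + X 1) ^ 2 else (X 2 + X 3) ^ 2) +
      (∑ j, C (e j) * X j) * ((X 0 + X 1) ^ 2 - (X 2 + X 3) ^ 2)) ∈ (baseTangent : Submodule k _) := by
  refine ⟨w, e, ?_⟩
  rw [sumCubesDeriv, Fin.sum_univ_six,
    Fin.sum_univ_four (fun i => (∑ j, C (w i j) * X j) * (X i ^ 2 - _))]
  have h0 : ∀ i : Fin 4, (∑ j, C (if i = j then (1 : k) else 0) * X j :
      MvPolynomial (Fin 4) k) = X i := by
    intro i
    rw [Finset.sum_eq_single i] <;> simp +contextual [eq_comm]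
  simp only [hexCoeff, baseDeriv, Matrix.cons_val, h0]
  have e1 : (∑ j, C (∑ i : Fin 4, (![0, 0, 1, 1] i - 1) * if i = j then (1 : k) else 0) * X j :
      MvPolynomial (Fin 4) k) = -(X 0 + X 1) := by
    simp [Fin.sum_univ_four]; ring
  have e2 : (∑ j, C (-∑ i : Fin 4, ![0, 0, 1, 1] i * if i = j then (1 : k) else 0) * X j :
      MvPolynomial (Fin 4) k) = -(X 2 + X 3) := by
    simp [Fin.sum_univ_four]
  have e3 : (∑ j, C (e j - w 0 j - w 1 j) * X j : MvPolynomial (Fin 4) k) =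
      (∑ j, C (e j) * X j) - (∑ j, C (w 0 j) * X j) - (∑ j, C (w 1 j) * X j) := by
    simp only [← Finset.sum_sub_distrib, ← sub_mul, C_sub]
  have e4 : (∑ j, C (-(e j + w 2 j + w 3 j)) * X j : MvPolynomial (Fin 4) k) =
      -((∑ j, C (e j) * X j) + (∑ j, C (w 2 j) * X j) + (∑ j, C (w 3 j) * X j)) := by
    simp only [← Finset.sum_add_distrib, ← add_mul, C_add, C_neg, neg_mul, Finset.sum_neg_distrib]
  rw [e1, e2, e3, e4]
  simp only [Fin.isValue, show (0 : Fin 4) < 2 from by decide, show (1 : Fin 4) < 2 from by decide,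
    show ¬(2 : Fin 4) < 2 from by decide, show ¬(3 : Fin 4) < 2 from by decide, if_true, if_false]
  ring

/-- The tangent space consists of the multiples, by arbitrary linear forms, of five quadrics, so
that its dimension can just reach `5 · 4 = 20`. Differences of squares come out of the quadrics at
once; then come the monomials with a square factor, and last the squarefree ones. -/
theorem baseTangent_eq [CharZero k] (i j l : Fin 4) :
    (X i * X j * X l : MvPolynomial (Fin 4) k) ∈ baseTangent := by
  have lin : ∀ l : Fin 4, (∑ j, C ((Pi.single l 1 : Fin 4 → k) j) * X j :
      MvPolynomial (Fin 4) k) = X l := fun l => by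
    rw [Finset.sum_eq_single l] <;> simp +contextual
  have c3 : ∀ q : MvPolynomial (Fin 4) k, 3 * q ∈ (baseTangent : Submodule k _) → q ∈ baseTangent := by
    intro q hq
    have := baseTangent.smul_mem (3⁻¹ : k) hq
    rwa [smul_eq_C_mul, ← mul_assoc, show (3 : MvPolynomial (Fin 4) k) = C 3 from (map_ofNat C 3).symm,
      ← C_mul,
      inv_mul_cancel₀ (by norm_num), C_1, one_mul] at this
  have sc : ∀ (c : k) (q q' : MvPolynomial (Fin 4) k), c ≠ 0 → C c * q' = q →
      q ∈ (baseTangent : Submodule k _) → q' ∈ baseTangent := by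
    rintro c q q' hc rfl hq
    have := baseTangent.smul_mem c⁻¹ hq
    rwa [smul_eq_C_mul, ← mul_assoc, ← C_mul, inv_mul_cancel₀ hc, C_1, one_mul] at this
  have hq : ∀ i l : Fin 4, (X l * (X i ^ 2 - if i < 2 then (X 0 + X 1) ^ 2 else (X 2 + X 3) ^ 2) :
      MvPolynomial (Fin 4) k) ∈ baseTangent := by
    intro i l
    have := c3 _ (mem_baseTangent (Pi.single i (Pi.single l 1)) 0)
    rw [Finset.sum_eq_single i] at this
    · simpa [lin] using this
    · intro b _ hb; simp [hb]
    · simp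
  have hE : ∀ l : Fin 4, (X l * ((X 0 + X 1) ^ 2 - (X 2 + X 3) ^ 2) :
      MvPolynomial (Fin 4) k) ∈ baseTangent := by
    intro l
    have := c3 _ (mem_baseTangent 0 (Pi.single l 1))
    simpa [lin] using this
  have hp0 : ∀ l : Fin 4, (X l * (X 1 ^ 2 + 2 * X 0 * X 1) : MvPolynomial (Fin 4) k) ∈ baseTangent := by
    intro l; refine sc (-1) _ _ (by norm_num) ?_ (hq 0 l); simp; ring
  have hp1 : ∀ l : Fin 4, (X l * (X 0 ^ 2 + 2 * X 0 * X 1) : MvPolynomial (Fin 4) k) ∈ baseTangent := by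
    intro l; refine sc (-1) _ _ (by norm_num) ?_ (hq 1 l); simp; ring
  have hp2 : ∀ l : Fin 4, (X l * (X 3 ^ 2 + 2 * X 2 * X 3) : MvPolynomial (Fin 4) k) ∈ baseTangent := by
    intro l; refine sc (-1) _ _ (by norm_num) ?_ (hq 2 l); simp; ring
  have hp3 : ∀ l : Fin 4, (X l * (X 2 ^ 2 + 2 * X 2 * X 3) : MvPolynomial (Fin 4) k) ∈ baseTangent := by
    intro l; refine sc (-1) _ _ (by norm_num) ?_ (hq 3 l); simp; ring
  have s13 : ∀ l : Fin 4, (X l * (X 1 ^ 2 - X 3 ^ 2) : MvPolynomial (Fin 4) k) ∈ baseTangent := by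
    intro l
    convert baseTangent.add_mem (baseTangent.sub_mem (hE l) (hp1 l)) (hp3 l) using 1; ring
  have s01 : ∀ l : Fin 4, (X l * (X 0 ^ 2 - X 1 ^ 2) : MvPolynomial (Fin 4) k) ∈ baseTangent := by
    intro l
    convert baseTangent.sub_mem (hp1 l) (hp0 l) using 1; ring
  have s23 : ∀ l : Fin 4, (X l * (X 2 ^ 2 - X 3 ^ 2) : MvPolynomial (Fin 4) k) ∈ baseTangent := by
    intro l
    convert baseTangent.sub_mem (hp3 l) (hp2 l) using 1; ring
  -- `2 X₀ (X₁² + 2 X₀X₁) - X₁ (X₀² + 2 X₀X₁) = 3 X₀² X₁`; the next three are alike.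
  have m01 : (X 1 * X 0 ^ 2 : MvPolynomial (Fin 4) k) ∈ baseTangent := by
    refine sc 3 _ _ (by norm_num) ?_ (baseTangent.sub_mem (baseTangent.smul_mem 2 (hp0 0)) (hp1 1))
    simp only [smul_eq_C_mul, map_ofNat]; ring
  have m10 : (X 0 * X 1 ^ 2 : MvPolynomial (Fin 4) k) ∈ baseTangent := by
    refine sc 3 _ _ (by norm_num) ?_ (baseTangent.sub_mem (baseTangent.smul_mem 2 (hp1 1)) (hp0 0))
    simp only [smul_eq_C_mul, map_ofNat]; ring
  have m23 : (X 3 * X 2 ^ 2 : MvPolynomial (Fin 4) k) ∈ baseTangent := by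
    refine sc 3 _ _ (by norm_num) ?_ (baseTangent.sub_mem (baseTangent.smul_mem 2 (hp2 2)) (hp3 3))
    simp only [smul_eq_C_mul, map_ofNat]; ring
  have m32 : (X 2 * X 3 ^ 2 : MvPolynomial (Fin 4) k) ∈ baseTangent := by
    refine sc 3 _ _ (by norm_num) ?_ (baseTangent.sub_mem (baseTangent.smul_mem 2 (hp3 3)) (hp2 2))
    simp only [smul_eq_C_mul, map_ofNat]; ring
  have hs1 : ∀ l : Fin 4, (X l * X 1 ^ 2 : MvPolynomial (Fin 4) k) ∈ baseTangent := by
    intro l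
    fin_cases l
    · exact m10
    · convert baseTangent.sub_mem m01 (s01 1) using 1; simp; ring
    · convert baseTangent.add_mem m32 (s13 2) using 1; simp; ring
    · convert baseTangent.add_mem (baseTangent.sub_mem m23 (s23 3)) (s13 3) using 1; simp; ring
  have hs : ∀ i l : Fin 4, (X l * X i ^ 2 : MvPolynomial (Fin 4) k) ∈ baseTangent := by
    intro i l
    fin_cases i
    · convert baseTangent.add_mem (hs1 l) (s01 l) using 1; simp; ring
    · exact hs1 l
    · convert baseTangent.add_mem (baseTangent.sub_mem (hs1 l) (s13 l)) (s23 l) using 1; simp; ring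
    · convert baseTangent.sub_mem (hs1 l) (s13 l) using 1; simp; ring
  have h01 : ∀ l : Fin 4, (X l * X 0 * X 1 : MvPolynomial (Fin 4) k) ∈ baseTangent := by
    intro l
    refine sc 2 _ _ (by norm_num) ?_ (baseTangent.sub_mem (hp0 l) (hs 1 l))
    simp only [map_ofNat]; ring
  have h23 : ∀ l : Fin 4, (X l * X 2 * X 3 : MvPolynomial (Fin 4) k) ∈ baseTangent := by
    intro l
    refine sc 2 _ _ (by norm_num) ?_ (baseTangent.sub_mem (hp2 l) (hs 3 l))
    simp only [map_ofNat]; ring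
  -- Three different indices out of four include both `0` and `1`, or both `2` and `3`.
  have comb : ∀ i j l : Fin 4, i = j ∨ i = l ∨ j = l ∨
      (∃ t, ({i, j, l} : Multiset (Fin 4)) = {t, 0, 1} ∨
        ({i, j, l} : Multiset (Fin 4)) = {t, 2, 3}) := by
    decide
  have hM : ∀ i j l : Fin 4, (X i * X j * X l : MvPolynomial (Fin 4) k) =
      (({i, j, l} : Multiset (Fin 4)).map X).prod := by
    intro i j l; simp [mul_assoc]
  rcases comb i j l with rfl | rfl | rfl | ⟨t, h | h⟩
  · convert hs i l using 1; ring
  · convert hs i j using 1; ring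
  · convert hs j i using 1; ring
  · rw [hM, h, ← hM]; exact h01 t
  · rw [hM, h, ← hM]; exact h23 t

theorem algebraicIndependent_hexMap [CharZero k] :
    AlgebraicIndependent k (hexMap : CubicIndex → MvPolynomial HexIndex k) := by
  have h : ∀ m : CubicIndex, ∃ w e, sumCubesDeriv (hexCoeff (fun i j => if i = j then (1 : k)
      else 0) ![0, 0, 1, 1]) (baseDeriv w e) = monomial m.1 1 := by
    intro m
    obtain ⟨i, j, l, hm⟩ := cubicIndex_eq m
    have := baseTangent_eq (k := k) i j l
    rw [X, X, X, monomial_mul, monomial_mul, ← hm, one_mul, one_mul] at this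
    exact this
  choose w e hwe using h
  classical
  refine algebraicIndependent_of_jacobian hexMap basePoint
    (fun m => Sum.elim (fun p => w m p.1 p.2) (e m)) fun m m' => ?_
  rw [sum_mul_eval_pderiv_hexMap, hwe, coeff_monomial]
  exact if_congr Subtype.ext_iff.symm rfl rfl

end CubicSurface
end

/-! ### Hexahedral equations of a general cubic form -/

noncomputable section
namespace CubicSurface
variable {k : Type*} [Field k]

/-- A polynomial in the constants of hexahedral equations. If neither it nor any of its conjugates
vanishes, then the Cremona planes of the double-sixes are pairwise distinct. -/
def hexDisc {R : Type*} [CommRing R] (b : Fin 6 → R) : R :=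
  (b 0 - b 1) * (b 2 + b 3 - (b 0 + b 1)) *
    ((b 2 + b 3 - (b 0 + b 1)) ^ 2 -
      2 * (b 2 + b 3 - (b 0 + b 1)) * (b 4 + b 5 - (b 0 + b 1)) +
      ((b 2 - b 3) ^ 2 - (b 0 - b 1) ^ 2))

theorem map_hexDisc {R S : Type*} [CommRing R] [CommRing S] (f : R →+* S) (b : Fin 6 → R) :
    f (hexDisc b) = hexDisc fun i => f (b i) := by
  simp only [hexDisc, map_add, map_sub, map_mul, map_pow, map_ofNat]

/-- The product of the conjugates of `hexDisc` at `b₄ = 0`, `b₅ = 1`. -/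
def hexDiscProd : MvPolynomial HexIndex k :=
  ∏ s : Equiv.Perm (Fin 6), hexDisc fun i =>
    (![X (Sum.inr 0), X (Sum.inr 1), X (Sum.inr 2), X (Sum.inr 3), 0, 1] :
      Fin 6 → MvPolynomial HexIndex k) (s i)

theorem eval_hexDiscProd (x : HexIndex → k) : eval x hexDiscProd =
    ∏ s : Equiv.Perm (Fin 6), hexDisc fun i =>
      (![x (Sum.inr 0), x (Sum.inr 1), x (Sum.inr 2), x (Sum.inr 3), 0, 1] : Fin 6 → k) (s i) := by
  rw [hexDiscProd, map_prod]
  refine Finset.prod_congr rfl fun s _ => ?_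
  rw [map_hexDisc]
  congr 1
  funext i
  generalize s i = j
  fin_cases j <;> simp

/-- A numerical witness that none of the 720 conjugates of the discriminant is the zero polynomial.
-/
theorem hexDisc_ne_zero_int : ∀ s : Equiv.Perm (Fin 6),
    hexDisc (fun i => (![2, 4, 7, 12, 0, 1] : Fin 6 → ℤ) (s i)) ≠ 0 := by
  decide +kernel

theorem hexDiscProd_ne_zero [CharZero k] : (hexDiscProd : MvPolynomial HexIndex k) ≠ 0 := by
  intro h
  have h1 := congrArg (eval (Sum.elim 0 (fun i => ((![2, 4, 7, 12] : Fin 4 → ℤ) i : k)))) h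
  rw [eval_hexDiscProd, map_zero, Finset.prod_eq_zero_iff] at h1
  obtain ⟨s, -, hs⟩ := h1
  refine hexDisc_ne_zero_int s ?_
  have h2 : ((hexDisc fun i => (![2, 4, 7, 12, 0, 1] : Fin 6 → ℤ) (s i) : ℤ) : k) = 0 := by
    refine (map_hexDisc (Int.castRingHom k) _).trans ?_
    rw [← hs]
    congr 1
    funext i
    generalize s i = j
    fin_cases j <;> simp
  exact_mod_cast h2

/-- Outside `G₁ = 0` the parametrisation is onto. The hypersurface `G₂ = 0` contains the image of
all parameters with vanishing discriminant, which is why the second assertion holds for every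
representation of `F` and not merely for one. -/
theorem exists_generic_sumCubes [IsAlgClosed k] [CharZero k] :
    ∃ G : MvPolynomial CubicIndex k, G ≠ 0 ∧ ∀ F : MvPolynomial (Fin 4) k, F.IsHomogeneous 3 →
      eval (fun m => F.coeff m.1) G ≠ 0 →
      (∃ z b, F = sumCubes (hexCoeff z b)) ∧
      ∀ z b, F = sumCubes (hexCoeff z b) → ∀ s : Equiv.Perm (Fin 6),
        hexDisc (fun i => (![b 0, b 1, b 2, b 3, 0, 1] : Fin 6 → k) (s i)) ≠ 0 := by
  have hcard : Fintype.card CubicIndex = Fintype.card HexIndex := by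
    rw [card_cubicIndex]; rfl
  obtain ⟨G₁, hG₁, h₁⟩ := exists_eval_eq_of_algebraicIndependent hexMap
    (algebraicIndependent_hexMap (k := k)) hcard
  obtain ⟨G₂, hG₂, h₂⟩ := exists_eval_eq_zero_of_hypersurface (hexMap (k := k)) hcard.ge _
    hexDiscProd_ne_zero
  refine ⟨G₁ * G₂, mul_ne_zero hG₁ hG₂, fun F hF hG => ?_⟩
  rw [map_mul] at hG
  constructor
  · obtain ⟨x, hx⟩ := h₁ _ (left_ne_zero_of_mul hG)
    refine ⟨fun i j => x (Sum.inl (i, j)), fun i => x (Sum.inr i), ext _ _ fun m => ?_⟩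
    · by_cases hm : m.degree = 3
      · rw [← hx ⟨m, hm⟩, eval_hexMap]
      · rw [hF.coeff_eq_zero hm, (isHomogeneous_sumCubes _).coeff_eq_zero hm]
  · rintro z b rfl s hs
    refine right_ne_zero_of_mul hG ?_
    let x : HexIndex → k := Sum.elim (fun p => z p.1 p.2) b
    have := h₂ x (by
      rw [eval_hexDiscProd]
      exact Finset.prod_eq_zero (Finset.mem_univ s) hs)
    simpa only [eval_hexMap, x, Sum.elim_inl, Sum.elim_inr] using this

theorem eq_sum_mul_apply (f : Module.Dual k (Fin 4 → k)) (x : Fin 4 → k) :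
    f x = ∑ j, f (Pi.single j 1) * x j := by
  conv_lhs => rw [← Finset.univ_sum_single x]
  rw [map_sum]
  refine Finset.sum_congr rfl fun j _ => ?_
  rw [mul_comm, ← smul_eq_mul, ← map_smul, ← Pi.single_smul, smul_eq_mul, mul_one]

theorem IsHexahedral.comp_perm {F : MvPolynomial (Fin 4) k}
    {Z : Fin 6 → Module.Dual k (Fin 4 → k)} {β : Fin 6 → k} (h : IsHexahedral F Z β)
    (s : Equiv.Perm (Fin 6)) : IsHexahedral F (Z ∘ s) (β ∘ s) where
  injective x hx := h.injective x fun i => by simpa using hx (s.symm i)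
  sum_eq_zero := by rw [← h.sum_eq_zero]; exact Equiv.sum_comp s Z
  sum_smul_eq_zero := by
    rw [← h.sum_smul_eq_zero]; exact Equiv.sum_comp s fun i => β i • Z i
  independent := by
    obtain ⟨i, j, hij⟩ := h.independent
    exact ⟨s.symm i, s.symm j, by simpa using hij⟩
  sum_cubes := by
    obtain ⟨c, hc, h⟩ := h.sum_cubes
    refine ⟨c, hc, fun x => ?_⟩
    rw [← h x]; exact Equiv.sum_comp s fun i => Z i x ^ 3

theorem IsHexahedral.smul {F : MvPolynomial (Fin 4) k}
    {Z : Fin 6 → Module.Dual k (Fin 4 → k)} {β : Fin 6 → k} (h : IsHexahedral F Z β)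
    {t : k} (ht : t ≠ 0) : IsHexahedral F (fun i => t • Z i) β where
  injective x hx := h.injective x fun i => by simpa [ht] using hx i
  sum_eq_zero := by rw [← Finset.smul_sum, h.sum_eq_zero, smul_zero]
  sum_smul_eq_zero := by
    simp only [smul_comm _ t]
    rw [← Finset.smul_sum, h.sum_smul_eq_zero, smul_zero]
  independent := h.independent
  sum_cubes := by
    obtain ⟨c, hc, h⟩ := h.sum_cubes
    refine ⟨t ^ 3 * c, by positivity, fun x => ?_⟩
    rw [mul_assoc, ← h x, Finset.mul_sum]
    exact Finset.sum_congr rfl fun i _ => by simp [mul_pow]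

theorem exists_perm_apply : ∀ i j : Fin 6, i ≠ j → ∃ s : Equiv.Perm (Fin 6), s 4 = i ∧ s 5 = j := by
  intro i j hij
  refine ⟨Equiv.swap (Equiv.swap 4 i 5) j * Equiv.swap 4 i, ?_, ?_⟩ <;>
  · revert i j; decide

/-- This allows the normalisation `β₄ = 0`, `β₅ = 1`. -/
theorem hexDisc_affine (β : Fin 6 → k) (t c : k) :
    hexDisc (fun i => t * (β i - c)) = t ^ 4 * hexDisc β := by
  simp only [hexDisc]; ring

/-- Arbitrary hexahedral equations reduce to the parametrised ones. After a renumbering `β₄ ≠ β₅`;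
an affine substitution makes them `0` and `1`; a cube root absorbs the constant in front of `F`; the
two linear relations then express `Z₄` and `Z₅` by the other forms. -/
theorem exists_generic_hexahedral [IsAlgClosed k] [CharZero k] :
    ForGeneralCubic (k := k) fun F => Nonsingular F →
      (∃ Z β, IsHexahedral F Z β) ∧
      ∀ Z β, IsHexahedral F Z β → ∀ s : Equiv.Perm (Fin 6), hexDisc (β ∘ s) ≠ 0 := by
  obtain ⟨G, hG, h⟩ := exists_generic_sumCubes (k := k)
  refine ⟨G, hG, fun F hF hGF hns => ?_⟩
  obtain ⟨h₁, h₂⟩ := h F hF hGF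
  constructor
  · obtain ⟨z, b, rfl⟩ := h₁
    let Z : Fin 6 → Module.Dual k (Fin 4 → k) := fun i =>
      ∑ j, hexCoeff z b i j • LinearMap.proj j
    have hZ : ∀ i x, Z i x = ∑ j, hexCoeff z b i j * x j := fun i x => by
      simp [Z, LinearMap.sum_apply]
    refine ⟨Z, ![b 0, b 1, b 2, b 3, 0, 1], ?_, ?_, ?_, ⟨4, 5, by simp⟩, 1, one_ne_zero, ?_⟩
    -- A common zero of the `Zᵢ` would be a singular point, as the sum of cubes vanishes there to
    -- third order.
    · intro x hx
      by_contra hx0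
      simp only [hZ] at hx
      obtain ⟨l, hl⟩ := hns x hx0 (by rw [eval_sumCubes]; simp [hx])
      refine hl ?_
      simp [sumCubes, map_sum, hx]
    · refine LinearMap.ext fun x => ?_
      simp only [LinearMap.sum_apply, hZ]
      rw [Finset.sum_comm]
      refine Finset.sum_eq_zero fun j _ => ?_
      rw [← Finset.sum_mul]
      simp only [Fin.sum_univ_six, hexCoeff, Matrix.cons_val, Fin.sum_univ_four]
      ring
    · refine LinearMap.ext fun x => ?_
      simp only [LinearMap.sum_apply, LinearMap.smul_apply, smul_eq_mul, hZ, Finset.mul_sum]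
      rw [Finset.sum_comm]
      refine Finset.sum_eq_zero fun j _ => ?_
      simp only [← mul_assoc]
      rw [← Finset.sum_mul]
      simp only [Fin.sum_univ_six, hexCoeff, Matrix.cons_val, Fin.sum_univ_four]
      ring
    · intro x
      rw [one_mul, eval_sumCubes]
      simp only [hZ]
  · intro Z β hZ s
    obtain ⟨i, j, hij⟩ := hZ.independent
    obtain ⟨p, rfl, rfl⟩ := exists_perm_apply i j fun e => hij (congrArg β e)
    obtain ⟨c, hc, hcF⟩ := hZ.sum_cubes
    obtain ⟨t, ht⟩ := IsAlgClosed.exists_pow_nat_eq c⁻¹ (n := 3) (by norm_num)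
    have ht0 : t ≠ 0 := by
      rintro rfl
      simp [eq_comm, hc] at ht
    have hZ' := (hZ.comp_perm p).smul ht0
    set Y : Fin 6 → Module.Dual k (Fin 4 → k) := fun i => t • (Z ∘ p) i with hY
    have hsub : β (p 5) - β (p 4) ≠ 0 := sub_ne_zero.2 fun e => hij e.symm
    set d : Fin 6 → k := fun i => (β (p 5) - β (p 4))⁻¹ * (β (p i) - β (p 4)) with hd
    have hd4 : d 4 = 0 := by simp [hd]
    have hd5 : d 5 = 1 := by simp [hd, hsub]
    have e1 : ∀ x, Y 0 x + Y 1 x + Y 2 x + Y 3 x + Y 4 x + Y 5 x = 0 := fun x => by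
      have := LinearMap.congr_fun hZ'.sum_eq_zero x
      simpa [Fin.sum_univ_six] using this
    have e2 : ∀ x, d 0 * Y 0 x + d 1 * Y 1 x + d 2 * Y 2 x + d 3 * Y 3 x + d 4 * Y 4 x
        + d 5 * Y 5 x = 0 := fun x => by
      have h3 := LinearMap.congr_fun hZ'.sum_smul_eq_zero x
      simp only [Fin.sum_univ_six, LinearMap.add_apply, LinearMap.smul_apply, smul_eq_mul,
        Function.comp_apply, LinearMap.zero_apply] at h3
      simp only [hd]
      linear_combination (β (p 5) - β (p 4))⁻¹ * h3 - (β (p 5) - β (p 4))⁻¹ * β (p 4) * e1 x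
    rw [hd4, hd5] at e2
    have hF : F = sumCubes (hexCoeff (fun i j => Y (![0, 1, 2, 3] i) (Pi.single j 1))
        (fun i => d (![0, 1, 2, 3] i))) := by
      refine MvPolynomial.funext fun x => ?_
      rw [eval_sumCubes]
      have e3 : ∀ i, ∑ j, hexCoeff (fun i j => Y (![0, 1, 2, 3] i) (Pi.single j 1))
          (fun i => d (![0, 1, 2, 3] i)) i j * x j = Y i x := by
        intro i
        rw [eq_sum_mul_apply (Y i) x]
        refine Finset.sum_congr rfl fun j _ => ?_
        congr 1
        have e1j := e1 (Pi.single j 1)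
        have e2j := e2 (Pi.single j 1)
        fin_cases i <;>
          simp only [hexCoeff, Fin.sum_univ_four, Fin.zero_eta, Fin.mk_one, Fin.reduceFinMk,
            Matrix.cons_val]
        · linear_combination e2j - e1j
        · linear_combination -e2j
      simp only [e3]
      have e4 : ∑ i, Y i x ^ 3 = t ^ 3 * ∑ i, Z i x ^ 3 := by
        rw [← Equiv.sum_comp p fun i => Z i x ^ 3, Finset.mul_sum]
        exact Finset.sum_congr rfl fun i _ => by simp [hY, mul_pow]
      rw [e4, hcF, ht]; field_simp
    have := h₂ _ _ hF (p⁻¹ * s)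
    intro h0
    refine this ?_
    have e5 : (fun i => (![d 0, d 1, d 2, d 3, 0, 1] : Fin 6 → k) ((p⁻¹ * s) i)) =
        fun i => (β (p 5) - β (p 4))⁻¹ * ((β ∘ s) i - β (p 4)) := by
      funext i
      have e6 : ∀ j, (![d 0, d 1, d 2, d 3, 0, 1] : Fin 6 → k) j = d j := by
        intro j
        fin_cases j <;> simp [hd4, hd5]
      rw [e6]
      simp [hd]
    simp only [Matrix.cons_val]
    rw [e5, hexDisc_affine, h0, mul_zero]

end CubicSurface
end

/-! ### The polar form, and linear algebra of lines and planes -/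

noncomputable section
namespace CubicSurface
variable {k : Type*} [Field k]

/-- `T` is the symmetric trilinear form of the cubic form `F`, and the surface `F = 0` is
nonsingular. -/
structure IsPolar (F : MvPolynomial (Fin 4) k)
    (T : (Fin 4 → k) →ₗ[k] (Fin 4 → k) →ₗ[k] (Fin 4 → k) →ₗ[k] k) : Prop where
  swap₁ : ∀ x y z, T x y z = T y x z
  swap₂ : ∀ x y z, T x y z = T x z y
  diag : ∀ x, T x x x = eval x F
  nonsingular : ∀ x, x ≠ 0 → ∃ w, T x x w ≠ 0

/-- The third partial derivatives, divided by `6`, are the coefficients of the polar form. Euler's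
formula gives the diagonal values, and it shows that a zero of the gradient is automatically a zero
of `F`. -/
theorem exists_isPolar [CharZero k] {F : MvPolynomial (Fin 4) k} (hF : F.IsHomogeneous 3)
    (hns : Nonsingular F) : ∃ T, IsPolar F T := by
  let c : Fin 4 → Fin 4 → Fin 4 → k := fun i j l => coeff 0 (pderiv l (pderiv j (pderiv i F)))
  let T : (Fin 4 → k) →ₗ[k] (Fin 4 → k) →ₗ[k] (Fin 4 → k) →ₗ[k] k :=
    ∑ i, ∑ j, ∑ l, (6⁻¹ * c i j l) • (LinearMap.proj i : (Fin 4 → k) →ₗ[k] k).smulRight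
      ((LinearMap.proj j : (Fin 4 → k) →ₗ[k] k).smulRight (LinearMap.proj l : (Fin 4 → k) →ₗ[k] k))
  have hT : ∀ x y z, T x y z = ∑ i, ∑ j, ∑ l, 6⁻¹ * c i j l * (x i * (y j * z l)) := by
    intro x y z
    simp [T, LinearMap.sum_apply]
  have comm : ∀ (i j : Fin 4) (p : MvPolynomial (Fin 4) k),
      pderiv i (pderiv j p) = pderiv j (pderiv i p) := by
    intro i j p
    ext m
    simp only [coeff_pderiv]
    by_cases h : i = j
    · subst h; rfl
    · have h' : ¬ j = i := fun e => h e.symm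
      rw [add_right_comm]
      simp [Finsupp.single_apply, h, h']; ring
  have e1 : ∀ i x, 2 * eval x (pderiv i F) = ∑ j, ∑ l, c i j l * (x j * x l) := by
    intro i x
    have h1 := congrArg (eval x) (hF.pderiv (i := i)).sum_X_mul_pderiv
    simp only [map_sum, map_mul, eval_X, nsmul_eq_mul, map_natCast, Nat.cast_ofNat, map_ofNat] at h1
    norm_num at h1
    rw [← h1]
    refine Finset.sum_congr rfl fun j _ => ?_
    have h2 := congrArg (eval x) ((hF.pderiv (i := i)).pderiv (i := j)).sum_X_mul_pderiv
    simp only [map_sum, map_mul, eval_X, nsmul_eq_mul, map_natCast, Nat.cast_ofNat, map_ofNat] at h2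
    norm_num at h2
    rw [← h2, Finset.mul_sum]
    refine Finset.sum_congr rfl fun l _ => ?_
    have h3 : pderiv l (pderiv j (pderiv i F)) = C (c i j l) :=
      totalDegree_eq_zero_iff_eq_C.1 (Nat.le_zero.1
        (((hF.pderiv (i := i)).pderiv (i := j)).pderiv (i := l)).totalDegree_le)
    rw [h3, eval_C]; ring
  -- `3 T(x, x, w)` is the derivative of `F` at `x` in the direction `w`.
  have e2 : ∀ x w, 3 * T x x w = ∑ l, w l * eval x (pderiv l F) := by
    intro x w
    have h1 : ∀ l, w l * eval x (pderiv l F) = ∑ j, ∑ i, 2⁻¹ * c i j l * (x i * (x j * w l)) := by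
      intro l
      rw [Finset.sum_comm]
      have := e1 l x
      have h2 : eval x (pderiv l F) = 2⁻¹ * ∑ j, ∑ i, c l j i * (x j * x i) := by
        rw [← this]; field_simp
      rw [h2, Finset.mul_sum, Finset.mul_sum]
      refine Finset.sum_congr rfl fun i _ => ?_
      rw [Finset.mul_sum, Finset.mul_sum]
      refine Finset.sum_congr rfl fun j _ => ?_
      have h3 : c l i j = c i j l := by
        simp only [c]
        rw [comm i l, comm j l]
      rw [h3]; ring
    rw [Finset.sum_congr rfl fun l _ => h1 l, Finset.sum_comm,
      Finset.sum_congr rfl fun j _ => Finset.sum_comm, Finset.sum_comm, hT]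
    simp only [Finset.mul_sum]
    refine Finset.sum_congr rfl fun i _ => Finset.sum_congr rfl fun j _ =>
      Finset.sum_congr rfl fun l _ => ?_
    ring
  refine ⟨T, ?_, ?_, ?_, ?_⟩
  · intro x y z
    rw [hT, hT, Finset.sum_comm]
    refine Finset.sum_congr rfl fun i _ => Finset.sum_congr rfl fun j _ =>
      Finset.sum_congr rfl fun l _ => ?_
    simp only [c]
    rw [comm i j]; ring
  · intro x y z
    rw [hT, hT]
    refine Finset.sum_congr rfl fun i _ => ?_
    rw [Finset.sum_comm]
    refine Finset.sum_congr rfl fun j _ => Finset.sum_congr rfl fun l _ => ?_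
    simp only [c]
    rw [comm l j]; ring
  · intro x
    have h1 := congrArg (eval x) hF.sum_X_mul_pderiv
    simp only [map_sum, map_mul, eval_X, nsmul_eq_mul, map_natCast, Nat.cast_ofNat, map_ofNat] at h1
    rw [← e2] at h1
    exact mul_left_cancel₀ (by norm_num) h1
  · intro x hx
    by_contra hc
    push Not at hc
    have h1 : eval x F = 0 := by
      have h1 := congrArg (eval x) hF.sum_X_mul_pderiv
      simp only [map_sum, map_mul, eval_X, nsmul_eq_mul, map_natCast, Nat.cast_ofNat, map_ofNat] at h1
      rw [← e2, hc] at h1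
      simpa using h1.symm
    obtain ⟨i, hi⟩ := hns x hx h1
    refine hi ?_
    have := e2 x (Pi.single i 1)
    rw [hc] at this
    simpa [Pi.single_apply] using this.symm

section Algebra

theorem exists_quadratic_zero [IsAlgClosed k] (a b c : k) :
    ∃ x y : k, (x ≠ 0 ∨ y ≠ 0) ∧ a * x ^ 2 + b * (x * y) + c * y ^ 2 = 0 := by
  by_cases ha : a = 0
  · exact ⟨1, 0, Or.inl one_ne_zero, by simp [ha]⟩
  · obtain ⟨x, hx⟩ := IsAlgClosed.exists_root
      (Polynomial.C a * Polynomial.X ^ 2 + Polynomial.C b * Polynomial.X + Polynomial.C c)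
      (by rw [Polynomial.degree_quadratic ha]; decide)
    refine ⟨x, 1, Or.inr one_ne_zero, ?_⟩
    simpa using hx

theorem exists_cubic_zero [IsAlgClosed k] (a b c d : k) :
    ∃ x y : k, (x ≠ 0 ∨ y ≠ 0) ∧
      a * x ^ 3 + b * (x ^ 2 * y) + c * (x * y ^ 2) + d * y ^ 3 = 0 := by
  by_cases ha : a = 0
  · exact ⟨1, 0, Or.inl one_ne_zero, by simp [ha]⟩
  · obtain ⟨x, hx⟩ := IsAlgClosed.exists_root
      (Polynomial.C a * Polynomial.X ^ 3 + Polynomial.C b * Polynomial.X ^ 2 +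
        Polynomial.C c * Polynomial.X + Polynomial.C d)
      (by rw [Polynomial.degree_cubic ha]; decide)
    refine ⟨x, 1, Or.inr one_ne_zero, ?_⟩
    simpa using hx

end Algebra

section LinearAlgebra

open Module

theorem finrank_ker_eq_three {g : Dual k (Fin 4 → k)} (hg : g ≠ 0) :
    finrank k (LinearMap.ker g) = 3 := by
  have h := LinearMap.finrank_range_add_finrank_ker g
  rw [LinearMap.range_eq_top.2 (LinearMap.surjective hg), finrank_top, finrank_self,
    finrank_fin_fun] at h
  omega

theorem finrank_ker_inf_ker {g h : Dual k (Fin 4 → k)} (hgh : ∀ a b : k, a • g + b • h = 0 →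
    a = 0 ∧ b = 0) : finrank k (LinearMap.ker g ⊓ LinearMap.ker h : Submodule k (Fin 4 → k)) = 2 := by
  have hli : LinearIndependent k ![g, h] := LinearIndependent.pair_iff.2 hgh
  have h1 := Subspace.finrank_add_finrank_dualCoannihilator_eq
    (Submodule.span k (Set.range ![g, h]))
  rw [finrank_span_eq_card hli, finrank_fin_fun, Fintype.card_fin] at h1
  have h2 : (Submodule.span k (Set.range ![g, h])).dualCoannihilator =
      LinearMap.ker g ⊓ LinearMap.ker h := by
    ext x
    rw [Submodule.mem_dualCoannihilator]
    refine ⟨fun H => ⟨H g (Submodule.subset_span ⟨0, rfl⟩), H h (Submodule.subset_span ⟨1, rfl⟩)⟩,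
      fun H φ hφ => ?_⟩
    induction hφ using Submodule.span_induction with
    | mem φ hφ =>
      obtain ⟨i, rfl⟩ := hφ
      fin_cases i
      · exact H.1
      · exact H.2
    | zero => rfl
    | add φ ψ _ _ h1 h2 => rw [LinearMap.add_apply, h1, h2, add_zero]
    | smul c φ _ h1 => rw [LinearMap.smul_apply, h1, smul_zero]
  rw [← h2]; omega

/-- The forms vanishing on a line make up a space of dimension two. -/
theorem exists_relation {L : Submodule k (Fin 4 → k)} (hL : finrank k L = 2)
    (g : Fin 3 → Dual k (Fin 4 → k)) (hg : ∀ i, L ≤ LinearMap.ker (g i)) :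
    ∃ c : Fin 3 → k, c ≠ 0 ∧ ∑ i, c i • g i = 0 := by
  by_contra hc
  push Not at hc
  have hli : LinearIndependent k g := by
    rw [Fintype.linearIndependent_iff]
    intro c hc0
    by_contra hne
    push Not at hne
    obtain ⟨i, hi⟩ := hne
    exact hc c (fun e => hi (congrFun e i)) hc0
  have h1 := Subspace.finrank_add_finrank_dualAnnihilator_eq L
  rw [hL, finrank_fin_fun] at h1
  have h2 : Submodule.span k (Set.range g) ≤ L.dualAnnihilator := by
    rw [Submodule.span_le]
    rintro _ ⟨i, rfl⟩
    rw [SetLike.mem_coe, Submodule.mem_dualAnnihilator]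
    exact fun x hx => hg i hx
  have h3 := Submodule.finrank_mono h2
  rw [finrank_span_eq_card hli, Fintype.card_fin] at h3
  omega

theorem eq_of_le_of_finrank_two {L M : Submodule k (Fin 4 → k)} (hL : finrank k L = 2)
    (hM : finrank k M = 2) (h : L ≤ M) : L = M :=
  Submodule.eq_of_le_of_finrank_eq h (hL.trans hM.symm)

theorem sup_eq_ker {L M : Submodule k (Fin 4 → k)} (hL : finrank k L = 2)
    (hM : finrank k M = 2) (hLM : L ≠ M) {u : Dual k (Fin 4 → k)} (hu : u ≠ 0)
    (h₁ : L ≤ LinearMap.ker u) (h₂ : M ≤ LinearMap.ker u) : L ⊔ M = LinearMap.ker u := by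
  refine Submodule.eq_of_le_of_finrank_le (sup_le h₁ h₂) ?_
  rw [finrank_ker_eq_three hu]
  by_contra hc
  have h3 : finrank k (L ⊔ M : Submodule k (Fin 4 → k)) ≤ 2 := by omega
  have h4 : L = L ⊔ M := Submodule.eq_of_le_of_finrank_le le_sup_left (by omega)
  exact hLM (eq_of_le_of_finrank_two hM hL (h4 ▸ le_sup_right)).symm

theorem inf_ne_bot_of_le_ker {L M : Submodule k (Fin 4 → k)} (hL : finrank k L = 2)
    (hM : finrank k M = 2) {u : Dual k (Fin 4 → k)} (hu : u ≠ 0)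
    (h₁ : L ≤ LinearMap.ker u) (h₂ : M ≤ LinearMap.ker u) : L ⊓ M ≠ ⊥ := by
  intro h
  have h1 := Submodule.finrank_sup_add_finrank_inf_eq L M
  have h2 := Submodule.finrank_mono (sup_le h₁ h₂)
  rw [finrank_ker_eq_three hu] at h2
  rw [h, finrank_bot] at h1
  omega

theorem inf_ker_ne_bot {L : Submodule k (Fin 4 → k)} (hL : finrank k L = 2)
    (u : Dual k (Fin 4 → k)) : L ⊓ LinearMap.ker u ≠ ⊥ := by
  intro h
  have h1 := Submodule.finrank_sup_add_finrank_inf_eq L (LinearMap.ker u)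
  have h2 := Submodule.finrank_le (L ⊔ LinearMap.ker u)
  have h3 := LinearMap.finrank_range_add_finrank_ker u
  have h4 := Submodule.finrank_le (LinearMap.range u)
  rw [finrank_self] at h4
  rw [finrank_fin_fun] at h2 h3
  rw [h, finrank_bot] at h1
  omega

theorem finrank_inf_ker {L : Submodule k (Fin 4 → k)} (hL : finrank k L = 2)
    {u : Dual k (Fin 4 → k)} (hLu : ¬ L ≤ LinearMap.ker u) :
    finrank k (L ⊓ LinearMap.ker u : Submodule k (Fin 4 → k)) ≤ 1 := by
  by_contra hc
  refine hLu ?_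
  have : L ⊓ LinearMap.ker u = L := Submodule.eq_of_le_of_finrank_le inf_le_left (by omega)
  exact this ▸ inf_le_right

theorem exists_mem_ne_zero {L M : Submodule k (Fin 4 → k)} (h : L ⊓ M ≠ ⊥) :
    ∃ x, x ≠ 0 ∧ x ∈ L ∧ x ∈ M := by
  obtain ⟨x, hx, hx0⟩ := Submodule.exists_mem_ne_zero_of_ne_bot h
  exact ⟨x, hx0, hx.1, hx.2⟩

theorem inf_ne_bot_of_mem {L M : Submodule k (Fin 4 → k)} {x : Fin 4 → k} (hx : x ≠ 0)
    (hL : x ∈ L) (hM : x ∈ M) : L ⊓ M ≠ ⊥ :=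
  fun h => hx ((Submodule.mem_bot k).1 (h ▸ ⟨hL, hM⟩))

theorem le_ker_of_mul_eq_zero [CharZero k] {L : Submodule k (Fin 4 → k)} {g h : Dual k (Fin 4 → k)}
    (H : ∀ x ∈ L, g x * h x = 0) : L ≤ LinearMap.ker g ∨ L ≤ LinearMap.ker h := by
  by_contra hc
  push Not at hc
  obtain ⟨⟨x, hx, hgx⟩, ⟨y, hy, hhy⟩⟩ := And.imp SetLike.not_le_iff_exists.1
    SetLike.not_le_iff_exists.1 hc
  rw [LinearMap.mem_ker] at hgx hhy
  have h1 : h x = 0 := (mul_eq_zero.1 (H x hx)).resolve_left hgx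
  have h2 : g y = 0 := (mul_eq_zero.1 (H y hy)).resolve_right hhy
  have h3 := H (x + y) (L.add_mem hx hy)
  rw [map_add, map_add, h1, h2, add_zero, zero_add] at h3
  exact mul_ne_zero hgx hhy h3

theorem le_ker_of_mul_mul_eq_zero [CharZero k] {L : Submodule k (Fin 4 → k)}
    {f g h : Dual k (Fin 4 → k)} (H : ∀ x ∈ L, f x * g x * h x = 0) :
    L ≤ LinearMap.ker f ∨ L ≤ LinearMap.ker g ∨ L ≤ LinearMap.ker h := by
  by_cases hL : L ≤ LinearMap.ker h
  · exact Or.inr (Or.inr hL)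
  obtain ⟨y, hy, hhy⟩ := SetLike.not_le_iff_exists.1 hL
  rw [LinearMap.mem_ker] at hhy
  have key : L ≤ LinearMap.ker f ∨ L ≤ LinearMap.ker g := by
    refine le_ker_of_mul_eq_zero fun x hx => ?_
    by_cases hhx : h x = 0
    · have H2 : ∀ t : k, t ≠ 0 → (f x + t * f y) * (g x + t * g y) = 0 := fun t ht => by
        have := H (x + t • y) (L.add_mem hx (L.smul_mem t hy))
        simp only [map_add, map_smul, smul_eq_mul, hhx, zero_add] at this
        exact (mul_eq_zero.1 this).resolve_right (mul_ne_zero ht hhy)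
      have h1 := H2 1 one_ne_zero
      have h2 := H2 (-1) (by norm_num)
      have h3 := H2 2 (by norm_num)
      linear_combination h1 + h2 / 3 - h3 / 3
    · exact (mul_eq_zero.1 (H x hx)).resolve_right hhx
  exact key.imp_right Or.inl

theorem exists_span_pair {L : Submodule k (Fin 4 → k)} (hL : finrank k L = 2) {p : Fin 4 → k}
    (hp : p ∈ L) (hp0 : p ≠ 0) : ∃ e ∈ L, (∀ a b : k, a • p + b • e = 0 → a = 0 ∧ b = 0) ∧
      ∀ x ∈ L, ∃ a b : k, x = a • p + b • e := by
  have h1 : ¬ L ≤ Submodule.span k {p} := fun h => by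
    have := Submodule.finrank_mono h
    rw [finrank_span_singleton hp0] at this
    omega
  obtain ⟨e, he, hep⟩ := SetLike.not_le_iff_exists.1 h1
  have hli : ∀ a b : k, a • p + b • e = 0 → a = 0 ∧ b = 0 := by
    intro a b hab
    have hb : b = 0 := by
      by_contra hb
      refine hep (Submodule.mem_span_singleton.2 ⟨-(b⁻¹ * a), ?_⟩)
      have h2 := congrArg (b⁻¹ • ·) hab
      simp only [smul_add, smul_smul, inv_mul_cancel₀ hb, one_smul, smul_zero] at h2
      rw [neg_smul, neg_eq_iff_add_eq_zero, h2]
    rw [hb, zero_smul, add_zero] at hab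
    exact ⟨(smul_eq_zero.1 hab).resolve_right hp0, hb⟩
  refine ⟨e, he, hli, fun x hx => ?_⟩
  have h3 : Submodule.span k (Set.range ![p, e]) = L := by
    refine Submodule.eq_of_le_of_finrank_eq ?_ ?_
    · rw [Submodule.span_le]
      rintro _ ⟨i, rfl⟩
      fin_cases i
      · exact hp
      · exact he
    · rw [finrank_span_eq_card (LinearIndependent.pair_iff.2 hli), hL, Fintype.card_fin]
  rw [← h3, Matrix.range_cons_cons_empty, Submodule.mem_span_pair] at hx
  obtain ⟨a, b, h⟩ := hx
  exact ⟨a, b, h.symm⟩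

end LinearAlgebra
end CubicSurface
end

/-! ### Coplanar lines on a nonsingular cubic surface -/

noncomputable section
namespace CubicSurface
open Module
variable {k : Type*} [Field k] {F : MvPolynomial (Fin 4) k}
  {T : (Fin 4 → k) →ₗ[k] (Fin 4 → k) →ₗ[k] (Fin 4 → k) →ₗ[k] k}

theorem IsPolar.eval_add (hT : IsPolar F T) (x y : Fin 4 → k) :
    eval (x + y) F = eval x F + 3 * T x x y + 3 * T x y y + eval y F := by
  rw [← hT.diag, ← hT.diag, ← hT.diag]
  simp only [map_add, LinearMap.add_apply]
  rw [hT.swap₁ y x x, hT.swap₂ x y x, hT.swap₁ y x y, hT.swap₂ y y x, hT.swap₁ y x y]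
  ring

theorem IsPolar.eval_smul (hT : IsPolar F T) (t : k) (x : Fin 4 → k) :
    eval (t • x) F = t ^ 3 * eval x F := by
  rw [← hT.diag, ← hT.diag]
  simp only [map_smul, LinearMap.smul_apply, smul_eq_mul]
  ring

theorem IsPolar.gradient [CharZero k] (hT : IsPolar F T) (x y : Fin 4 → k) :
    6 * T x x y = eval (x + y) F - eval (x - y) F - 2 * eval y F := by
  have h1 := hT.eval_add x y
  have h2 := hT.eval_add x ((-1 : k) • y)
  rw [hT.eval_smul, neg_one_smul, ← sub_eq_add_neg] at h2
  simp only [map_neg, LinearMap.neg_apply] at h2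
  linear_combination h2 - h1

theorem IsPolar.eq_zero_of_mem_line [CharZero k] (hT : IsPolar F T)
    {L : Submodule k (Fin 4 → k)} (hL : IsLineOn F L) {x y z : Fin 4 → k} (hx : x ∈ L)
    (hy : y ∈ L) (hz : z ∈ L) : T x y z = 0 := by
  have h1 : ∀ x ∈ L, ∀ y ∈ L, T x x y = 0 := fun x hx y hy => by
    have := hT.gradient x y
    rw [hL.2 _ (L.add_mem hx hy), hL.2 _ (L.sub_mem hx hy), hL.2 _ hy] at this
    simpa using this
  have h2 := h1 _ (L.add_mem hx hy) _ hz
  simp only [map_add, LinearMap.add_apply] at h2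
  rw [h1 x hx z hz, h1 y hy z hz, hT.swap₁ y x z] at h2
  have h3 : (2 : k) * T x y z = 0 := by linear_combination h2
  simpa using h3

/-- No plane is tangent to a nonsingular cubic surface along a line. -/
theorem IsPolar.not_tangent_along [CharZero k] [IsAlgClosed k] (hT : IsPolar F T)
    {L : Submodule k (Fin 4 → k)} (hL : finrank k L = 2) {u : Dual k (Fin 4 → k)} (hu : u ≠ 0)
    (H : ∀ q ∈ L, ∀ w, u w = 0 → T q q w = 0) : False := by
  obtain ⟨d, hd⟩ := LinearMap.surjective hu 1
  obtain ⟨p, hp, hp0⟩ := Submodule.exists_mem_ne_zero_of_ne_bot (p := L)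
    (fun h => by rw [h, finrank_bot] at hL; omega)
  obtain ⟨e, he, hli, -⟩ := exists_span_pair hL hp hp0
  -- If the plane were tangent along `L`, only the derivative in a transversal direction `d` could
  -- be nonzero on `L`. It is a quadratic form there, so it has a zero, which would be a singular
  -- point.
  obtain ⟨x, y, hxy, h0⟩ := exists_quadratic_zero (T p p d) (2 * T p e d) (T e e d)
  have hq : x • p + y • e ≠ 0 := fun h => by
    have := hli x y h
    rcases hxy with h | h
    · exact h this.1
    · exact h this.2
  obtain ⟨w, hw⟩ := hT.nonsingular _ hq
  refine hw ?_
  have h1 := H _ (L.add_mem (L.smul_mem x hp) (L.smul_mem y he)) (w - u w • d) (by simp [hd])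
  have h2 : T (x • p + y • e) (x • p + y • e) d = 0 := by
    simp only [map_add, map_smul, LinearMap.add_apply, LinearMap.smul_apply, smul_eq_mul]
    rw [hT.swap₁ e p d]
    linear_combination h0
  rw [map_sub, map_smul, h2, smul_zero, sub_zero] at h1
  exact h1

/-- Two lines of the surface that meet lie in a plane, which cuts out a third line. -/
theorem IsPolar.exists_third_form [CharZero k] [IsAlgClosed k] (hT : IsPolar F T)
    {L M : Submodule k (Fin 4 → k)} (hL : IsLineOn F L) (hM : IsLineOn F M) (hne : L ≠ M)
    (hLM : L ⊓ M ≠ ⊥) : ∃ u l m n : Dual k (Fin 4 → k), u ≠ 0 ∧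
      L = LinearMap.ker u ⊓ LinearMap.ker l ∧ M = LinearMap.ker u ⊓ LinearMap.ker m ∧
      finrank k (LinearMap.ker u ⊓ LinearMap.ker n : Submodule k (Fin 4 → k)) = 2 ∧
      LinearMap.ker u ⊓ LinearMap.ker n ≠ L ∧ LinearMap.ker u ⊓ LinearMap.ker n ≠ M ∧
      ∀ x, u x = 0 → eval x F = l x * m x * n x := by
  obtain ⟨p, hp0, hpL, hpM⟩ := exists_mem_ne_zero hLM
  obtain ⟨e, he, hpe, hL2⟩ := exists_span_pair hL.1 hpL hp0
  obtain ⟨f, hf, hpf, hM2⟩ := exists_span_pair hM.1 hpM hp0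
  have hfL : f ∉ L := fun h => by
    refine hne (eq_of_le_of_finrank_two hM.1 hL.1 fun x hx => ?_).symm
    obtain ⟨a, b, rfl⟩ := hM2 x hx
    exact L.add_mem (L.smul_mem _ hpL) (L.smul_mem _ h)
  have hli : LinearIndependent k ![p, e, f] := by
    rw [Fintype.linearIndependent_iff]
    intro c hc
    simp only [Fin.sum_univ_three, Matrix.cons_val] at hc
    have h2 : c 2 = 0 := by
      by_contra h2
      refine hfL ?_
      have : f = (-(c 2)⁻¹) • (c 0 • p + c 1 • e) := by
        have h3 : c 0 • p + c 1 • e = -(c 2 • f) := eq_neg_of_add_eq_zero_left hc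
        rw [h3, neg_smul, smul_neg, neg_neg, smul_smul, inv_mul_cancel₀ h2, one_smul]
      rw [this]
      exact L.smul_mem _ (L.add_mem (L.smul_mem _ hpL) (L.smul_mem _ he))
    rw [h2, zero_smul, add_zero] at hc
    have := hpe _ _ hc
    intro i
    fin_cases i
    · exact this.1
    · exact this.2
    · exact h2
  obtain ⟨d, hd⟩ : ∃ d, d ∉ Submodule.span k (Set.range ![p, e, f]) := by
    by_contra hc
    push Not at hc
    have h1 := finrank_span_eq_card hli
    rw [(Submodule.eq_top_iff').2 hc, finrank_top, finrank_fin_fun, Fintype.card_fin] at h1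
    omega
  have hli4 : LinearIndependent k (Fin.cons d ![p, e, f] : Fin 4 → Fin 4 → k) :=
    linearIndependent_finCons.2 ⟨hli, hd⟩
  -- Coordinates dual to the basis `d, p, e, f`. In the plane `u = 0` the two lines are `z' = 0` and
  -- `y' = 0`, so the restriction of `F` is divisible by `y' z'`.
  obtain ⟨u, x', y', z', hrep, ⟨up, ue, uf, ud⟩, ⟨xp, xe, xf⟩, ⟨yp, ye, yf⟩, zp, ze, zf⟩ :
      ∃ u x' y' z' : Dual k (Fin 4 → k),
      (∀ v, v = u v • d + x' v • p + y' v • e + z' v • f) ∧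
      (u p = 0 ∧ u e = 0 ∧ u f = 0 ∧ u d = 1) ∧ (x' p = 1 ∧ x' e = 0 ∧ x' f = 0) ∧
      (y' p = 0 ∧ y' e = 1 ∧ y' f = 0) ∧ z' p = 0 ∧ z' e = 0 ∧ z' f = 1 := by
    let B := basisOfLinearIndependentOfCardEqFinrank hli4 (by simp)
    have hB : ∀ i, B i = (Fin.cons d ![p, e, f] : Fin 4 → Fin 4 → k) i := fun i => by simp [B]
    have hcoord : ∀ i j, B.coord i ((Fin.cons d ![p, e, f] : Fin 4 → Fin 4 → k) j) =
        if i = j then 1 else 0 := by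
      intro i j
      rw [← hB, Basis.coord_apply, Basis.repr_self, Finsupp.single_apply]
      exact if_congr eq_comm rfl rfl
    refine ⟨B.coord 0, B.coord 1, B.coord 2, B.coord 3, fun v => ?_,
      ⟨hcoord 0 1, hcoord 0 2, hcoord 0 3, hcoord 0 0⟩,
      ⟨hcoord 1 1, hcoord 1 2, hcoord 1 3⟩, ⟨hcoord 2 1, hcoord 2 2, hcoord 2 3⟩,
      hcoord 3 1, hcoord 3 2, hcoord 3 3⟩
    conv_lhs => rw [← B.sum_repr v]
    rw [Fin.sum_univ_four, hB, hB, hB, hB]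
    rfl
  -- The remaining linear factor, read off from the expansion of `F(x'p + y'e + z'f)`.
  obtain ⟨n, hn⟩ : ∃ n : Dual k (Fin 4 → k), ∀ v, n v =
      6 * T p e f * x' v + 3 * T e e f * y' v + 3 * T e f f * z' v :=
    ⟨(6 * T p e f) • x' + (3 * T e e f) • y' + (3 * T e f f) • z', fun v => by simp⟩
  have hu0 : u ≠ 0 := fun h => by
    rw [h] at ud; simp at ud
  have hLeq : L = LinearMap.ker u ⊓ LinearMap.ker z' := by
    apply le_antisymm
    · intro v hv
      obtain ⟨a, b, rfl⟩ := hL2 v hv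
      constructor <;> simp [up, ue, zp, ze]
    · rintro v ⟨h1, h2⟩
      replace h1 : u v = 0 := h1
      replace h2 : z' v = 0 := h2
      rw [hrep v, h1, h2, zero_smul, zero_smul, zero_add, add_zero]
      exact L.add_mem (L.smul_mem _ hpL) (L.smul_mem _ he)
  have hMeq : M = LinearMap.ker u ⊓ LinearMap.ker y' := by
    apply le_antisymm
    · intro v hv
      obtain ⟨a, b, rfl⟩ := hM2 v hv
      constructor <;> simp [up, uf, yp, yf]
    · rintro v ⟨h1, h2⟩
      replace h1 : u v = 0 := h1
      replace h2 : y' v = 0 := h2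
      rw [hrep v, h1, h2, zero_smul, zero_smul, zero_add, add_zero]
      exact M.add_mem (M.smul_mem _ hpM) (M.smul_mem _ hf)
  have hL0 : ∀ {x y z}, x ∈ L → y ∈ L → z ∈ L → T x y z = 0 := hT.eq_zero_of_mem_line hL
  have hM0 : ∀ {x y z}, x ∈ M → y ∈ M → z ∈ M → T x y z = 0 := hT.eq_zero_of_mem_line hM
  -- If `n` vanished at `p` and `e`, its line would be `L` and the plane would be tangent along `L`.
  have nL : ¬ (T p e f = 0 ∧ T e e f = 0) := by
    rintro ⟨h1, h2⟩
    refine hT.not_tangent_along hL.1 hu0 fun q hq w hw => ?_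
    obtain ⟨a, b, rfl⟩ := hL2 q hq
    rw [hrep w, hw, zero_smul, zero_add, map_add, map_add, map_smul, map_smul, map_smul,
      hL0 hq hq hpL, hL0 hq hq he]
    simp only [map_add, map_smul, LinearMap.add_apply, LinearMap.smul_apply, smul_eq_mul]
    rw [hT.swap₁ e p f, h1, h2, hM0 hpM hpM hf]
    ring
  have nM : ¬ (T p e f = 0 ∧ T e f f = 0) := by
    rintro ⟨h1, h2⟩
    refine hT.not_tangent_along hM.1 hu0 fun q hq w hw => ?_
    obtain ⟨a, b, rfl⟩ := hM2 q hq
    rw [hrep w, hw, zero_smul, zero_add, map_add, map_add, map_smul, map_smul, map_smul,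
      hM0 hq hq hpM, hM0 hq hq hf]
    simp only [map_add, map_smul, LinearMap.add_apply, LinearMap.smul_apply, smul_eq_mul]
    rw [hT.swap₁ f p e, hT.swap₂ p f e, h1, hT.swap₂ f f e, hT.swap₁ f e f, h2, hL0 hpL hpL he]
    ring
  have np : n p = 6 * T p e f := by simp [hn, xp, yp, zp]
  have ne : n e = 3 * T e e f := by simp [hn, xe, ye, ze]
  have nf : n f = 3 * T e f f := by simp [hn, xf, yf, zf]
  refine ⟨u, z', y', n, hu0, hLeq, hMeq, finrank_ker_inf_ker fun a b hab => ?_, fun h => ?_,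
    fun h => ?_, fun v hv => ?_⟩
  · have hb : b = 0 := by
      by_contra hb
      have h1 := LinearMap.congr_fun hab p
      have h2 := LinearMap.congr_fun hab e
      simp only [LinearMap.add_apply, LinearMap.smul_apply, np, ne, smul_eq_mul,
        LinearMap.zero_apply, up, ue] at h1 h2
      norm_num [hb] at h1 h2
      exact nL ⟨h1, h2⟩
    rw [hb, zero_smul, add_zero] at hab
    exact ⟨(smul_eq_zero.1 hab).resolve_right hu0, hb⟩
  · have h1 : n p = 0 := (h ▸ hpL : p ∈ LinearMap.ker u ⊓ LinearMap.ker n).2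
    have h2 : n e = 0 := (h ▸ he : e ∈ LinearMap.ker u ⊓ LinearMap.ker n).2
    rw [np] at h1
    rw [ne] at h2
    norm_num at h1 h2
    exact nL ⟨h1, h2⟩
  · have h1 : n p = 0 := (h ▸ hpM : p ∈ LinearMap.ker u ⊓ LinearMap.ker n).2
    have h2 : n f = 0 := (h ▸ hf : f ∈ LinearMap.ker u ⊓ LinearMap.ker n).2
    rw [np] at h1
    rw [nf] at h2
    norm_num at h1 h2
    exact nM ⟨h1, h2⟩
  · have h1 := hrep v
    rw [hv, zero_smul, zero_add] at h1
    rw [hn]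
    generalize x' v = a at h1 ⊢
    generalize y' v = b at h1 ⊢
    generalize z' v = c at h1 ⊢
    subst h1
    rw [add_assoc, hT.eval_add, hT.eval_add, hT.eval_smul, hT.eval_smul, hT.eval_smul,
      hL.2 p hpL, hL.2 e he, hM.2 f hf]
    simp only [map_add, map_smul, LinearMap.add_apply, LinearMap.smul_apply, smul_eq_mul]
    rw [hL0 hpL hpL he, hL0 hpL he he, hM0 hpM hpM hf, hM0 hpM hf hf, hT.swap₂ p f e]
    ring

/-- Three distinct coplanar lines on the surface. -/
structure IsTri (F : MvPolynomial (Fin 4) k) (L M N : Submodule k (Fin 4 → k)) : Prop where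
  line₁ : IsLineOn F L
  line₂ : IsLineOn F M
  line₃ : IsLineOn F N
  ne₁₂ : L ≠ M
  ne₁₃ : L ≠ N
  ne₂₃ : M ≠ N
  coplanar : ∃ u : Dual k (Fin 4 → k), u ≠ 0 ∧ L ≤ LinearMap.ker u ∧ M ≤ LinearMap.ker u ∧
    N ≤ LinearMap.ker u

theorem IsTri.swap₁₂ {L M N : Submodule k (Fin 4 → k)} (h : IsTri F L M N) : IsTri F M L N :=
  ⟨h.line₂, h.line₁, h.line₃, h.ne₁₂.symm, h.ne₂₃, h.ne₁₃, by
    obtain ⟨u, hu, h1, h2, h3⟩ := h.coplanar; exact ⟨u, hu, h2, h1, h3⟩⟩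

theorem IsTri.swap₂₃ {L M N : Submodule k (Fin 4 → k)} (h : IsTri F L M N) : IsTri F L N M :=
  ⟨h.line₁, h.line₃, h.line₂, h.ne₁₃, h.ne₁₂, h.ne₂₃.symm, by
    obtain ⟨u, hu, h1, h2, h3⟩ := h.coplanar; exact ⟨u, hu, h1, h3, h2⟩⟩

theorem IsTri.meets₁₂ {L M N : Submodule k (Fin 4 → k)} (h : IsTri F L M N) : L ⊓ M ≠ ⊥ := by
  obtain ⟨u, hu, h1, h2, -⟩ := h.coplanar
  exact inf_ne_bot_of_le_ker h.line₁.1 h.line₂.1 hu h1 h2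

theorem IsPolar.exists_isTri [CharZero k] [IsAlgClosed k] (hT : IsPolar F T)
    {L M : Submodule k (Fin 4 → k)} (hL : IsLineOn F L) (hM : IsLineOn F M) (hne : L ≠ M)
    (hLM : L ⊓ M ≠ ⊥) : ∃ N, IsTri F L M N := by
  obtain ⟨u, l, m, n, hu, hLeq, hMeq, hN, hNL, hNM, hF⟩ := hT.exists_third_form hL hM hne hLM
  refine ⟨LinearMap.ker u ⊓ LinearMap.ker n, hL, hM, ⟨hN, fun x hx => ?_⟩, hne, hNL.symm,
    hNM.symm, u, hu, hLeq ▸ inf_le_left, hMeq ▸ inf_le_left, inf_le_left⟩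
  have : n x = 0 := hx.2
  rw [hF x hx.1, this, mul_zero]

/-- A plane contains at most three lines of the surface. -/
theorem IsPolar.eq_of_le_ker [CharZero k] [IsAlgClosed k] (hT : IsPolar F T)
    {L M N K : Submodule k (Fin 4 → k)} (h : IsTri F L M N) (hK : IsLineOn F K)
    {u : Dual k (Fin 4 → k)} (hu : u ≠ 0) (h₁ : L ≤ LinearMap.ker u) (h₂ : M ≤ LinearMap.ker u)
    (h₃ : K ≤ LinearMap.ker u) : K = L ∨ K = M ∨ K = N := by
  obtain ⟨v, l, m, n, hv, hLeq, hMeq, hN', hNL, hNM, hF⟩ :=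
    hT.exists_third_form h.line₁ h.line₂ h.ne₁₂ h.meets₁₂
  have huv : LinearMap.ker u = LinearMap.ker v := by
    rw [← sup_eq_ker h.line₁.1 h.line₂.1 h.ne₁₂ hu h₁ h₂,
      sup_eq_ker h.line₁.1 h.line₂.1 h.ne₁₂ hv (hLeq ▸ inf_le_left) (hMeq ▸ inf_le_left)]
  have key : ∀ K', IsLineOn F K' → K' ≤ LinearMap.ker u →
      K' = L ∨ K' = M ∨ K' = LinearMap.ker v ⊓ LinearMap.ker n := by
    intro K' hK' hK'u
    rw [huv] at hK'u
    rcases le_ker_of_mul_mul_eq_zero (L := K') (f := l) (g := m) (h := n) (fun x hx => by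
      rw [← hF x (hK'u hx), hK'.2 x hx]) with h4 | h4 | h4
    · exact Or.inl (eq_of_le_of_finrank_two hK'.1 h.line₁.1 (hLeq ▸ le_inf hK'u h4))
    · exact Or.inr (Or.inl (eq_of_le_of_finrank_two hK'.1 h.line₂.1 (hMeq ▸ le_inf hK'u h4)))
    · exact Or.inr (Or.inr (eq_of_le_of_finrank_two hK'.1 hN' (le_inf hK'u h4)))
  have hNu : N ≤ LinearMap.ker u := by
    obtain ⟨w, hw, hw1, hw2, hw3⟩ := h.coplanar
    rw [← sup_eq_ker h.line₁.1 h.line₂.1 h.ne₁₂ hu h₁ h₂,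
      sup_eq_ker h.line₁.1 h.line₂.1 h.ne₁₂ hw hw1 hw2]
    exact hw3
  have hN2 : N = LinearMap.ker v ⊓ LinearMap.ker n := by
    rcases key N h.line₃ hNu with h5 | h5 | h5
    · exact absurd h5.symm h.ne₁₃
    · exact absurd h5.symm h.ne₂₃
    · exact h5
  rw [hN2]
  exact key K hK h₃

/-- Three lines that meet pairwise are coplanar. -/
theorem IsPolar.le_ker_of_meets [CharZero k] (hT : IsPolar F T)
    {L M K : Submodule k (Fin 4 → k)} (hL : IsLineOn F L) (hM : IsLineOn F M) (hne : L ≠ M)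
    (hK : IsLineOn F K) {u : Dual k (Fin 4 → k)} (hu : u ≠ 0) (h₁ : L ≤ LinearMap.ker u)
    (h₂ : M ≤ LinearMap.ker u) (hKL : K ⊓ L ≠ ⊥) (hKM : K ⊓ M ≠ ⊥) : K ≤ LinearMap.ker u := by
  by_contra hc
  obtain ⟨q, hq0, hqK, hqL⟩ := exists_mem_ne_zero hKL
  obtain ⟨r, hr0, hrK, hrM⟩ := exists_mem_ne_zero hKM
  have h1 := finrank_inf_ker hK.1 hc
  -- A line not contained in the plane meets it in a single point, so the points on `L` and on `M`
  -- coincide.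
  have h2 : q ∈ M := by
    obtain ⟨v, hv⟩ := finrank_le_one_iff.1 h1
    obtain ⟨a, ha⟩ := hv ⟨q, hqK, h₁ hqL⟩
    obtain ⟨b, hb⟩ := hv ⟨r, hrK, h₂ hrM⟩
    have ha' := congrArg Subtype.val ha
    have hb' := congrArg Subtype.val hb
    simp only [Submodule.coe_smul] at ha' hb'
    have hb0 : b ≠ 0 := by rintro rfl; rw [zero_smul] at hb'; exact hr0 hb'.symm
    have : q = (a * b⁻¹) • r := by
      rw [← ha', ← hb', smul_smul, mul_assoc, inv_mul_cancel₀ hb0, mul_one]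
    rw [this]
    exact M.smul_mem _ hrM
  -- All lines of the surface through `q` lie in the tangent plane at `q`, which is therefore the
  -- plane of `L` and `M`.
  have hg : T q q ≠ 0 := fun h => by
    obtain ⟨w, hw⟩ := hT.nonsingular q hq0
    exact hw (by rw [h]; rfl)
  refine hc ?_
  rw [← sup_eq_ker hL.1 hM.1 hne hu h₁ h₂,
    sup_eq_ker hL.1 hM.1 hne hg (fun w hw => hT.eq_zero_of_mem_line hL hqL hqL hw)
      (fun w hw => hT.eq_zero_of_mem_line hM h2 h2 hw)]
  exact fun w hw => hT.eq_zero_of_mem_line hK hqK hqK hw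

theorem IsPolar.isTri_of_meets [CharZero k] [IsAlgClosed k] (hT : IsPolar F T)
    {L M K : Submodule k (Fin 4 → k)} (hL : IsLineOn F L) (hM : IsLineOn F M) (hK : IsLineOn F K)
    (hLM : L ≠ M) (hLK : L ≠ K) (hMK : M ≠ K) (h₁ : L ⊓ M ≠ ⊥) (h₂ : L ⊓ K ≠ ⊥)
    (h₃ : M ⊓ K ≠ ⊥) : IsTri F L M K := by
  obtain ⟨N, hN⟩ := hT.exists_isTri hL hM hLM h₁
  obtain ⟨u, hu, hu1, hu2, -⟩ := hN.coplanar
  exact ⟨hL, hM, hK, hLM, hLK, hMK, u, hu, hu1, hu2,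
    hT.le_ker_of_meets hL hM hLM hK hu hu1 hu2 (inf_comm L K ▸ h₂) (inf_comm M K ▸ h₃)⟩

/-- A line of the surface that meets two lines of a coplanar triple belongs to the triple. -/
theorem IsPolar.eq_of_meets [CharZero k] [IsAlgClosed k] (hT : IsPolar F T)
    {L M N K : Submodule k (Fin 4 → k)} (h : IsTri F L M N) (hK : IsLineOn F K)
    (hKL : K ⊓ L ≠ ⊥) (hKM : K ⊓ M ≠ ⊥) : K = L ∨ K = M ∨ K = N := by
  obtain ⟨u, hu, h1, h2, -⟩ := h.coplanar
  exact hT.eq_of_le_ker h hK hu h1 h2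
    (hT.le_ker_of_meets h.line₁ h.line₂ h.ne₁₂ hK hu h1 h2 hKL hKM)

/-- Every line of the surface meets one of the lines of a coplanar triple. -/
theorem IsPolar.meets_tri [CharZero k] [IsAlgClosed k] (hT : IsPolar F T)
    {L M N K : Submodule k (Fin 4 → k)} (h : IsTri F L M N) (hK : IsLineOn F K) :
    K ⊓ L ≠ ⊥ ∨ K ⊓ M ≠ ⊥ ∨ K ⊓ N ≠ ⊥ := by
  obtain ⟨u, l, m, n, hu, hLeq, hMeq, hN', hNL, hNM, hF⟩ :=
    hT.exists_third_form h.line₁ h.line₂ h.ne₁₂ h.meets₁₂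
  have hN2 : LinearMap.ker u ⊓ LinearMap.ker n = N := by
    have hl : IsLineOn F (LinearMap.ker u ⊓ LinearMap.ker n) :=
      ⟨hN', fun x hx => by rw [hF x hx.1, show n x = 0 from hx.2, mul_zero]⟩
    rcases hT.eq_of_le_ker h hl hu (hLeq ▸ inf_le_left) (hMeq ▸ inf_le_left) inf_le_left with
      h5 | h5 | h5
    · exact absurd h5 hNL
    · exact absurd h5 hNM
    · exact h5
  obtain ⟨p, hp0, hpK, hpu⟩ := exists_mem_ne_zero (inf_ker_ne_bot hK.1 u)
  have h1 := hF p hpu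
  rw [hK.2 p hpK, eq_comm, mul_eq_zero, mul_eq_zero] at h1
  rcases h1 with (h1 | h1) | h1
  · exact Or.inl (inf_ne_bot_of_mem hp0 hpK (hLeq ▸ ⟨hpu, h1⟩))
  · exact Or.inr (Or.inl (inf_ne_bot_of_mem hp0 hpK (hMeq ▸ ⟨hpu, h1⟩)))
  · exact Or.inr (Or.inr (inf_ne_bot_of_mem hp0 hpK (hN2 ▸ ⟨hpu, h1⟩)))

end CubicSurface
end

/-! ### Steiner's form of the equation and its root relations -/

noncomputable section
namespace CubicSurface
open Module
variable {k : Type*} [Field k] {F : MvPolynomial (Fin 4) k}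
  {T : (Fin 4 → k) →ₗ[k] (Fin 4 → k) →ₗ[k] (Fin 4 → k) →ₗ[k] k}
  {u v : Fin 3 → Dual k (Fin 4 → k)} {a b : Fin 3 → k}

/-- The cubic form `F` is, up to a constant, the sum of the products `u₀u₁u₂` and `v₀v₁v₂`. -/
def IsSteiner (F : MvPolynomial (Fin 4) k) (u v : Fin 3 → Dual k (Fin 4 → k)) : Prop :=
  ∃ c : k, c ≠ 0 ∧ ∀ x, ∏ i, u i x + ∏ j, v j x = c * eval x F

/-- The linear relation `∑ aᵢ uᵢ + ∑ bⱼ vⱼ = 0`. -/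
def IsRel (u v : Fin 3 → Dual k (Fin 4 → k)) (a b : Fin 3 → k) : Prop :=
  ∀ x, ∑ i, a i * u i x + ∑ j, b j * v j x = 0

theorem sum_rotate {M : Type*} [AddCommMonoid M] (f : Fin 3 → M) (i : Fin 3) :
    ∑ j, f j = f i + f (i + 1) + f (i + 2) := by
  rw [Fin.sum_univ_three]
  fin_cases i
  · rfl
  · change f 0 + f 1 + f 2 = f 1 + f 2 + f 0
    abel
  · change f 0 + f 1 + f 2 = f 2 + f 0 + f 1
    abel

theorem prod_rotate {M : Type*} [CommMonoid M] (f : Fin 3 → M) (i : Fin 3) :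
    ∏ j, f j = f i * f (i + 1) * f (i + 2) := by
  rw [Fin.prod_univ_three]
  fin_cases i
  · rfl
  · change f 0 * f 1 * f 2 = f 1 * f 2 * f 0
    rw [mul_assoc, mul_comm]
  · change f 0 * f 1 * f 2 = f 2 * f 0 * f 1
    rw [mul_comm, mul_assoc]

theorem eq_rotate (i j : Fin 3) : j = i ∨ j = i + 1 ∨ j = i + 2 := by
  revert i j; decide

theorem IsSteiner.symm (h : IsSteiner F u v) : IsSteiner F v u := by
  obtain ⟨c, hc, h⟩ := h
  exact ⟨c, hc, fun x => by rw [← h, add_comm]⟩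

theorem IsRel.add {a' b' : Fin 3 → k} (h : IsRel u v a b) (h' : IsRel u v a' b') (s t : k) :
    IsRel u v (fun i => s * a i + t * a' i) (fun j => s * b j + t * b' j) := fun x => by
  have h1 := h x
  have h2 := h' x
  simp only [Fin.sum_univ_three] at h1 h2 ⊢
  linear_combination s * h1 + t * h2

section Steiner

variable [CharZero k] (hT : IsPolar F T) (h : IsSteiner F u v)

include hT h

/-- Two factors of each product vanish at such a point, so the gradient of the cubic vanishes as
well. Hence two of the `u` and two of the `v` always form a coordinate system. -/
theorem IsSteiner.eq_zero (i j : Fin 3) {x : Fin 4 → k} (h1 : u (i + 1) x = 0)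
    (h2 : u (i + 2) x = 0) (h3 : v (j + 1) x = 0) (h4 : v (j + 2) x = 0) : x = 0 := by
  by_contra hx
  obtain ⟨w, hw⟩ := hT.nonsingular x hx
  obtain ⟨c, hc, h⟩ := h
  refine hw ?_
  have h5 := hT.gradient x w
  have h6 := h (x + w)
  have h7 := h (x - w)
  have h8 := h w
  rw [prod_rotate _ i, prod_rotate _ j] at h6 h7 h8
  simp only [map_add, map_sub, h1, h2, h3, h4] at h6 h7 h8
  have : (6 * c) * T x x w = 0 := by linear_combination c * h5 - h6 + h7 + 2 * h8
  simpa [hc] using this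

theorem IsSteiner.exists_point (i j : Fin 3) (p q r s : k) : ∃ x, u (i + 1) x = p ∧
    u (i + 2) x = q ∧ v (j + 1) x = r ∧ v (j + 2) x = s := by
  let φ : (Fin 4 → k) →ₗ[k] (Fin 4 → k) :=
    LinearMap.pi ![u (i + 1), u (i + 2), v (j + 1), v (j + 2)]
  have hφ : Function.Injective φ := by
    rw [injective_iff_map_eq_zero]
    intro x hx
    exact h.eq_zero hT i j (congrFun hx 0) (congrFun hx 1) (congrFun hx 2) (congrFun hx 3)
  obtain ⟨x, hx⟩ := LinearMap.injective_iff_surjective.1 hφ ![p, q, r, s]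
  exact ⟨x, congrFun hx 0, congrFun hx 1, congrFun hx 2, congrFun hx 3⟩

/-- Such a relation involves only four forms, which are coordinates. -/
theorem IsSteiner.rel_eq_zero (hr : IsRel u v a b) (i j : Fin 3) (ha : a i = 0) (hb : b j = 0) :
    (∀ i', a i' = 0) ∧ ∀ j', b j' = 0 := by
  have key : ∀ p q r s, a (i + 1) * p + a (i + 2) * q + b (j + 1) * r + b (j + 2) * s = 0 := by
    intro p q r s
    obtain ⟨x, h1, h2, h3, h4⟩ := h.exists_point hT i j p q r s
    have := hr x
    rw [sum_rotate _ i, sum_rotate _ j, h1, h2, h3, h4, ha, hb] at this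
    linear_combination this
  have h1 := key 1 0 0 0
  have h2 := key 0 1 0 0
  have h3 := key 0 0 1 0
  have h4 := key 0 0 0 1
  simp only [mul_one, mul_zero, add_zero, zero_add] at h1 h2 h3 h4
  constructor
  · intro i'
    rcases eq_rotate i i' with rfl | rfl | rfl <;> assumption
  · intro i'
    rcases eq_rotate j i' with rfl | rfl | rfl <;> assumption

theorem IsSteiner.ne_zero_of_rel (hr : IsRel u v a b) (hp : ∏ i, a i = ∏ j, b j)
    (hne : (∃ i, a i ≠ 0) ∨ ∃ j, b j ≠ 0) : (∀ i, a i ≠ 0) ∧ ∀ j, b j ≠ 0 := by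
  by_contra hc
  have h0 : ∏ i, a i = 0 ∧ ∏ j, b j = 0 := by
    rw [not_and_or] at hc
    push Not at hc
    rcases hc with ⟨i, hi⟩ | ⟨i, hi⟩
    · have := Finset.prod_eq_zero (Finset.mem_univ i) hi
      exact ⟨this, hp ▸ this⟩
    · have := Finset.prod_eq_zero (Finset.mem_univ i) hi
      exact ⟨hp ▸ this, this⟩
  obtain ⟨i, -, hi⟩ := Finset.prod_eq_zero_iff.1 h0.1
  obtain ⟨j, -, hj⟩ := Finset.prod_eq_zero_iff.1 h0.2
  obtain ⟨h1, h2⟩ := h.rel_eq_zero hT hr i j hi hj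
  rcases hne with ⟨i, hi⟩ | ⟨j, hj⟩
  · exact hi (h1 i)
  · exact hj (h2 j)

/-- If the minor vanished, a combination of the two relations would lack both `uᵢ` and `vⱼ`,
contrary to `IsSteiner.rel_eq_zero`. -/
theorem IsSteiner.det_ne_zero {a' b' : Fin 3 → k} (hr : IsRel u v a b) (hr' : IsRel u v a' b')
    (hne : ∀ s t : k, (∀ i, s * a i + t * a' i = 0) → (∀ j, s * b j + t * b' j = 0) →
      s = 0 ∧ t = 0) (i j : Fin 3) : a i * b' j - a' i * b j ≠ 0 := by
  intro h0
  obtain ⟨h1, h2⟩ := h.rel_eq_zero hT (hr.add hr' (b' j) (-b j)) i j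
    (by linear_combination h0) (by ring)
  obtain ⟨h3, h4⟩ := hne _ _ h1 h2
  obtain ⟨h5, h6⟩ := h.rel_eq_zero hT (hr.add hr' (a' i) (-a i)) i j (by ring)
    (by linear_combination -h0)
  obtain ⟨h7, h8⟩ := hne _ _ h5 h6
  obtain ⟨h9, -⟩ := h.rel_eq_zero hT hr i j (neg_eq_zero.1 h8) (neg_eq_zero.1 h4)
  obtain ⟨-, h10⟩ := h.rel_eq_zero hT hr i j (neg_eq_zero.1 h8) (neg_eq_zero.1 h4)
  exact one_ne_zero (hne 1 0 (fun i => by rw [h9]; ring) (fun i => by rw [h10]; ring)).1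

/-- Every relation is a combination of two independent ones. -/
theorem IsSteiner.exists_combination {a' b' a'' b'' : Fin 3 → k} (hr : IsRel u v a b)
    (hr' : IsRel u v a' b') (hr'' : IsRel u v a'' b'')
    (hne : ∀ s t : k, (∀ i, s * a i + t * a' i = 0) → (∀ j, s * b j + t * b' j = 0) →
      s = 0 ∧ t = 0) :
    ∃ s t : k, (∀ i, a'' i = s * a i + t * a' i) ∧ ∀ j, b'' j = s * b j + t * b' j := by
  have hd := h.det_ne_zero hT hr hr' hne 0 0
  obtain ⟨d, hd⟩ : ∃ d, d * (a 0 * b' 0 - a' 0 * b 0) = 1 := ⟨_, inv_mul_cancel₀ hd⟩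
  have h1 := (hr.add hr' ((a'' 0 * b' 0 - a' 0 * b'' 0) * d)
    ((a 0 * b'' 0 - a'' 0 * b 0) * d)).add hr'' 1 (-1)
  obtain ⟨h2, h3⟩ := h.rel_eq_zero hT h1 0 0 (by linear_combination a'' 0 * hd)
    (by linear_combination b'' 0 * hd)
  exact ⟨(a'' 0 * b' 0 - a' 0 * b'' 0) * d, (a 0 * b'' 0 - a'' 0 * b 0) * d,
    fun i => by linear_combination -(h2 i), fun i => by linear_combination -(h3 i)⟩

/-- The relation `∑ uᵢ + ∑ vⱼ = 0` is a simple root of the equation `∏ aᵢ = ∏ bⱼ`. -/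
theorem IsSteiner.sum_ne_sum (h1 : IsRel u v 1 1) (hr : IsRel u v a b)
    (hne : ∀ s t : k, (∀ i, s * 1 + t * a i = 0) → (∀ j, s * 1 + t * b j = 0) →
      s = 0 ∧ t = 0) : ∑ i, a i ≠ ∑ j, b j := by
  intro h0
  have hd := h.det_ne_zero hT h1 hr hne 0 0
  simp only [Pi.one_apply, one_mul, mul_one] at hd
  -- Equal sums make the point with all `uᵢ = 1` and all `vⱼ = -1` compatible with both relations.
  -- There `u₀u₁u₂ + v₀v₁v₂` has differential `∑ uᵢ + ∑ vⱼ = 0`, so the point would be singular.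
  obtain ⟨x, hx1, hx2, hx3, hx4⟩ := h.exists_point hT 0 0 1 1 (-1) (-1)
  simp only [zero_add] at hx1 hx2 hx3 hx4
  have e1 := h1 x
  have e2 := hr x
  simp only [Fin.sum_univ_three, hx1, hx2, hx3, hx4, Pi.one_apply] at e1 e2 h0
  have hu : u 0 x = 1 := by
    have : (b 0 - a 0) * (u 0 x - 1) = 0 := by linear_combination b 0 * e1 - e2 + h0
    rcases mul_eq_zero.1 this with h | h
    · exact absurd h hd
    · linear_combination h
  have hv : v 0 x = -1 := by linear_combination e1 - hu
  obtain ⟨w, hw⟩ := hT.nonsingular x (fun h => by simp [h] at hx1)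
  obtain ⟨c, hc, h⟩ := h
  refine hw ?_
  have h5 := hT.gradient x w
  have h6 := h (x + w)
  have h7 := h (x - w)
  have h8 := h w
  have h9 := h1 w
  simp only [Fin.prod_univ_three, Fin.sum_univ_three, map_add, map_sub, hx1, hx2, hx3, hx4, hu,
    hv, Pi.one_apply] at h6 h7 h8 h9
  have : (6 * c) * T x x w = 0 := by
    linear_combination c * h5 - h6 + h7 + 2 * h8 + 2 * h9
  simpa [hc] using this

end Steiner

theorem IsSteiner.smul (h : IsSteiner F u v) (ha : ∀ i, a i ≠ 0) (hp : ∏ i, a i = ∏ j, b j) :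
    IsSteiner F (fun i => a i • u i) (fun j => b j • v j) := by
  obtain ⟨c, hc, h⟩ := h
  refine ⟨(∏ i, a i) * c, mul_ne_zero (Finset.prod_ne_zero_iff.2 fun i _ => ha i) hc, fun x => ?_⟩
  rw [mul_assoc, ← h]
  simp only [LinearMap.smul_apply, smul_eq_mul, Finset.prod_mul_distrib]
  rw [← hp]
  ring

theorem IsRel.smul {a' b' : Fin 3 → k} (h : IsRel u v a' b') (ha : ∀ i, a i ≠ 0)
    (hb : ∀ j, b j ≠ 0) :
    IsRel (fun i => a i • u i) (fun j => b j • v j) (fun i => a' i / a i) fun j => b' j / b j := by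
  intro x
  rw [← h x]
  simp only [LinearMap.smul_apply, smul_eq_mul]
  congr 1 <;> refine Finset.sum_congr rfl fun i _ => ?_
  · rw [← mul_assoc, div_mul_cancel₀ _ (ha i)]
  · rw [← mul_assoc, div_mul_cancel₀ _ (hb i)]

theorem exists_two_rel (u v : Fin 3 → Dual k (Fin 4 → k)) : ∃ a b a' b', IsRel u v a b ∧
    IsRel u v a' b' ∧ ∀ s t : k, (∀ i, s * a i + t * a' i = 0) → (∀ j, s * b j + t * b' j = 0) →
      s = 0 ∧ t = 0 := by
  let φ : ((Fin 3 → k) × (Fin 3 → k)) →ₗ[k] Dual k (Fin 4 → k) :=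
    (Fintype.linearCombination k u).coprod (Fintype.linearCombination k v)
  have h1 : 2 ≤ finrank k (LinearMap.ker φ) := by
    have h2 := φ.finrank_range_add_finrank_ker
    have h3 := (LinearMap.range φ).finrank_le
    simp only [finrank_prod, finrank_fin_fun, Subspace.dual_finrank_eq] at h2 h3
    omega
  obtain ⟨w, hw⟩ := exists_linearIndependent_of_le_finrank h1
  have hrel : ∀ i, IsRel u v (w i).1.1 (w i).1.2 := fun i x => by
    have e : ∀ y, φ y x = ∑ i, y.1 i * u i x + ∑ j, y.2 j * v j x := fun y => by
      simp [φ, Fintype.linearCombination_apply, LinearMap.sum_apply]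
    rw [← e, show φ (w i).1 = 0 from (w i).2, LinearMap.zero_apply]
  refine ⟨_, _, _, _, hrel 0, hrel 1, fun s t h1 h2 => ?_⟩
  have := Fintype.linearIndependent_iff.1 hw ![s, t] (by
    rw [Fin.sum_univ_two]
    ext i
    · exact h1 i
    · exact h2 i)
  exact ⟨this 0, this 1⟩

/-- A relation that is a root of the equation `∏ aᵢ = ∏ bⱼ` exists. -/
theorem exists_root_rel [IsAlgClosed k] (u v : Fin 3 → Dual k (Fin 4 → k)) :
    ∃ a b, IsRel u v a b ∧ ∏ i, a i = ∏ j, b j ∧ ((∃ i, a i ≠ 0) ∨ ∃ j, b j ≠ 0) := by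
  obtain ⟨a, b, a', b', hr, hr', hne⟩ := exists_two_rel u v
  -- The coefficients of the binary cubic `∏ (x aᵢ + y a'ᵢ) - ∏ (x bⱼ + y b'ⱼ)`.
  obtain ⟨x, y, hxy, h0⟩ := exists_cubic_zero (a 0 * a 1 * a 2 - b 0 * b 1 * b 2)
    (a' 0 * a 1 * a 2 + a 0 * a' 1 * a 2 + a 0 * a 1 * a' 2
      - (b' 0 * b 1 * b 2 + b 0 * b' 1 * b 2 + b 0 * b 1 * b' 2))
    (a 0 * a' 1 * a' 2 + a' 0 * a 1 * a' 2 + a' 0 * a' 1 * a 2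
      - (b 0 * b' 1 * b' 2 + b' 0 * b 1 * b' 2 + b' 0 * b' 1 * b 2))
    (a' 0 * a' 1 * a' 2 - b' 0 * b' 1 * b' 2)
  refine ⟨_, _, hr.add hr' x y, ?_, ?_⟩
  · simp only [Fin.prod_univ_three]
    linear_combination h0
  · by_contra hc
    push Not at hc
    have := hne x y hc.1 hc.2
    rcases hxy with h | h
    · exact h this.1
    · exact h this.2

/-- A description of the cubic surface `F = 0` by `u₀u₁u₂ + v₀v₁v₂ = 0`, together with the three
linear relations `∑ aᵢ uᵢ + ∑ bⱼ vⱼ = 0` with `∏ aᵢ = ∏ bⱼ`. -/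
structure IsMarking (F : MvPolynomial (Fin 4) k) (u v : Fin 3 → Dual k (Fin 4 → k))
    (A B : Fin 3 → Fin 3 → k) : Prop where
  steiner : IsSteiner F u v
  rel : ∀ ρ, IsRel u v (A ρ) (B ρ)
  prod_eq : ∀ ρ, ∏ i, A ρ i = ∏ j, B ρ j
  ne_zero_left : ∀ ρ i, A ρ i ≠ 0
  ne_zero_right : ∀ ρ j, B ρ j ≠ 0
  independent : ∀ ρ ρ', ρ ≠ ρ' → ∀ s t : k, (∀ i, s * A ρ i + t * A ρ' i = 0) →
    (∀ j, s * B ρ j + t * B ρ' j = 0) → s = 0 ∧ t = 0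
  complete : ∀ a b, IsRel u v a b → ∏ i, a i = ∏ j, b j →
    ∃ ρ t, (∀ i, a i = t * A ρ i) ∧ ∀ j, b j = t * B ρ j

theorem IsMarking.comp_perm {A B : Fin 3 → Fin 3 → k} (h : IsMarking F u v A B)
    (s : Equiv.Perm (Fin 3)) : IsMarking F u v (A ∘ s) (B ∘ s) where
  steiner := h.steiner
  rel ρ := h.rel (s ρ)
  prod_eq ρ := h.prod_eq (s ρ)
  ne_zero_left ρ := h.ne_zero_left (s ρ)
  ne_zero_right ρ := h.ne_zero_right (s ρ)
  independent ρ ρ' hρ := h.independent (s ρ) (s ρ') (s.injective.ne hρ)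
  complete a b hr hp := by
    obtain ⟨ρ, t, h1, h2⟩ := h.complete a b hr hp
    exact ⟨s.symm ρ, t, by simpa using h1, by simpa using h2⟩

theorem IsMarking.smul {A B : Fin 3 → Fin 3 → k} (h : IsMarking F u v A B)
    (ha : ∀ i, a i ≠ 0) (hb : ∀ j, b j ≠ 0) (hp : ∏ i, a i = ∏ j, b j) :
    IsMarking F (fun i => a i • u i) (fun j => b j • v j) (fun ρ i => A ρ i / a i)
      (fun ρ j => B ρ j / b j) where
  steiner := h.steiner.smul ha hp
  rel ρ := (h.rel ρ).smul ha hb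
  prod_eq ρ := by rw [Finset.prod_div_distrib, Finset.prod_div_distrib, h.prod_eq, hp]
  ne_zero_left ρ i := div_ne_zero (h.ne_zero_left ρ i) (ha i)
  ne_zero_right ρ j := div_ne_zero (h.ne_zero_right ρ j) (hb j)
  independent ρ ρ' hρ s t h1 h2 := h.independent ρ ρ' hρ s t
    (fun i => by
      have := h1 i
      rw [← mul_div_assoc, ← mul_div_assoc, ← add_div, div_eq_zero_iff] at this
      exact this.resolve_right (ha i))
    (fun i => by
      have := h2 i
      rw [← mul_div_assoc, ← mul_div_assoc, ← add_div, div_eq_zero_iff] at this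
      exact this.resolve_right (hb i))
  complete a' b' hr hp' := by
    obtain ⟨ρ, t, h1, h2⟩ := h.complete (fun i => a' i * a i) (fun j => b' j * b j)
      (fun x => by
        rw [← hr x]
        simp only [LinearMap.smul_apply, smul_eq_mul, mul_assoc])
      (by rw [Finset.prod_mul_distrib, Finset.prod_mul_distrib, hp, hp'])
    refine ⟨ρ, t, fun i => ?_, fun j => ?_⟩
    · rw [← mul_div_assoc, ← h1, mul_div_cancel_right₀ _ (ha i)]
    · rw [← mul_div_assoc, ← h2, mul_div_cancel_right₀ _ (hb j)]

/-- The three root relations exist once one of them is `∑ uᵢ + ∑ vⱼ = 0`. -/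
theorem IsSteiner.exists_isMarking_one [CharZero k] [IsAlgClosed k] (hT : IsPolar F T)
    (h : IsSteiner F u v) (h1 : IsRel u v 1 1) :
    ∃ A B : Fin 3 → Fin 3 → k, IsMarking F u v A B ∧ A 0 = 1 ∧ B 0 = 1 := by
  obtain ⟨a', b', hr', hne'⟩ : ∃ a b, IsRel u v a b ∧ ∀ s t : k, (∀ i, s * 1 + t * a i = 0) →
      (∀ j, s * 1 + t * b j = 0) → s = 0 ∧ t = 0 := by
    obtain ⟨a, b, a', b', hr, hr', hne⟩ := exists_two_rel u v
    by_contra hc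
    push Not at hc
    have key : ∀ a b, IsRel u v a b → ∃ t, (∀ i, a i = t) ∧ ∀ j, b j = t := by
      intro a b hr
      obtain ⟨s, t, h2, h3, h4⟩ := hc a b hr
      have ht : t ≠ 0 := fun ht => h4 (by simpa [ht] using h2 0) ht
      refine ⟨-s / t, fun i => ?_, fun i => ?_⟩
      · rw [eq_div_iff ht]; linear_combination h2 i
      · rw [eq_div_iff ht]; linear_combination h3 i
    obtain ⟨s, hs1, hs2⟩ := key a b hr
    obtain ⟨t, ht1, ht2⟩ := key a' b' hr'
    have h5 := hne t (-s) (fun i => by rw [hs1, ht1]; ring) (fun i => by rw [hs2, ht2]; ring)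
    exact one_ne_zero (hne 1 0 (fun i => by rw [hs1, ← neg_neg s, h5.2]; ring)
      (fun i => by rw [hs2, ← neg_neg s, h5.2]; ring)).1
  obtain ⟨a, b, hr, hp, hne⟩ : ∃ a b, IsRel u v a b ∧ ∏ i, a i = ∏ j, b j ∧
      ∀ s t : k, (∀ i, s * 1 + t * a i = 0) → (∀ j, s * 1 + t * b j = 0) → s = 0 ∧ t = 0 := by
    -- The cofactor of `y` in `∏ (x + y a'ᵢ) - ∏ (x + y b'ⱼ)`, that is, the cubic with its known
    -- root removed. Its coefficient at `x²` is nonzero by `IsSteiner.sum_ne_sum`, so its zeros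
    -- differ from that root.
    obtain ⟨x, y, hxy, h0⟩ := exists_quadratic_zero (a' 0 + a' 1 + a' 2 - (b' 0 + b' 1 + b' 2))
      (a' 1 * a' 2 + a' 0 * a' 2 + a' 0 * a' 1 - (b' 1 * b' 2 + b' 0 * b' 2 + b' 0 * b' 1))
      (a' 0 * a' 1 * a' 2 - b' 0 * b' 1 * b' 2)
    have hsum := h.sum_ne_sum hT h1 hr' hne'
    have hy : y ≠ 0 := fun hy => by
      rw [hy] at h0
      have hx : x ≠ 0 := hxy.resolve_right (fun h => h hy)
      have : (a' 0 + a' 1 + a' 2 - (b' 0 + b' 1 + b' 2)) * x ^ 2 = 0 := by linear_combination h0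
      rw [Fin.sum_univ_three, Fin.sum_univ_three] at hsum
      exact mul_ne_zero (sub_ne_zero.2 hsum) (pow_ne_zero 2 hx) this
    refine ⟨_, _, h1.add hr' x y, ?_, fun s t h2 h3 => ?_⟩
    · simp only [Fin.prod_univ_three, Pi.one_apply]
      linear_combination y * h0
    · obtain ⟨h4, h5⟩ := hne' (s + t * x) (t * y)
        (fun i => by rw [← h2 i, Pi.one_apply]; ring) (fun i => by rw [← h3 i, Pi.one_apply]; ring)
      have ht : t = 0 := (mul_eq_zero.1 h5).resolve_right hy
      rw [ht] at h4
      exact ⟨by linear_combination h4, ht⟩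
  have hsum := h.sum_ne_sum hT h1 hr hne
  have hnz := h.ne_zero_of_rel hT hr hp (by
    by_contra hc
    push Not at hc
    exact one_ne_zero (hne 0 1 (fun i => by rw [hc.1]; ring) (fun i => by rw [hc.2]; ring)).2)
  -- Simplicity of the second root: rescaling the forms by it turns it into `(1, 1)` and the first
  -- relation into the inverses `1/aᵢ`, `1/bⱼ`. The inequality of their sums becomes one of second
  -- elementary symmetric functions.
  have hsum' : a 1 * a 2 + a 0 * a 2 + a 0 * a 1 ≠ b 1 * b 2 + b 0 * b 2 + b 0 * b 1 := by
    have hrel1 := hr.smul hnz.1 hnz.2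
    have e : (fun i => a i / a i) = 1 := funext fun i => div_self (hnz.1 i)
    have e' : (fun i => b i / b i) = 1 := funext fun i => div_self (hnz.2 i)
    rw [e, e'] at hrel1
    have := (h.smul hnz.1 hp).sum_ne_sum hT hrel1 (h1.smul hnz.1 hnz.2) (fun s t h2 h3 => by
      have := hne t s (fun i => by
          have := h2 i
          rw [Pi.one_apply, mul_one_div, mul_one] at this
          have h4 := div_mul_cancel₀ t (hnz.1 i)
          linear_combination a i * this - h4)
        (fun i => by
          have := h3 i
          rw [Pi.one_apply, mul_one_div, mul_one] at this
          have h4 := div_mul_cancel₀ t (hnz.2 i)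
          linear_combination b i * this - h4)
      exact ⟨this.2, this.1⟩)
    intro h0
    refine this ?_
    rw [Fin.prod_univ_three, Fin.prod_univ_three] at hp
    simp only [Fin.sum_univ_three, Pi.one_apply]
    have a0 := hnz.1 0
    have a1 := hnz.1 1
    have a2 := hnz.1 2
    have b0 := hnz.2 0
    have b1 := hnz.2 1
    have b2 := hnz.2 2
    rw [div_add_div _ _ a0 a1, div_add_div _ _ (mul_ne_zero a0 a1) a2, div_add_div _ _ b0 b1,
      div_add_div _ _ (mul_ne_zero b0 b1) b2, hp]
    congr 1
    linear_combination h0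
  rw [Fin.sum_univ_three, Fin.sum_univ_three] at hsum
  rw [Fin.prod_univ_three, Fin.prod_univ_three] at hp
  -- On the pencil `s (1, 1) + t (a, b)` the cubic is `s t (s q - t p)`, so that the third root is
  -- `s : t = p : q`; it differs from the first two as `p` and `q` are nonzero.
  obtain ⟨p, hpdef⟩ : ∃ p, p = b 1 * b 2 + b 0 * b 2 + b 0 * b 1 -
    (a 1 * a 2 + a 0 * a 2 + a 0 * a 1) := ⟨_, rfl⟩
  obtain ⟨q, hqdef⟩ : ∃ q, q = a 0 + a 1 + a 2 - (b 0 + b 1 + b 2) := ⟨_, rfl⟩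
  have hp0 : p ≠ 0 := hpdef ▸ sub_ne_zero.2 hsum'.symm
  have hq0 : q ≠ 0 := hqdef ▸ sub_ne_zero.2 hsum
  have hr2 := h1.add hr p q
  have hp2 : ∏ i, (p * (1 : Fin 3 → k) i + q * a i) = ∏ j, (p * (1 : Fin 3 → k) j + q * b j) := by
    simp only [Fin.prod_univ_three, Pi.one_apply]
    linear_combination p * q ^ 2 * hpdef - p ^ 2 * q * hqdef + q ^ 3 * hp
  have hne2 : ∀ s t r : k, (∀ i, s * 1 + t * a i + r * (p * 1 + q * a i) = 0) →
      (∀ j, s * 1 + t * b j + r * (p * 1 + q * b j) = 0) → s + r * p = 0 ∧ t + r * q = 0 :=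
    fun s t r h2 h3 => hne _ _ (fun i => by linear_combination h2 i)
      (fun i => by linear_combination h3 i)
  have hnz2 := h.ne_zero_of_rel hT hr2 hp2 (by
    by_contra hc
    push Not at hc
    have := hne2 0 0 1 (fun i => by simpa using hc.1 i) (fun i => by simpa using hc.2 i)
    exact hp0 (by linear_combination this.1))
  refine ⟨![1, a, fun i => p * (1 : Fin 3 → k) i + q * a i],
    ![1, b, fun i => p * (1 : Fin 3 → k) i + q * b i], ⟨h, ?_, ?_, ?_, ?_, ?_, ?_⟩, rfl, rfl⟩
  · intro ρ
    fin_cases ρ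
    exacts [h1, hr, hr2]
  · intro ρ
    fin_cases ρ
    · rfl
    · simp only [Fin.prod_univ_three]; exact hp
    · exact hp2
  · intro ρ i
    fin_cases ρ
    exacts [one_ne_zero, hnz.1 i, hnz2.1 i]
  · intro ρ i
    fin_cases ρ
    exacts [one_ne_zero, hnz.2 i, hnz2.2 i]
  · have h01 := hne
    have h02 : ∀ s t : k, (∀ i, s * 1 + t * (p * 1 + q * a i) = 0) →
        (∀ i, s * 1 + t * (p * 1 + q * b i) = 0) → s = 0 ∧ t = 0 := fun s t h2 h3 => by
      obtain ⟨h4, h5⟩ := hne2 s 0 t (fun i => by linear_combination h2 i)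
        (fun i => by linear_combination h3 i)
      have ht : t = 0 := by simpa [hq0] using h5
      rw [ht] at h4
      exact ⟨by linear_combination h4, ht⟩
    have h12 : ∀ s t : k, (∀ i, s * a i + t * (p * 1 + q * a i) = 0) →
        (∀ i, s * b i + t * (p * 1 + q * b i) = 0) → s = 0 ∧ t = 0 := fun s t h2 h3 => by
      obtain ⟨h4, h5⟩ := hne2 0 s t (fun i => by linear_combination h2 i)
        (fun i => by linear_combination h3 i)
      have ht : t = 0 := by simpa [hp0] using h4
      rw [ht] at h5
      exact ⟨by linear_combination h5, ht⟩
    intro ρ ρ' hρ s t h2 h3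
    fin_cases ρ <;> fin_cases ρ'
    · exact absurd rfl hρ
    · exact h01 s t h2 h3
    · exact h02 s t h2 h3
    · exact (h01 t s (fun i => by rw [add_comm]; exact h2 i)
        (fun i => by rw [add_comm]; exact h3 i)).symm
    · exact absurd rfl hρ
    · exact h12 s t h2 h3
    · exact (h02 t s (fun i => by rw [add_comm]; exact h2 i)
        (fun i => by rw [add_comm]; exact h3 i)).symm
    · exact (h12 t s (fun i => by rw [add_comm]; exact h2 i)
        (fun i => by rw [add_comm]; exact h3 i)).symm
    · exact absurd rfl hρ
  · intro a'' b'' hr'' hp''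
    obtain ⟨s, t, hs, ht⟩ := h.exists_combination hT h1 hr hr'' hne
    simp only [Pi.one_apply] at hs ht
    rw [Fin.prod_univ_three, Fin.prod_univ_three, hs, hs, hs, ht, ht, ht] at hp''
    have : s * t * (s * q - t * p) = 0 := by
      linear_combination hp'' - t ^ 3 * hp + s ^ 2 * t * hqdef - s * t ^ 2 * hpdef
    rcases mul_eq_zero.1 this with h2 | h2
    · rcases mul_eq_zero.1 h2 with h2 | h2
      · exact ⟨1, t, fun i => by rw [hs, h2]; simp, fun i => by rw [ht, h2]; simp⟩
      · exact ⟨0, s, fun i => by rw [hs, h2]; simp, fun i => by rw [ht, h2]; simp⟩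
    · have e1 : s = t / q * p := by field_simp; linear_combination h2
      have e2 : t = t / q * q := by field_simp
      refine ⟨2, t / q, fun i => ?_, fun i => ?_⟩
      · rw [hs]
        change _ = t / q * (p * 1 + q * a i)
        linear_combination e1 + a i * e2
      · rw [ht]
        change _ = t / q * (p * 1 + q * b i)
        linear_combination e1 + b i * e2

/-- Every description `u₀u₁u₂ + v₀v₁v₂ = 0` of a nonsingular cubic surface can be marked after a
rescaling of the linear forms. -/
theorem IsSteiner.exists_isMarking [CharZero k] [IsAlgClosed k] (hT : IsPolar F T)
    (h : IsSteiner F u v) : ∃ a b : Fin 3 → k, (∀ i, a i ≠ 0) ∧ (∀ j, b j ≠ 0) ∧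
      ∃ A B : Fin 3 → Fin 3 → k, IsMarking F (fun i => a i • u i) (fun j => b j • v j) A B := by
  obtain ⟨a, b, hr, hp, hne⟩ := exists_root_rel u v
  obtain ⟨ha, hb⟩ := h.ne_zero_of_rel hT hr hp hne
  have h1 := hr.smul ha hb
  have e : (fun i => a i / a i) = 1 := funext fun i => div_self (ha i)
  have e' : (fun i => b i / b i) = 1 := funext fun i => div_self (hb i)
  rw [e, e'] at h1
  obtain ⟨A, B, hm, -⟩ := (h.smul ha hp).exists_isMarking_one hT h1
  exact ⟨a, b, ha, hb, A, B, hm⟩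

end CubicSurface
end

/-! ### The 27 lines and their incidences -/

noncomputable section
namespace CubicSurface
open Module
variable {k : Type*} [Field k] {F : MvPolynomial (Fin 4) k}
  {T : (Fin 4 → k) →ₗ[k] (Fin 4 → k) →ₗ[k] (Fin 4 → k) →ₗ[k] k}
  {u v : Fin 3 → Dual k (Fin 4 → k)} {a b : Fin 3 → k} {A B : Fin 3 → Fin 3 → k}

/-- The line `uᵢ = vⱼ = 0`. -/
def cellLine (u v : Fin 3 → Dual k (Fin 4 → k)) (i j : Fin 3) : Submodule k (Fin 4 → k) :=
  LinearMap.ker (u i) ⊓ LinearMap.ker (v j)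

/-- The line on which `aᵢ uᵢ + b_{σ i} v_{σ i}` vanishes for all `i`. -/
def rootLine (u v : Fin 3 → Dual k (Fin 4 → k)) (a b : Fin 3 → k) (σ : Equiv.Perm (Fin 3)) :
    Submodule k (Fin 4 → k) :=
  ⨅ i, LinearMap.ker (a i • u i + b (σ i) • v (σ i))

theorem mem_rootLine {σ : Equiv.Perm (Fin 3)} {x : Fin 4 → k} : x ∈ rootLine u v a b σ ↔
    ∀ i, a i * u i x + b (σ i) * v (σ i) x = 0 := by
  simp [rootLine, Submodule.mem_iInf]

theorem cellLine_symm (i j : Fin 3) : cellLine u v i j = cellLine v u j i := inf_comm _ _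

theorem IsRel.sum_perm (h : IsRel u v a b) (σ : Equiv.Perm (Fin 3)) (x : Fin 4 → k) :
    ∑ i, (a i * u i x + b (σ i) * v (σ i) x) = 0 := by
  rw [Finset.sum_add_distrib, Equiv.sum_comp σ fun j => b j * v j x]
  exact h x

theorem exists_ne_ne (i j : Fin 3) : ∃ l : Fin 3, l ≠ i ∧ l ≠ j := by revert i j; decide

/-- The permutation `i ↦ i + q` or `i ↦ q - i` of the three indices. -/
def shift : Bool → Fin 3 → Equiv.Perm (Fin 3)
  | false, q => Equiv.addRight q
  | true, q => Equiv.subLeft q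

theorem shift_apply_eq (s : Bool) (q q' i : Fin 3) : shift s q i = shift s q' i ↔ q = q' := by
  revert s q q' i; decide

/-- A rotation and a reflection of three indices agree somewhere, which places their root lines in a
common plane. -/
theorem exists_shift_eq (s : Bool) (q q' : Fin 3) : ∃ i, shift s q i = shift (!s) q' i := by
  revert s q q'; decide

theorem shift_ne_shift_not (s : Bool) (q q' : Fin 3) : shift s q ≠ shift (!s) q' := by
  revert s q q'; decide

theorem exists_eq_shift (σ : Equiv.Perm (Fin 3)) : ∃ s q, σ = shift s q := by
  revert σ; decide +kernel

theorem shift_injective {s s' : Bool} {q q' : Fin 3} (h : shift s q = shift s' q') :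
    s = s' ∧ q = q' := by
  revert s s' q q'; decide

section

variable [CharZero k] (hT : IsPolar F T)

include hT

theorem IsSteiner.exists_point_eq (h : IsSteiner F u v) (i j : Fin 3) (f g : Fin 3 → k) :
    ∃ x, (∀ i' ≠ i, u i' x = f i') ∧ ∀ j' ≠ j, v j' x = g j' := by
  obtain ⟨x, h1, h2, h3, h4⟩ := h.exists_point hT i j (f (i + 1)) (f (i + 2)) (g (j + 1)) (g (j + 2))
  refine ⟨x, fun i' hi => ?_, fun j' hj => ?_⟩
  · rcases eq_rotate i i' with rfl | rfl | rfl
    exacts [absurd rfl hi, h1, h2]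
  · rcases eq_rotate j j' with rfl | rfl | rfl
    exacts [absurd rfl hj, h3, h4]

theorem IsSteiner.isLineOn_cellLine (h : IsSteiner F u v) (i j : Fin 3) :
    IsLineOn F (cellLine u v i j) := by
  constructor
  · refine finrank_ker_inf_ker fun s t hst => ?_
    obtain ⟨i', hi', -⟩ := exists_ne_ne i i
    obtain ⟨j', hj', -⟩ := exists_ne_ne j j
    obtain ⟨x, hx1, hx2⟩ := h.exists_point_eq hT i' j' (fun _ => 1) (fun _ => 0)
    obtain ⟨y, hy1, hy2⟩ := h.exists_point_eq hT i' j' (fun _ => 0) (fun _ => 1)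
    have e1 := LinearMap.congr_fun hst x
    have e2 := LinearMap.congr_fun hst y
    simp only [LinearMap.add_apply, LinearMap.smul_apply, hx1 i hi'.symm, hx2 j hj'.symm,
      hy1 i hi'.symm, hy2 j hj'.symm, LinearMap.zero_apply, smul_eq_mul] at e1 e2
    exact ⟨by linear_combination e1, by linear_combination e2⟩
  · rintro x ⟨h1, h2⟩
    obtain ⟨c, hc, h⟩ := h
    have := h x
    rw [Finset.prod_eq_zero (f := fun i => u i x) (Finset.mem_univ i) h1,
      Finset.prod_eq_zero (f := fun j => v j x) (Finset.mem_univ j) h2,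
      add_zero, eq_comm] at this
    exact (mul_eq_zero.1 this).resolve_left hc

theorem IsSteiner.cellLine_ne_of_ne (h : IsSteiner F u v) (i i' : Fin 3) {j j' : Fin 3}
    (hj : j ≠ j') : cellLine u v i j ≠ cellLine u v i' j' := by
  intro he
  obtain ⟨i0, hi0, -⟩ := exists_ne_ne i i
  obtain ⟨j0, hj0, hj0'⟩ := exists_ne_ne j j'
  obtain ⟨x, hx1, hx2⟩ := h.exists_point_eq hT i0 j0 (fun _ => 0)
    (fun t => if t = j' then 1 else 0)
  have hx : x ∈ cellLine u v i j := ⟨hx1 i hi0.symm, by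
    rw [SetLike.mem_coe, LinearMap.mem_ker, hx2 j hj0.symm, if_neg hj]⟩
  rw [he] at hx
  have := hx.2
  rw [SetLike.mem_coe, LinearMap.mem_ker, hx2 j' hj0'.symm, if_pos rfl] at this
  exact one_ne_zero this

theorem IsSteiner.cellLine_injective (h : IsSteiner F u v) {i i' j j' : Fin 3}
    (he : cellLine u v i j = cellLine u v i' j') : i = i' ∧ j = j' := by
  refine ⟨?_, ?_⟩
  · by_contra hc
    rw [cellLine_symm, cellLine_symm i'] at he
    exact h.symm.cellLine_ne_of_ne hT _ _ hc he
  · by_contra hc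
    exact h.cellLine_ne_of_ne hT _ _ hc he

variable (h : IsMarking F u v A B)

include h

/-- Points of a root line with prescribed coordinates. -/
theorem IsMarking.exists_mem_rootLine (ρ : Fin 3) (σ : Equiv.Perm (Fin 3)) (i : Fin 3)
    (c : Fin 3 → k) : ∃ x ∈ rootLine u v (A ρ) (B ρ) σ,
      ∀ i' ≠ i, u i' x = B ρ (σ i') * c i' ∧ v (σ i') x = -(A ρ i' * c i') := by
  obtain ⟨x, hx1, hx2⟩ := h.steiner.exists_point_eq hT i (σ i) (fun i' => B ρ (σ i') * c i')
    (fun j => -(A ρ (σ.symm j) * c (σ.symm j)))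
  have key : ∀ i' ≠ i, u i' x = B ρ (σ i') * c i' ∧ v (σ i') x = -(A ρ i' * c i') :=
    fun i' hi' => ⟨hx1 i' hi', by rw [hx2 _ (σ.injective.ne hi'), Equiv.symm_apply_apply]⟩
  refine ⟨x, mem_rootLine.2 ?_, key⟩
  have h1 : ∀ i' ≠ i, A ρ i' * u i' x + B ρ (σ i') * v (σ i') x = 0 := fun i' hi' => by
    rw [(key i' hi').1, (key i' hi').2]; ring
  intro i'
  by_cases hi : i' = i
  · have h2 := (h.rel ρ).sum_perm σ x
    rw [Finset.sum_eq_single i (fun j _ hj => h1 j hj) (by simp)] at h2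
    rw [hi]; exact h2
  · exact h1 i' hi

/-- The three defining forms add up to zero, so two of them suffice. On the line `∏ aᵢ ∏ uᵢ = -∏ bⱼ
∏ vⱼ`, and `∏ aᵢ = ∏ bⱼ ≠ 0` can be cancelled. -/
theorem IsMarking.isLineOn_rootLine (ρ : Fin 3) (σ : Equiv.Perm (Fin 3)) :
    IsLineOn F (rootLine u v (A ρ) (B ρ) σ) := by
  constructor
  · have e : rootLine u v (A ρ) (B ρ) σ = LinearMap.ker (A ρ 0 • u 0 + B ρ (σ 0) • v (σ 0)) ⊓
        LinearMap.ker (A ρ 1 • u 1 + B ρ (σ 1) • v (σ 1)) := by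
      ext x
      rw [mem_rootLine, Submodule.mem_inf, LinearMap.mem_ker, LinearMap.mem_ker]
      simp only [LinearMap.add_apply, LinearMap.smul_apply, smul_eq_mul]
      have h2 := (h.rel ρ).sum_perm σ x
      rw [Fin.sum_univ_three] at h2
      constructor
      · intro h; exact ⟨h 0, h 1⟩
      · rintro ⟨h0, h1⟩ i
        fin_cases i
        · exact h0
        · exact h1
        · rw [h0, h1, zero_add, zero_add] at h2; exact h2
    rw [e]
    refine finrank_ker_inf_ker fun s t hst => ?_
    obtain ⟨x, hx1, hx2⟩ := h.steiner.exists_point_eq hT 2 (σ 2)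
      (fun i => if i = 0 then 1 else 0) (fun _ => 0)
    obtain ⟨y, hy1, hy2⟩ := h.steiner.exists_point_eq hT 2 (σ 2)
      (fun i => if i = 1 then 1 else 0) (fun _ => 0)
    have e1 := LinearMap.congr_fun hst x
    have e2 := LinearMap.congr_fun hst y
    simp [hx1 0, hx1 1, hx2, hy1 0, hy1 1, hy2, σ.injective.eq_iff, h.ne_zero_left] at e1 e2
    exact ⟨e1, e2⟩
  · intro x hx
    rw [mem_rootLine] at hx
    obtain ⟨c, hc, hs⟩ := h.steiner
    have h1 : (∏ i, A ρ i) * ∏ i, u i x = -((∏ j, B ρ j) * ∏ j, v j x) := by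
      rw [← Finset.prod_mul_distrib, ← Finset.prod_mul_distrib,
        ← Equiv.prod_comp σ fun j => B ρ j * v j x]
      simp only [Fin.prod_univ_three]
      have e : ∀ i, A ρ i * u i x = -(B ρ (σ i) * v (σ i) x) := fun i => by
        linear_combination hx i
      rw [e, e, e]
      ring
    have h2 : ((∏ i, A ρ i) * c) * eval x F = 0 := by
      rw [mul_assoc, ← hs]
      linear_combination h1 - (∏ j, v j x) * (h.prod_eq ρ).symm
    refine (mul_eq_zero.1 h2).resolve_left (mul_ne_zero ?_ hc)
    exact Finset.prod_ne_zero_iff.2 fun i _ => h.ne_zero_left ρ i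

theorem IsMarking.not_rootLine_le (ρ : Fin 3) (σ : Equiv.Perm (Fin 3)) (i : Fin 3) :
    ¬ rootLine u v (A ρ) (B ρ) σ ≤ LinearMap.ker (u i) := by
  intro hle
  obtain ⟨i', hi', -⟩ := exists_ne_ne i i
  obtain ⟨x, hx, hx1⟩ := h.exists_mem_rootLine hT ρ σ i' (fun _ => 1)
  have := hle hx
  rw [LinearMap.mem_ker, (hx1 i hi'.symm).1, mul_one] at this
  exact h.ne_zero_right _ _ this

theorem IsMarking.rootLine_ne_cellLine (ρ : Fin 3) (σ : Equiv.Perm (Fin 3)) (i j : Fin 3) :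
    rootLine u v (A ρ) (B ρ) σ ≠ cellLine u v i j := fun he =>
  h.not_rootLine_le hT ρ σ i (he ▸ inf_le_left)

theorem IsMarking.rootLine_injective {ρ ρ' : Fin 3} {σ τ : Equiv.Perm (Fin 3)}
    (he : rootLine u v (A ρ) (B ρ) σ = rootLine u v (A ρ') (B ρ') τ) : ρ = ρ' ∧ σ = τ := by
  have hσ : σ = τ := by
    by_contra hc
    obtain ⟨i, hi⟩ := not_forall.1 fun h => hc (Equiv.ext h)
    obtain ⟨i', hi'⟩ := σ.surjective (τ i)
    have hii' : i' ≠ i := by rintro rfl; exact hi hi'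
    obtain ⟨i0, h0, h0'⟩ := exists_ne_ne i i'
    obtain ⟨x, hx, hx1⟩ := h.exists_mem_rootLine hT ρ σ i0 (fun t => if t = i then 1 else 0)
    rw [he] at hx
    have h1 := mem_rootLine.1 hx i
    rw [(hx1 i h0.symm).1, ← hi', (hx1 i' h0'.symm).2, if_pos rfl, if_neg hii', mul_zero, neg_zero,
      mul_zero, add_zero, mul_one] at h1
    exact mul_ne_zero (h.ne_zero_left _ _) (h.ne_zero_right _ _) h1
  refine ⟨?_, hσ⟩
  subst hσ
  by_contra hc
  obtain ⟨x, hx, hx1⟩ := h.exists_mem_rootLine hT ρ σ 1 (fun t => 1)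
  rw [he] at hx
  have h1 := mem_rootLine.1 hx 0
  rw [(hx1 0 (by decide)).1, (hx1 0 (by decide)).2] at h1
  refine h.steiner.det_ne_zero hT (h.rel ρ) (h.rel ρ') (h.independent ρ ρ' hc) 0 (σ 0) ?_
  linear_combination -h1

end

section

variable [CharZero k] (hT : IsPolar F T)

include hT

theorem IsSteiner.isTri_row (h : IsSteiner F u v) (i : Fin 3) {j j' j'' : Fin 3} (h1 : j ≠ j')
    (h2 : j ≠ j'') (h3 : j' ≠ j'') :
    IsTri F (cellLine u v i j) (cellLine u v i j') (cellLine u v i j'') where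
  line₁ := h.isLineOn_cellLine hT i j
  line₂ := h.isLineOn_cellLine hT i j'
  line₃ := h.isLineOn_cellLine hT i j''
  ne₁₂ := h.cellLine_ne_of_ne hT i i h1
  ne₁₃ := h.cellLine_ne_of_ne hT i i h2
  ne₂₃ := h.cellLine_ne_of_ne hT i i h3
  coplanar := ⟨u i, fun h0 => by
    have := (h.isLineOn_cellLine hT i 0).1
    obtain ⟨i', hi', -⟩ := exists_ne_ne i i
    obtain ⟨x, hx1, hx2⟩ := h.exists_point_eq hT i' 0 (fun _ => 1) (fun _ => 0)
    have := hx1 i hi'.symm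
    rw [h0] at this
    exact one_ne_zero this.symm, inf_le_left, inf_le_left, inf_le_left⟩

theorem IsSteiner.cellLine_inf_ne_bot (h : IsSteiner F u v) (i : Fin 3) {j j' : Fin 3}
    (h1 : j ≠ j') : cellLine u v i j ⊓ cellLine u v i j' ≠ ⊥ := by
  obtain ⟨j'', h2, h3⟩ := exists_ne_ne j j'
  exact (h.isTri_row hT i h1 h2.symm h3.symm).meets₁₂

variable [IsAlgClosed k]

/-- A line meeting one line of a coplanar triple and not in it misses the others. -/
theorem IsPolar.inf_eq_bot_of_isTri {L M N K : Submodule k (Fin 4 → k)} (h : IsTri F L M N)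
    (hK : IsLineOn F K) (h1 : K ≠ L) (h2 : K ≠ M) (h3 : K ≠ N) (hKL : K ⊓ L ≠ ⊥) : K ⊓ M = ⊥ := by
  by_contra hc
  rcases hT.eq_of_meets h hK hKL hc with h4 | h4 | h4
  exacts [h1 h4, h2 h4, h3 h4]

theorem IsSteiner.cellLine_inf_eq_bot (h : IsSteiner F u v) {i i' j j' : Fin 3} (hi : i ≠ i')
    (hj : j ≠ j') : cellLine u v i j ⊓ cellLine u v i' j' = ⊥ := by
  obtain ⟨j'', h2, h3⟩ := exists_ne_ne j j'
  refine hT.inf_eq_bot_of_isTri (h.isTri_row hT i' hj h2.symm h3.symm)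
    (h.isLineOn_cellLine hT i j) ?_ ?_ ?_ ?_
  · exact fun e => hi (h.cellLine_injective hT e).1
  · exact fun e => hi (h.cellLine_injective hT e).1
  · exact fun e => hi (h.cellLine_injective hT e).1
  · rw [cellLine_symm, cellLine_symm i']
    exact h.symm.cellLine_inf_ne_bot hT j hi

omit [IsAlgClosed k] in
-- The common plane is `aᵢ uᵢ + b_{σ i} v_{σ i} = 0`.
theorem IsMarking.isTri_root (h : IsMarking F u v A B) (ρ : Fin 3) {σ τ : Equiv.Perm (Fin 3)} (hne : σ ≠ τ) {i : Fin 3}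
    (hi : σ i = τ i) : IsTri F (cellLine u v i (σ i)) (rootLine u v (A ρ) (B ρ) σ)
      (rootLine u v (A ρ) (B ρ) τ) where
  line₁ := h.steiner.isLineOn_cellLine hT _ _
  line₂ := h.isLineOn_rootLine hT _ _
  line₃ := h.isLineOn_rootLine hT _ _
  ne₁₂ := (h.rootLine_ne_cellLine hT _ _ _ _).symm
  ne₁₃ := (h.rootLine_ne_cellLine hT _ _ _ _).symm
  ne₂₃ := fun e => hne (h.rootLine_injective hT e).2
  coplanar := by
    refine ⟨A ρ i • u i + B ρ (σ i) • v (σ i), fun h0 => ?_, ?_, fun x hx => ?_, fun x hx => ?_⟩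
    · obtain ⟨i', hi', -⟩ := exists_ne_ne i i
      obtain ⟨j', hj', -⟩ := exists_ne_ne (σ i) (σ i)
      obtain ⟨x, hx1, hx2⟩ := h.steiner.exists_point_eq hT i' j' (fun _ => 1) (fun _ => 0)
      have := LinearMap.congr_fun h0 x
      simp only [LinearMap.add_apply, LinearMap.smul_apply, hx1 i hi'.symm, hx2 _ hj'.symm,
        mul_zero, add_zero, smul_eq_mul, mul_one, LinearMap.zero_apply] at this
      exact h.ne_zero_left _ _ this
    · rintro x ⟨h1, h2⟩
      rw [SetLike.mem_coe, LinearMap.mem_ker] at h1 h2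
      rw [LinearMap.mem_ker, LinearMap.add_apply, LinearMap.smul_apply, LinearMap.smul_apply, h1,
        h2, smul_zero, smul_zero, add_zero]
    · exact mem_rootLine.1 hx i
    · rw [hi]
      exact mem_rootLine.1 hx i

variable (h : IsMarking F u v A B)

include h

/-- A line outside a coplanar triple meets exactly one of its three members. This principle decides
all incidences that follow; here the triple is a row of cells. -/
theorem IsMarking.cellLine_inf_rootLine (i j ρ : Fin 3) (s : Bool) (q : Fin 3) :
    cellLine u v i j ⊓ rootLine u v (A ρ) (B ρ) (shift s q) ≠ ⊥ ↔ shift s q i = j := by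
  obtain ⟨q', hq'⟩ : ∃ q', shift s q i = shift (!s) q' i := by
    clear h hT; revert s q i; decide
  have key := (h.isTri_root hT ρ (shift_ne_shift_not s q q') hq').meets₁₂
  constructor
  · intro h1
    by_contra hc
    obtain ⟨j', hj1, hj2⟩ := exists_ne_ne (shift s q i) j
    refine h1 ?_
    rw [inf_comm]
    rw [inf_comm] at key
    exact hT.inf_eq_bot_of_isTri (h.steiner.isTri_row hT i hc hj1.symm hj2.symm)
      (h.isLineOn_rootLine hT _ _) (h.rootLine_ne_cellLine hT _ _ _ _)
      (h.rootLine_ne_cellLine hT _ _ _ _) (h.rootLine_ne_cellLine hT _ _ _ _) key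
  · rintro rfl
    exact key

theorem IsMarking.rootLine_inf_rootLine_not (ρ ρ' : Fin 3) (s : Bool) (q q' : Fin 3) :
    rootLine u v (A ρ) (B ρ) (shift s q) ⊓ rootLine u v (A ρ') (B ρ') (shift (!s) q') ≠ ⊥ ↔
      ρ = ρ' := by
  obtain ⟨i, hi⟩ := exists_shift_eq s q q'
  constructor
  · intro h1
    by_contra hc
    have ht := h.isTri_root hT ρ' (shift_ne_shift_not s q q') hi
    refine h1 (hT.inf_eq_bot_of_isTri ht.swap₂₃ (h.isLineOn_rootLine hT _ _)
      (h.rootLine_ne_cellLine hT _ _ _ _) ?_ ?_ ?_)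
    · exact fun e => hc (h.rootLine_injective hT e).1
    · exact fun e => hc (h.rootLine_injective hT e).1
    · rw [inf_comm, h.cellLine_inf_rootLine hT]
  · rintro rfl
    exact (h.isTri_root hT ρ (shift_ne_shift_not s q q') hi).swap₁₂.swap₂₃.meets₁₂

/-- The test triple consists of the second line, a root line of opposite parity for the same
relation, and the cell line common to their permutations. The incidences of the first line with the
last two are known. -/
theorem IsMarking.rootLine_inf_rootLine {ρ ρ' : Fin 3} {s : Bool} {q q' : Fin 3}
    (hne : ρ ≠ ρ' ∨ q ≠ q') :
    rootLine u v (A ρ) (B ρ) (shift s q) ⊓ rootLine u v (A ρ') (B ρ') (shift s q') ≠ ⊥ ↔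
      ρ ≠ ρ' ∧ q ≠ q' := by
  obtain ⟨i, hi⟩ := exists_shift_eq s q' 0
  have ht := h.isTri_root hT ρ' (shift_ne_shift_not s q' 0) hi
  have hl := h.isLineOn_rootLine hT ρ (shift s q)
  have n1 := h.rootLine_ne_cellLine hT ρ (shift s q) i (shift s q' i)
  have n2 : rootLine u v (A ρ) (B ρ) (shift s q) ≠ rootLine u v (A ρ') (B ρ') (shift s q') :=
    fun e => by
      obtain ⟨h1, h2⟩ := h.rootLine_injective hT e
      rcases hne with h3 | h3
      · exact h3 h1
      · exact h3 (shift_injective h2).2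
  have n3 : rootLine u v (A ρ) (B ρ) (shift s q) ≠ rootLine u v (A ρ') (B ρ') (shift (!s) 0) :=
    fun e => shift_ne_shift_not s q 0 (h.rootLine_injective hT e).2
  have m1 := h.cellLine_inf_rootLine hT i (shift s q' i) ρ s q
  rw [shift_apply_eq, inf_comm] at m1
  have m3 := h.rootLine_inf_rootLine_not hT ρ ρ' s q 0
  constructor
  · intro h1
    constructor
    · intro hc
      exact h1 (hT.inf_eq_bot_of_isTri ht.swap₂₃.swap₁₂.swap₂₃ hl n3 n2 n1 (m3.2 hc))
    · intro hc
      exact h1 (hT.inf_eq_bot_of_isTri ht hl n1 n2 n3 (m1.2 hc))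
  · rintro ⟨h1, h2⟩
    rcases hT.meets_tri ht hl with h3 | h3 | h3
    · exact absurd (m1.1 h3) h2
    · exact h3
    · exact absurd (m3.1 h3) h1

/-- The surface contains no lines besides the nine cell lines and the eighteen root lines. -/
theorem IsMarking.eq_cellLine_or_eq_rootLine {K : Submodule k (Fin 4 → k)} (hK : IsLineOn F K) :
    (∃ i j, K = cellLine u v i j) ∨ ∃ ρ σ, K = rootLine u v (A ρ) (B ρ) σ := by
  obtain ⟨c, hc, hs⟩ := h.steiner
  have hsum : ∀ x ∈ K, ∏ i, u i x + ∏ j, v j x = 0 := fun x hx => by rw [hs, hK.2 x hx, mul_zero]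
  have hcell : ∀ i j, K ≤ LinearMap.ker (u i) → K ≤ LinearMap.ker (v j) →
      K = cellLine u v i j := fun i j h1 h2 =>
    eq_of_le_of_finrank_two hK.1 (h.steiner.isLineOn_cellLine hT i j).1 (le_inf h1 h2)
  by_cases hu : ∃ i, K ≤ LinearMap.ker (u i)
  · obtain ⟨i, hi⟩ := hu
    have h1 := le_ker_of_mul_mul_eq_zero (L := K) (f := v 0) (g := v 1) (h := v 2) fun x hx => by
      have := hsum x hx
      rw [Finset.prod_eq_zero (f := fun i => u i x) (Finset.mem_univ i) (hi hx), zero_add,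
        Fin.prod_univ_three] at this
      exact this
    rcases h1 with h1 | h1 | h1
    exacts [Or.inl ⟨i, 0, hcell _ _ hi h1⟩, Or.inl ⟨i, 1, hcell _ _ hi h1⟩,
      Or.inl ⟨i, 2, hcell _ _ hi h1⟩]
  by_cases hv : ∃ j, K ≤ LinearMap.ker (v j)
  · obtain ⟨j, hj⟩ := hv
    have h1 := le_ker_of_mul_mul_eq_zero (L := K) (f := u 0) (g := u 1) (h := u 2) fun x hx => by
      have := hsum x hx
      rw [Finset.prod_eq_zero (f := fun i => v i x) (Finset.mem_univ j) (hj hx), add_zero,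
        Fin.prod_univ_three] at this
      exact this
    rcases h1 with h1 | h1 | h1
    exacts [Or.inl ⟨0, j, hcell _ _ h1 hj⟩, Or.inl ⟨1, j, hcell _ _ h1 hj⟩,
      Or.inl ⟨2, j, hcell _ _ h1 hj⟩]
  push Not at hu hv
  have hne : ∀ i j, K ≠ cellLine u v i j := fun i j e => hu i (e ▸ inf_le_left)
  -- A line contained in none of the six planes meets one cell line in each row, and in different
  -- columns; this defines a permutation.
  have hex : ∀ i, ∃ j, K ⊓ cellLine u v i j ≠ ⊥ := fun i => by
    rcases hT.meets_tri (h.steiner.isTri_row hT i (j := 0) (j' := 1) (j'' := 2) (by decide)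
      (by decide) (by decide)) hK with h1 | h1 | h1
    exacts [⟨_, h1⟩, ⟨_, h1⟩, ⟨_, h1⟩]
  choose σ hσ using hex
  have hinj : Function.Injective σ := by
    intro i i' he
    by_contra hii
    obtain ⟨i'', h1, h2⟩ := exists_ne_ne i i'
    have ht := h.steiner.symm.isTri_row hT (σ i) hii h1.symm h2.symm
    rw [cellLine_symm, cellLine_symm _ i', cellLine_symm _ i''] at ht
    exact hσ i' (he ▸ hT.inf_eq_bot_of_isTri ht hK (hne _ _) (hne _ _) (hne _ _) (hσ i))
  obtain ⟨τ, hτ⟩ : ∃ τ : Equiv.Perm (Fin 3), ∀ i, τ i = σ i :=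
    ⟨Equiv.ofBijective σ (Finite.injective_iff_bijective.1 hinj), fun _ => rfl⟩
  -- On `K` both `uᵢ` and `v_{τ i}` vanish at the point where `K` meets the cell line, so they are
  -- proportional there.
  have hprop : ∀ i, ∃ s : k, ∀ x ∈ K, v (τ i) x = s * u i x := by
    intro i
    obtain ⟨p, hp0, hpK, hpu, hpv⟩ := exists_mem_ne_zero (hσ i)
    obtain ⟨e, he, -, hspan⟩ := exists_span_pair hK.1 hpK hp0
    rw [SetLike.mem_coe, LinearMap.mem_ker] at hpu hpv
    have hue : u i e ≠ 0 := fun h0 => hu i fun x hx => by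
      obtain ⟨a, b, rfl⟩ := hspan x hx
      simp [hpu, h0]
    refine ⟨v (σ i) e / u i e, fun x hx => ?_⟩
    obtain ⟨a, b, rfl⟩ := hspan x hx
    rw [hτ]
    simp only [map_add, map_smul, hpu, hpv, mul_zero, zero_add, smul_eq_mul]
    field_simp
  choose s hs' using hprop
  -- The three forms `v_{τ i} - sᵢ uᵢ` vanish on `K`, hence are dependent. The vanishing of `F` on
  -- `K` gives `∏ sᵢ = -1`, which makes the dependence a root relation.
  obtain ⟨d, hd0, hd⟩ := exists_relation hK.1 (fun i => v (τ i) - s i • u i) fun i x hx => by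
    rw [LinearMap.mem_ker, LinearMap.sub_apply, LinearMap.smul_apply, hs' i x hx, smul_eq_mul,
      sub_self]
  have hprod : ∏ i, s i = -1 := by
    by_contra hc1
    have : ∀ x ∈ K, u 0 x * u 1 x * u 2 x = 0 := fun x hx => by
      have h1 := hsum x hx
      rw [← Equiv.prod_comp τ fun j => v j x] at h1
      simp only [hs' _ x hx] at h1
      rw [Finset.prod_mul_distrib, Fin.prod_univ_three fun i => u i x] at h1
      have h2 : (∏ i, s i - -1) * (u 0 x * u 1 x * u 2 x) = 0 := by linear_combination h1
      exact (mul_eq_zero.1 h2).resolve_left (sub_ne_zero.2 hc1)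
    rcases le_ker_of_mul_mul_eq_zero this with h1 | h1 | h1
    exacts [hu _ h1, hu _ h1, hu _ h1]
  obtain ⟨ρ, t, ht1, ht2⟩ := h.complete (fun i => -(d i * s i)) (fun j => d (τ.symm j))
    (fun x => by
      rw [← Equiv.sum_comp τ fun j => d (τ.symm j) * v j x, ← Finset.sum_add_distrib]
      have := LinearMap.congr_fun hd x
      rw [LinearMap.sum_apply] at this
      refine Eq.trans ?_ this
      refine Finset.sum_congr rfl fun i _ => ?_
      simp only [LinearMap.smul_apply, LinearMap.sub_apply, Equiv.symm_apply_apply, smul_eq_mul]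
      ring)
    (by
      rw [Equiv.prod_comp τ.symm d]
      simp only [neg_mul_eq_mul_neg]
      rw [Finset.prod_mul_distrib, Finset.prod_neg, hprod]
      simp [pow_succ])
  have ht0 : t ≠ 0 := by
    rintro rfl
    refine hd0 (funext fun i => ?_)
    have := ht2 (τ i)
    rwa [Equiv.symm_apply_apply, zero_mul] at this
  refine Or.inr ⟨ρ, τ, eq_of_le_of_finrank_two hK.1 (h.isLineOn_rootLine hT ρ τ).1 fun x hx => ?_⟩
  rw [mem_rootLine]
  intro i
  have h1 := ht1 i
  have h2 := ht2 (τ i)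
  rw [Equiv.symm_apply_apply] at h2
  have : t * (A ρ i * u i x + B ρ (τ i) * v (τ i) x) = 0 := by
    rw [hs' i x hx]
    linear_combination -(u i x) * h1 - s i * u i x * h2
  exact (mul_eq_zero.1 this).resolve_left ht0

end

end CubicSurface
end

/-! ### Labels for the 27 lines -/

noncomputable section
namespace CubicSurface
open Module
variable {k : Type*} [Field k] {F : MvPolynomial (Fin 4) k}
  {T : (Fin 4 → k) →ₗ[k] (Fin 4 → k) →ₗ[k] (Fin 4 → k) →ₗ[k] k}
  {u v : Fin 3 → Dual k (Fin 4 → k)} {A B : Fin 3 → Fin 3 → k}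

/-- The block of a label in `Fin 27`: the cell lines form the block `0`, the even and the odd root
lines the blocks `1` and `2`. -/
def blk (x : Fin 27) : Fin 3 := ⟨x.1 / 9, by omega⟩

/-- The row index of a label. -/
def row (x : Fin 27) : Fin 3 := ⟨x.1 / 3 % 3, by omega⟩

/-- The column index of a label. -/
def col (x : Fin 27) : Fin 3 := ⟨x.1 % 3, by omega⟩

/-- The label with given indices. -/
def label (t p q : Fin 3) : Fin 27 := ⟨9 * t.1 + 3 * p.1 + q.1, by omega⟩

theorem blk_label (t p q : Fin 3) : blk (label t p q) = t := by revert t p q; decide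
theorem row_label (t p q : Fin 3) : row (label t p q) = p := by revert t p q; decide
theorem col_label (t p q : Fin 3) : col (label t p q) = q := by revert t p q; decide

theorem label_eq (x : Fin 27) : label (blk x) (row x) (col x) = x := by revert x; decide

theorem label_ext {x y : Fin 27} (h1 : blk x = blk y) (h2 : row x = row y) (h3 : col x = col y) :
    x = y := by rw [← label_eq x, h1, h2, h3, label_eq]

/-- The line with a given label. -/
def mark (u v : Fin 3 → Dual k (Fin 4 → k)) (A B : Fin 3 → Fin 3 → k) (x : Fin 27) :
    Submodule k (Fin 4 → k) :=
  match blk x with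
  | 0 => cellLine u v (row x) (col x)
  | 1 => rootLine u v (A (row x)) (B (row x)) (shift false (col x))
  | 2 => rootLine u v (A (row x)) (B (row x)) (shift true (col x))

/-- Incidence of distinct lines in terms of their labels. -/
def adj (x y : Fin 27) : Bool :=
  match blk x, blk y with
  | 0, 0 => xor (row x == row y) (col x == col y)
  | 0, 1 => shift false (col y) (row x) == col x
  | 0, 2 => shift true (col y) (row x) == col x
  | 1, 0 => shift false (col x) (row y) == col y
  | 2, 0 => shift true (col x) (row y) == col y
  | 1, 1 => row x != row y && col x != col y
  | 2, 2 => row x != row y && col x != col y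
  | 1, 2 => row x == row y
  | 2, 1 => row x == row y

theorem mark_of_blk_zero {x : Fin 27} (h : blk x = 0) :
    mark u v A B x = cellLine u v (row x) (col x) := by rw [mark, h]
theorem mark_of_blk_one {x : Fin 27} (h : blk x = 1) :
    mark u v A B x = rootLine u v (A (row x)) (B (row x)) (shift false (col x)) := by rw [mark, h]
theorem mark_of_blk_two {x : Fin 27} (h : blk x = 2) :
    mark u v A B x = rootLine u v (A (row x)) (B (row x)) (shift true (col x)) := by rw [mark, h]

theorem blk_cases (x : Fin 27) : blk x = 0 ∨ blk x = 1 ∨ blk x = 2 := by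
  generalize blk x = t; revert t; decide

section

variable [CharZero k] (hT : IsPolar F T) (h : IsMarking F u v A B)

include hT h

theorem IsMarking.isLineOn_mark (x : Fin 27) : IsLineOn F (mark u v A B x) := by
  rcases blk_cases x with hx | hx | hx
  · rw [mark_of_blk_zero hx]; exact h.steiner.isLineOn_cellLine hT _ _
  · rw [mark_of_blk_one hx]; exact h.isLineOn_rootLine hT _ _
  · rw [mark_of_blk_two hx]; exact h.isLineOn_rootLine hT _ _

theorem IsMarking.mark_injective : Function.Injective (mark u v A B) := by
  intro x y he
  rcases blk_cases x with hx | hx | hx <;> rcases blk_cases y with hy | hy | hy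
  · rw [mark_of_blk_zero hx, mark_of_blk_zero hy] at he
    have := h.steiner.cellLine_injective hT he
    exact label_ext (hx.trans hy.symm) this.1 this.2
  · rw [mark_of_blk_zero hx, mark_of_blk_one hy] at he
    exact absurd he.symm (h.rootLine_ne_cellLine hT _ _ _ _)
  · rw [mark_of_blk_zero hx, mark_of_blk_two hy] at he
    exact absurd he.symm (h.rootLine_ne_cellLine hT _ _ _ _)
  · rw [mark_of_blk_one hx, mark_of_blk_zero hy] at he
    exact absurd he (h.rootLine_ne_cellLine hT _ _ _ _)
  · rw [mark_of_blk_one hx, mark_of_blk_one hy] at he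
    have := h.rootLine_injective hT he
    exact label_ext (hx.trans hy.symm) this.1 (shift_injective this.2).2
  · rw [mark_of_blk_one hx, mark_of_blk_two hy] at he
    have := h.rootLine_injective hT he
    exact absurd (shift_injective this.2).1 (by decide)
  · rw [mark_of_blk_two hx, mark_of_blk_zero hy] at he
    exact absurd he (h.rootLine_ne_cellLine hT _ _ _ _)
  · rw [mark_of_blk_two hx, mark_of_blk_one hy] at he
    have := h.rootLine_injective hT he
    exact absurd (shift_injective this.2).1 (by decide)
  · rw [mark_of_blk_two hx, mark_of_blk_two hy] at he
    have := h.rootLine_injective hT he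
    exact label_ext (hx.trans hy.symm) this.1 (shift_injective this.2).2

variable [IsAlgClosed k]

theorem IsMarking.exists_mark_eq {K : Submodule k (Fin 4 → k)} (hK : IsLineOn F K) :
    ∃ x, mark u v A B x = K := by
  rcases h.eq_cellLine_or_eq_rootLine hT hK with ⟨i, j, rfl⟩ | ⟨ρ, σ, rfl⟩
  · exact ⟨label 0 i j, by rw [mark_of_blk_zero (blk_label _ _ _), row_label, col_label]⟩
  · obtain ⟨s, q, rfl⟩ := exists_eq_shift σ
    cases s
    · exact ⟨label 1 ρ q, by rw [mark_of_blk_one (blk_label _ _ _), row_label, col_label]⟩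
    · exact ⟨label 2 ρ q, by rw [mark_of_blk_two (blk_label _ _ _), row_label, col_label]⟩

theorem IsMarking.mark_inf_ne_bot {x y : Fin 27} (hne : x ≠ y) :
    mark u v A B x ⊓ mark u v A B y ≠ ⊥ ↔ adj x y = true := by
  have hrc : blk x = blk y → row x ≠ row y ∨ col x ≠ col y := fun hb => by
    by_contra hc
    push Not at hc
    exact hne (label_ext hb hc.1 hc.2)
  rcases blk_cases x with hx | hx | hx <;> rcases blk_cases y with hy | hy | hy
  · rw [mark_of_blk_zero hx, mark_of_blk_zero hy, adj, hx, hy]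
    have hrc := hrc (hx.trans hy.symm)
    by_cases h1 : row x = row y
    · have h2 : col x ≠ col y := hrc.resolve_left (fun h => h h1)
      simp only [h1, beq_self_eq_true, beq_eq_false_iff_ne.2 h2, Bool.xor_false, iff_true]
      exact h.steiner.cellLine_inf_ne_bot hT _ h2
    · by_cases h2 : col x = col y
      · simp only [h2, beq_self_eq_true, beq_eq_false_iff_ne.2 h1, Bool.false_xor, iff_true]
        rw [cellLine_symm, cellLine_symm (row y)]
        exact h.steiner.symm.cellLine_inf_ne_bot hT _ h1
      · simp [beq_eq_false_iff_ne.2 h1, beq_eq_false_iff_ne.2 h2,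
          h.steiner.cellLine_inf_eq_bot hT h1 h2]
  · rw [mark_of_blk_zero hx, mark_of_blk_one hy, adj, hx, hy, h.cellLine_inf_rootLine hT]
    exact beq_iff_eq.symm
  · rw [mark_of_blk_zero hx, mark_of_blk_two hy, adj, hx, hy, h.cellLine_inf_rootLine hT]
    exact beq_iff_eq.symm
  · rw [mark_of_blk_one hx, mark_of_blk_zero hy, adj, hx, hy, inf_comm,
      h.cellLine_inf_rootLine hT]
    exact beq_iff_eq.symm
  · rw [mark_of_blk_one hx, mark_of_blk_one hy, adj, hx, hy,
      h.rootLine_inf_rootLine hT (hrc (hx.trans hy.symm))]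
    simp
  · rw [mark_of_blk_one hx, mark_of_blk_two hy, adj, hx, hy]
    exact (h.rootLine_inf_rootLine_not hT _ _ false _ _).trans beq_iff_eq.symm
  · rw [mark_of_blk_two hx, mark_of_blk_zero hy, adj, hx, hy, inf_comm,
      h.cellLine_inf_rootLine hT]
    exact beq_iff_eq.symm
  · rw [mark_of_blk_two hx, mark_of_blk_one hy, adj, hx, hy]
    exact (h.rootLine_inf_rootLine_not hT _ _ true _ _).trans beq_iff_eq.symm
  · rw [mark_of_blk_two hx, mark_of_blk_two hy, adj, hx, hy,
      h.rootLine_inf_rootLine hT (hrc (hx.trans hy.symm))]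
    simp

end

end CubicSurface
end

/-! ### Finite combinatorics of the double-sixes -/

noncomputable section
namespace CubicSurface
open Module
variable {k : Type*} [Field k] {F : MvPolynomial (Fin 4) k}
  {T : (Fin 4 → k) →ₗ[k] (Fin 4 → k) →ₗ[k] (Fin 4 → k) →ₗ[k] k}
  {u v : Fin 3 → Dual k (Fin 4 → k)} {A B : Fin 3 → Fin 3 → k}

/-- The neighbours of the 27 labels as bit masks. -/
def nbrMask (x : Fin 27) : ℕ :=
  [19173966, 38347925, 76695843, 38422641, 76583594, 19211548, 76621193, 19286354, 38310628,
    2056465, 2019426, 1945740, 14880017, 14846562, 14780044, 117468433, 117463650, 117454476,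
    113249953, 94375690, 56626772, 102264993, 85225738, 51146836, 14385313, 12026122, 7307348].getD x.1 0

/-- Replaces the case distinctions of `adj` by arithmetic of natural numbers, in which the finite
checks below are carried out. -/
theorem adj_eq_testBit (x y : Fin 27) : adj x y = (nbrMask x).testBit y.1 := by
  revert x y; decide +kernel

/-- The digits in base 27 of these numbers are the labels of the lines `A₁, …, A₆, B₁, …, B₆` of the
36 double-sixes. -/
def sixCode (r : Fin 36) : ℕ :=
  [132553110349963362, 115235378461555614, 115234498584925002, 85926939672199257,
    85926103633686834, 91699809098283829, 114363122278292212, 137811507243073551,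
    137810670042238506, 131017428346173232, 137216711758461579, 137215874557626534,
    103243829916198411, 143591751203284488, 143584376669158123, 119898135984079431,
    142996955718672516, 142989581184546151, 137879289345170097, 141944617413806700,
    141730514875751311, 135958502869156350, 119898993403569042, 125671005410164003,
    125885107948219392, 103244687335688022, 109016699342282983, 109230801880338372,
    126335277438003955, 126342651972130320, 135957645449666739, 137880145559349414,
    120561570811084338, 120562408011919383, 147076937811760540, 143652158771254669].getD r.1 0

/-- The labels of the lines of the double-sixes. -/
def six (r : Fin 36) (i : ℕ) : Fin 27 := ⟨sixCode r / 27 ^ i % 27, Nat.mod_lt _ (by decide)⟩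

/-- The set of labels of a double-six as a bit mask. -/
def sixMask (r : Fin 36) : ℕ := ((List.range 12).map fun i => 2 ^ (six r i).1).sum

/-- The digits in base 27 of these numbers are the labels of 3 × 3 grids of lines with coplanar rows
and columns. -/
def gridCode (g : Fin 17) : ℕ :=
  [1183286986164, 1231714547758, 1231652903491, 2360969181604, 1231685772671, 1231624128404,
    2361026618057, 1183202216300, 2312604705953, 11326998404, 6986264904882, 2714913164336,
    4346592086352, 4638664599309, 1264257868918, 1264167449564, 1183203869756].getD g.1 0

/-- The labels of a grid of lines. -/
def grid (g : Fin 17) (i j : Fin 3) : Fin 27 :=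
  ⟨gridCode g / 27 ^ (3 * i.1 + j.1) % 27, Nat.mod_lt _ (by decide)⟩

/-- The mask of the set of labels `{x, y} ∪ (N x ∆ N y)`. -/
def pairMask (x y : Fin 27) : ℕ := (2 ^ x.1 ||| 2 ^ y.1) ||| (nbrMask x ^^^ nbrMask y)

theorem testBit_sixMask (r : Fin 36) (x : Fin 27) :
    (sixMask r).testBit x.1 = true ↔ ∃ i : Fin 12, six r i.1 = x := by
  revert r x; decide +kernel

theorem six_injective (r : Fin 36) : Function.Injective fun i : Fin 12 => six r i.1 := by
  have : ∀ r, ∀ i j : Fin 12, six r i.1 = six r j.1 → i = j := by decide +kernel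
  exact fun i j h => this r i j h

theorem adj_six (r : Fin 36) (i j : Fin 6) : (adj (six r i.1) (six r j.1) = false ∧
    adj (six r (6 + i.1)) (six r (6 + j.1)) = false) ∧
    (adj (six r i.1) (six r (6 + j.1)) = true ↔ i ≠ j) := by
  simp only [adj_eq_testBit]
  revert r i j; decide +kernel

/-- A skew pair `x = A₁`, `y = B₁` determines its double-six: the other ten lines are those that
meet just one of `x` and `y`. The numbers agree, as `27 · 16 / 2 = 36 · 6`. -/
theorem exists_sixMask_eq {x y : Fin 27} (h1 : x ≠ y) (h2 : adj x y = false) :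
    ∃ r, pairMask x y = sixMask r := by
  rw [adj_eq_testBit] at h2
  revert x y; decide +kernel

theorem testBit_pairMask (x y z : Fin 27) :
    (pairMask x y).testBit z.1 = true ↔ (x = z ∨ y = z) ∨ adj x z ≠ adj y z := by
  rw [pairMask, Nat.testBit_or, Nat.testBit_or, Nat.testBit_xor, ← adj_eq_testBit,
    ← adj_eq_testBit, Nat.testBit_two_pow, Nat.testBit_two_pow]
  simp [Fin.ext_iff]

theorem exists_testBit_ne {r r' : Fin 36} (h : r ≠ r') :
    ∃ x : Fin 27, (sixMask r).testBit x.1 ≠ (sixMask r').testBit x.1 := by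
  revert r r'; decide +kernel

theorem adj_grid (g : Fin 17) (i i' j j' : Fin 3) (h : (i, j) ≠ (i', j')) :
    grid g i j ≠ grid g i' j' ∧ (i = i' ∨ j = j' → adj (grid g i j) (grid g i' j') = true) := by
  simp only [adj_eq_testBit]
  revert g i i' j j'; decide +kernel

theorem exists_grid (r : Fin 36) :
    ∃ g, ∀ i j, (sixMask r).testBit (grid g i j).1 = false := by
  revert r; decide +kernel

/-- The list `sixCode` begins with the three double-sixes that avoid the grid of cell lines; each is
made of the root lines of two of the three relations. The next lemma shows that no others avoid this
grid. -/
theorem testBit_sixMask_of_lt (ρ : Fin 3) (x : Fin 27) :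
    (sixMask ⟨ρ.1, by omega⟩).testBit x.1 = true ↔ blk x ≠ 0 ∧ row x ≠ ρ := by
  revert ρ x; decide +kernel

theorem exists_eq_of_avoids {r : Fin 36}
    (h : ∀ i j : Fin 3, (sixMask r).testBit (label 0 i j).1 = false) :
    ∃ ρ : Fin 3, r = ⟨ρ.1, by omega⟩ := by
  revert r; decide +kernel

/-- Besides a fixed double-six, there are two types of double-sixes. -/
theorem double_six_types {r : Fin 36} (hne : r ≠ 0) :
    (∃ g, ∀ i j, (sixMask r).testBit (grid g i j).1 = false ∧
      (sixMask 0).testBit (grid g i j).1 = false) ∨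
    ∃ l : Fin 27, (sixMask r).testBit l.1 = false ∧ (sixMask 0).testBit l.1 = false ∧
      ∀ x, adj l x = true → (sixMask r).testBit x.1 = (sixMask 0).testBit x.1 := by
  simp only [adj_eq_testBit]
  revert r; decide +kernel

attribute [irreducible] six sixMask grid pairMask

end CubicSurface
end

/-! ### Counting the double-sixes -/

noncomputable section
namespace CubicSurface
open Module
variable {k : Type*} [Field k] {F : MvPolynomial (Fin 4) k}
  {T : (Fin 4 → k) →ₗ[k] (Fin 4 → k) →ₗ[k] (Fin 4 → k) →ₗ[k] k}
  {u v : Fin 3 → Dual k (Fin 4 → k)} {A B : Fin 3 → Fin 3 → k}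

/-- The set of lines of a double-six given by its labels. -/
def sixLines (u v : Fin 3 → Dual k (Fin 4 → k)) (A B : Fin 3 → Fin 3 → k) (r : Fin 36) :
    Set (Submodule k (Fin 4 → k)) :=
  mark u v A B '' {x | (sixMask r).testBit x.1 = true}

theorem adj_self (x : Fin 27) : adj x x = false := by revert x; decide

theorem adj_comm (x y : Fin 27) : adj x y = adj y x := by revert x y; decide

section

variable [CharZero k] [IsAlgClosed k] (hT : IsPolar F T) (h : IsMarking F u v A B)

include hT h

omit [IsAlgClosed k] in
theorem IsMarking.mark_mem_sixLines {r : Fin 36} {x : Fin 27} :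
    mark u v A B x ∈ sixLines u v A B r ↔ (sixMask r).testBit x.1 = true :=
  (h.mark_injective hT).mem_set_image

theorem IsMarking.isDoubleSix_sixLines (r : Fin 36) : IsDoubleSix F (sixLines u v A B r) := by
  have hinj := six_injective r
  have hne : ∀ i j : Fin 12, i ≠ j → six r i.1 ≠ six r j.1 := fun i j hij => hinj.ne hij
  refine ⟨fun i => mark u v A B (six r i.1), fun i => mark u v A B (six r (6 + i.1)),
    fun i => h.isLineOn_mark hT _, fun i => h.isLineOn_mark hT _, fun i j hij => ?_,
    fun i j hij => ?_, fun i j => ?_, ?_⟩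
  · have h1 := h.mark_inf_ne_bot hT (hne ⟨i.1, by omega⟩ ⟨j.1, by omega⟩ (by
      simpa [Fin.ext_iff] using hij))
    by_contra hc
    exact Bool.false_ne_true ((adj_six r i j).1.1.symm.trans (h1.1 hc))
  · have h1 := h.mark_inf_ne_bot hT (hne ⟨6 + i.1, by omega⟩ ⟨6 + j.1, by omega⟩ (by
      simpa [Fin.ext_iff] using hij))
    by_contra hc
    exact Bool.false_ne_true ((adj_six r i j).1.2.symm.trans (h1.1 hc))
  · exact (h.mark_inf_ne_bot hT (hne ⟨i.1, by omega⟩ ⟨6 + j.1, by omega⟩ (by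
      simp [Fin.ext_iff]; omega))).trans (adj_six r i j).2
  · ext L
    constructor
    · rintro ⟨x, hx, rfl⟩
      obtain ⟨i, rfl⟩ := (testBit_sixMask r x).1 hx
      by_cases hi : i.1 < 6
      · exact Or.inl ⟨⟨i.1, hi⟩, rfl⟩
      · refine Or.inr ⟨⟨i.1 - 6, by omega⟩, ?_⟩
        change mark u v A B (six r (6 + (i.1 - 6))) = _
        rw [Nat.add_sub_cancel' (by omega)]
    · rintro (⟨i, rfl⟩ | ⟨i, rfl⟩)
      · exact ⟨_, (testBit_sixMask r _).2 ⟨⟨i.1, by omega⟩, rfl⟩, rfl⟩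
      · exact ⟨_, (testBit_sixMask r _).2 ⟨⟨6 + i.1, by omega⟩, rfl⟩, rfl⟩

/-- All twelve lines belong to the list attached to the pair `A₁, B₁` by `exists_sixMask_eq`, and
that list has only twelve members. -/
theorem IsMarking.exists_eq_sixLines {D : Set (Submodule k (Fin 4 → k))} (hD : IsDoubleSix F D) :
    ∃ r, D = sixLines u v A B r := by
  obtain ⟨a, b, ha, hb, haa, hbb, hab, rfl⟩ := hD
  choose α hα using fun i => h.exists_mark_eq hT (ha i)
  choose β hβ using fun i => h.exists_mark_eq hT (hb i)
  have line_ne : ∀ {L}, IsLineOn F L → L ⊓ L ≠ ⊥ := fun {L} hL h0 => by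
    rw [inf_idem] at h0
    have := hL.1
    rw [h0, finrank_bot] at this
    omega
  have aa : ∀ i j, adj (α i) (α j) = false := fun i j => by
    by_cases hij : α i = α j
    · rw [hij, adj_self]
    · by_contra hc
      have h1 := (h.mark_inf_ne_bot hT hij).2 (by simpa using hc)
      rw [hα, hα] at h1
      exact h1 (haa i j fun e => hij (e ▸ rfl))
  have bb : ∀ i j, adj (β i) (β j) = false := fun i j => by
    by_cases hij : β i = β j
    · rw [hij, adj_self]
    · by_contra hc
      have h1 := (h.mark_inf_ne_bot hT hij).2 (by simpa using hc)
      rw [hβ, hβ] at h1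
      exact h1 (hbb i j fun e => hij (e ▸ rfl))
  -- If `aᵢ = bⱼ` then `i ≠ j`, and for a third index `l` the line `a_l` would meet `bⱼ = aᵢ`.
  have hne : ∀ i j, α i ≠ β j := fun i j e => by
    have e1 : a i = b j := by rw [← hα, ← hβ, e]
    have h1 : i ≠ j := (hab i j).1 (e1 ▸ line_ne (ha i))
    obtain ⟨l, hl⟩ : ∃ l : Fin 6, l ≠ i ∧ l ≠ j := by
      clear * -; revert i j; decide
    exact (hab l j).2 hl.2 (by rw [← e1]; exact haa l i hl.1)
  have ab : ∀ i j, adj (α i) (β j) = true ↔ i ≠ j := fun i j => by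
    rw [← h.mark_inf_ne_bot hT (hne i j), hα, hβ, hab]
  have ainj : Function.Injective α := fun i j e => by
    by_contra hc
    have h1 := haa i j hc
    rw [← hα, ← hα, e] at h1
    exact line_ne (h.isLineOn_mark hT _) h1
  have binj : Function.Injective β := fun i j e => by
    by_contra hc
    have h1 := hbb i j hc
    rw [← hβ, ← hβ, e] at h1
    exact line_ne (h.isLineOn_mark hT _) h1
  have h00 : adj (α 0) (β 0) = false := by
    have := (ab 0 0).not.2 (by simp)
    simpa using this
  obtain ⟨r, hr⟩ := exists_sixMask_eq (hne 0 0) h00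
  have hmem : ∀ x : Fin 6 ⊕ Fin 6, (sixMask r).testBit (Sum.elim α β x).1 = true := by
    intro x
    rw [← hr, testBit_pairMask]
    rcases x with i | i
    · by_cases hi : i = 0
      · exact Or.inl (Or.inl (by rw [hi]; rfl))
      · refine Or.inr ?_
        rw [Sum.elim_inl, aa, adj_comm, (ab i 0).2 hi]
        decide
    · by_cases hi : i = 0
      · exact Or.inl (Or.inr (by rw [hi]; rfl))
      · refine Or.inr ?_
        rw [Sum.elim_inr, bb, (ab 0 i).2 (Ne.symm hi)]
        decide
  have hinj : Function.Injective (Sum.elim α β) := ainj.sumElim binj hne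
  have heq : Finset.univ.image (Sum.elim α β) = Finset.univ.image fun i : Fin 12 => six r i.1 := by
    refine Finset.eq_of_subset_of_card_le (fun x hx => ?_) ?_
    · obtain ⟨y, -, rfl⟩ := Finset.mem_image.1 hx
      obtain ⟨i, hi⟩ := (testBit_sixMask r _).1 (hmem y)
      exact Finset.mem_image.2 ⟨i, Finset.mem_univ _, hi⟩
    · rw [Finset.card_image_of_injective _ hinj,
        Finset.card_image_of_injective _ (six_injective r)]
      simp
  refine ⟨r, ?_⟩
  ext L
  constructor
  · rintro (⟨i, rfl⟩ | ⟨i, rfl⟩)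
    · exact ⟨α i, hmem (Sum.inl i), hα i⟩
    · exact ⟨β i, hmem (Sum.inr i), hβ i⟩
  · rintro ⟨x, hx, rfl⟩
    obtain ⟨i, rfl⟩ := (testBit_sixMask r x).1 hx
    have : six r i.1 ∈ Finset.univ.image (Sum.elim α β) := by
      rw [heq]
      exact Finset.mem_image_of_mem (fun i : Fin 12 => six r i.1) (Finset.mem_univ i)
    obtain ⟨y, -, hy⟩ := Finset.mem_image.1 this
    rw [← hy]
    rcases y with j | j
    · exact Or.inl ⟨j, (hα j).symm⟩
    · exact Or.inr ⟨j, (hβ j).symm⟩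

omit [IsAlgClosed k] in
theorem IsMarking.sixLines_injective : Function.Injective (sixLines u v A B) := by
  intro r r' he
  by_contra hc
  obtain ⟨x, hx⟩ := exists_testBit_ne hc
  have := h.mark_mem_sixLines hT (r := r) (x := x)
  rw [he, h.mark_mem_sixLines hT] at this
  exact hx (Bool.eq_iff_iff.2 this.symm)

/-- There are 36 double-sixes. -/
theorem IsMarking.ncard_isDoubleSix : {D | IsDoubleSix F D}.ncard = 36 := by
  have : {D | IsDoubleSix F D} = sixLines u v A B '' Set.univ := by
    rw [Set.image_univ]
    ext D
    constructor
    · intro hD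
      obtain ⟨r, rfl⟩ := h.exists_eq_sixLines hT hD
      exact ⟨r, rfl⟩
    · rintro ⟨r, rfl⟩
      exact h.isDoubleSix_sixLines hT r
  rw [this, Set.ncard_image_of_injective _ (h.sixLines_injective hT), Set.ncard_univ]
  simp

end

end CubicSurface
end

/-! ### From a grid of lines to Steiner's form -/

noncomputable section
namespace CubicSurface
open Module
variable {k : Type*} [Field k] {F : MvPolynomial (Fin 4) k}
  {T : (Fin 4 → k) →ₗ[k] (Fin 4 → k) →ₗ[k] (Fin 4 → k) →ₗ[k] k}

/-- A linear form as a polynomial. -/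
def linPoly (w : Dual k (Fin 4 → k)) : MvPolynomial (Fin 4) k :=
  ∑ j, C (w (Pi.single j 1)) * X j

theorem eval_linPoly (w : Dual k (Fin 4 → k)) (x : Fin 4 → k) : eval x (linPoly w) = w x := by
  rw [linPoly, map_sum, eq_sum_mul_apply w x]
  simp only [map_mul, eval_C, eval_X]

theorem linPoly_ne_zero {w : Dual k (Fin 4 → k)} (hw : w ≠ 0) : linPoly w ≠ 0 := fun h =>
  hw (LinearMap.ext fun x => by rw [← eval_linPoly, h, map_zero, LinearMap.zero_apply])

theorem exists_eval_ne_zero [CharZero k] {P : MvPolynomial (Fin 4) k} (hP : P ≠ 0) :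
    ∃ x, eval x P ≠ 0 := by
  by_contra hc
  push Not at hc
  exact hP (MvPolynomial.funext fun x => by rw [hc, map_zero])

/-- A cubic form that vanishes on three planes is a multiple of the product of their equations. -/
theorem IsPolar.exists_eq_mul_prod [CharZero k] (hT : IsPolar F T) {u v : Fin 3 → Dual k (Fin 4 → k)}
    {c : k} (hu : ∀ i j, i ≠ j → ∀ s t : k, s • u i + t • u j = 0 → s = 0 ∧ t = 0)
    (H : ∀ i x, u i x = 0 → eval x F = c * ∏ j, v j x) :
    ∃ c', ∀ x, eval x F = c' * ∏ i, u i x + c * ∏ j, v j x := by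
  have hu0 : ∀ i, u i ≠ 0 := fun i hi => by
    obtain ⟨j, hj, -⟩ := exists_ne_ne i i
    exact one_ne_zero (hu i j hj.symm 1 0 (by rw [hi, smul_zero, zero_smul, add_zero])).1
  obtain ⟨e, he⟩ := exists_eval_ne_zero (P := ∏ i, linPoly (u i))
    (Finset.prod_ne_zero_iff.2 fun i _ => linPoly_ne_zero (hu0 i))
  simp only [map_prod, eval_linPoly] at he
  have hei : ∀ i, u i e ≠ 0 := fun i => Finset.prod_ne_zero_iff.1 he i (Finset.mem_univ i)
  -- The constant that makes the difference of the two sides vanish at `e`, a point off the three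
  -- planes.
  refine ⟨(eval e F - c * ∏ j, v j e) / ∏ i, u i e, ?_⟩
  set c' := (eval e F - c * ∏ j, v j e) / ∏ i, u i e with hc'
  have hc'e : c' * ∏ i, u i e = eval e F - c * ∏ j, v j e := div_mul_cancel₀ _ he
  clear_value c'
  -- On the line joining `e` and `x`, the difference is a cubic in one variable that vanishes at `e`
  -- and at the points of the three planes. When these points are distinct, which means that no `w i
  -- j` with `i ≠ j` vanishes at `x`, the cubic has four zeros and is zero.
  let w : Fin 3 → Fin 3 → Dual k (Fin 4 → k) := fun i j => u j e • u i - u i e • u j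
  have hw : ∀ i j, i ≠ j → w i j ≠ 0 := fun i j hij h0 => by
    have := hu i j hij (u j e) (-u i e) (by
      rw [neg_smul (u i e) (u j), ← sub_eq_add_neg]; exact h0)
    exact hei j this.1
  let E := F - C c' * ∏ i, linPoly (u i) - C c * ∏ j, linPoly (v j)
  have hE : ∀ x, eval x E = eval x F - c' * ∏ i, u i x - c * ∏ j, v j x := fun x => by
    simp only [E, map_sub, map_mul, eval_C, map_prod, eval_linPoly]
  have hEQ : E * (linPoly (w 0 1) * linPoly (w 0 2) * linPoly (w 1 2)) = 0 := by
    refine MvPolynomial.funext fun x => ?_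
    rw [map_zero]
    simp only [map_mul, eval_linPoly]
    rw [hE]
    have key : ∀ i, u i e ^ 3 * eval x F - 3 * (u i e ^ 2 * u i x) * T x x e
        + 3 * (u i e * u i x ^ 2) * T x e e - u i x ^ 3 * eval e F =
        c * ∏ j, (u i e * v j x - u i x * v j e) := fun i => by
      have h1 := H i (u i e • x + (-u i x) • e) (by
        simp only [map_add, map_smul, smul_eq_mul]; ring)
      rw [hT.eval_add, hT.eval_smul, hT.eval_smul] at h1
      simp only [map_add, map_smul, LinearMap.smul_apply, smul_eq_mul] at h1
      simp only [Fin.prod_univ_three] at h1 ⊢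
      linear_combination h1
    have k0 := key 0
    have k1 := key 1
    have k2 := key 2
    simp only [Fin.prod_univ_three, w, LinearMap.sub_apply, LinearMap.smul_apply,
      smul_eq_mul] at k0 k1 k2 hc'e ⊢
    have h0 := hei 0
    have h1 := hei 1
    have h2 := hei 2
    generalize u 0 e = e0 at *
    generalize u 1 e = e1 at *
    generalize u 2 e = e2 at *
    generalize u 0 x = x0 at *
    generalize u 1 x = x1 at *
    generalize u 2 x = x2 at *
    generalize v 0 x = y0 at *
    generalize v 1 x = y1 at *
    generalize v 2 x = y2 at *
    generalize v 0 e = f0 at *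
    generalize v 1 e = f1 at *
    generalize v 2 e = f2 at *
    generalize eval e F = Fe at *
    generalize eval x F = Fx at *
    generalize T x x e = t1 at *
    generalize T x e e = t2 at *
    have h3 : e0 * e1 * e2 ≠ 0 := mul_ne_zero (mul_ne_zero h0 h1) h2
    refine (mul_eq_zero.1 (?_ : e0 * e1 * e2 * _ = 0)).resolve_left h3
    linear_combination (e2 * x1 - e1 * x2) * (e1 * x1 * e2 * x2) * k0
      - (e2 * x0 - e0 * x2) * (e0 * x0 * e2 * x2) * k1
      + (e1 * x0 - e0 * x1) * (e0 * x0 * e1 * x1) * k2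
      - x0 * x1 * x2 * ((e1 * x0 - e0 * x1) * (e2 * x0 - e0 * x2) * (e2 * x1 - e1 * x2)) * hc'e
  have hQ : linPoly (w 0 1) * linPoly (w 0 2) * linPoly (w 1 2) ≠ 0 :=
    mul_ne_zero (mul_ne_zero (linPoly_ne_zero (hw _ _ (by decide)))
      (linPoly_ne_zero (hw _ _ (by decide)))) (linPoly_ne_zero (hw _ _ (by decide)))
  intro x
  have h1 := hE x
  rw [(mul_eq_zero.1 hEQ).resolve_right hQ, map_zero] at h1
  linear_combination -h1

/-- A nine-fold grid of lines on the surface, with coplanar rows and columns, gives a description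
of the surface by `u₀u₁u₂ + v₀v₁v₂ = 0`. -/
theorem IsPolar.exists_isSteiner_of_grid [CharZero k] [IsAlgClosed k] (hT : IsPolar F T)
    {g : Fin 3 → Fin 3 → Submodule k (Fin 4 → k)} (hg : ∀ i j, IsLineOn F (g i j))
    (hne : ∀ i j i' j', (i, j) ≠ (i', j') → g i j ≠ g i' j')
    (hmeet : ∀ i j i' j', (i, j) ≠ (i', j') → i = i' ∨ j = j' → g i j ⊓ g i' j' ≠ ⊥) :
    ∃ u v, IsSteiner F u v ∧ ∀ i j, g i j = cellLine u v i j := by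
  have hrow : ∀ i, IsTri F (g i 0) (g i 1) (g i 2) := fun i =>
    hT.isTri_of_meets (hg _ _) (hg _ _) (hg _ _) (hne _ _ _ _ (by simp)) (hne _ _ _ _ (by simp))
      (hne _ _ _ _ (by simp)) (hmeet _ _ _ _ (by simp) (Or.inl rfl))
      (hmeet _ _ _ _ (by simp) (Or.inl rfl)) (hmeet _ _ _ _ (by simp) (Or.inl rfl))
  have hcol : ∀ j, IsTri F (g 0 j) (g 1 j) (g 2 j) := fun j =>
    hT.isTri_of_meets (hg _ _) (hg _ _) (hg _ _) (hne _ _ _ _ (by simp)) (hne _ _ _ _ (by simp))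
      (hne _ _ _ _ (by simp)) (hmeet _ _ _ _ (by simp) (Or.inr rfl))
      (hmeet _ _ _ _ (by simp) (Or.inr rfl)) (hmeet _ _ _ _ (by simp) (Or.inr rfl))
  choose u hu0 hu1 hu2 hu3 using fun i => (hrow i).coplanar
  choose v hv0 hv1 hv2 hv3 using fun j => (hcol j).coplanar
  have hgu : ∀ i j, g i j ≤ LinearMap.ker (u i) := fun i j => by
    fin_cases j
    exacts [hu1 i, hu2 i, hu3 i]
  have hgv : ∀ i j, g i j ≤ LinearMap.ker (v j) := fun i j => by
    fin_cases i
    exacts [hv1 j, hv2 j, hv3 j]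
  have hout : ∀ i i' j, i ≠ i' → ¬ g i' j ≤ LinearMap.ker (u i) := fun i i' j hi hle => by
    rcases hT.eq_of_le_ker (hrow i) (hg i' j) (hu0 i) (hgu i 0) (hgu i 1) hle with h | h | h
    all_goals exact hne _ _ _ _ (fun e => hi (congrArg Prod.fst e).symm) h
  have hindep : ∀ i (w : Dual k (Fin 4 → k)), w ≠ 0 → (∃ i' j, i ≠ i' ∧ g i' j ≤ LinearMap.ker w) →
      ∀ s t : k, s • u i + t • w = 0 → s = 0 ∧ t = 0 := by
    rintro i w hw ⟨i', j, hi, hle⟩ s t hst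
    have hs : s = 0 := by
      by_contra hs
      refine hout i i' j hi fun x hx => ?_
      have h1 := LinearMap.congr_fun hst x
      have h2 : w x = 0 := hle hx
      simp only [LinearMap.add_apply, LinearMap.smul_apply, h2, smul_eq_mul, mul_zero, add_zero,
        LinearMap.zero_apply] at h1
      exact (mul_eq_zero.1 h1).resolve_left hs
    rw [hs, zero_smul, zero_add] at hst
    exact ⟨hs, (smul_eq_zero.1 hst).resolve_right hw⟩
  have hcell : ∀ i j, g i j = cellLine u v i j := fun i j => by
    obtain ⟨i', hi', -⟩ := exists_ne_ne i i
    exact eq_of_le_of_finrank_two (hg i j).1 (finrank_ker_inf_ker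
      (hindep i (v j) (hv0 j) ⟨i', j, hi'.symm, hgv i' j⟩)) (le_inf (hgu i j) (hgv i j))
  -- Two forms with the same zero line in a plane are proportional on that plane.
  have hprop : ∀ i j (l : Dual k (Fin 4 → k)), g i j = LinearMap.ker (u i) ⊓ LinearMap.ker l →
      ∃ s : k, ∀ x, u i x = 0 → l x = s * v j x := by
    intro i j l hl
    have hlt : ¬ LinearMap.ker (u i) ≤ g i j := fun hle => by
      have h1 := Submodule.finrank_mono hle
      rw [finrank_ker_eq_three (hu0 i), (hg i j).1] at h1
      omega
    obtain ⟨e, he, he'⟩ := SetLike.not_le_iff_exists.1 hlt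
    rw [LinearMap.mem_ker] at he
    have hve : v j e ≠ 0 := fun h0 => he' (by rw [hcell]; exact ⟨he, h0⟩)
    refine ⟨l e / v j e, fun x hx => ?_⟩
    have h1 : v j e • x - v j x • e ∈ g i j := by
      rw [hcell]
      refine ⟨?_, ?_⟩
      · rw [SetLike.mem_coe, LinearMap.mem_ker, map_sub, map_smul, map_smul, he, hx]
        simp
      · rw [SetLike.mem_coe, LinearMap.mem_ker, map_sub, map_smul, map_smul, smul_eq_mul,
          smul_eq_mul, mul_comm, sub_self]
    rw [hl] at h1
    have h2 : l (v j e • x - v j x • e) = 0 := h1.2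
    rw [map_sub, map_smul, map_smul, smul_eq_mul, smul_eq_mul] at h2
    field_simp
    linear_combination h2
  -- In the `i`-th row plane the surface consists of the three lines of that row, which the column
  -- forms `vⱼ` cut out too.
  have hrestrict : ∀ i, ∃ c : k, ∀ x, u i x = 0 → eval x F = c * ∏ j, v j x := by
    intro i
    obtain ⟨w, l, m, n, hw, hL, hM, hN, hNL, hNM, hF⟩ :=
      hT.exists_third_form (hg i 0) (hg i 1) (hrow i).ne₁₂ (hrow i).meets₁₂
    have hker : LinearMap.ker w = LinearMap.ker (u i) := by
      rw [← sup_eq_ker (hg i 0).1 (hg i 1).1 (hrow i).ne₁₂ hw (hL ▸ inf_le_left)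
        (hM ▸ inf_le_left), ← sup_eq_ker (hg i 0).1 (hg i 1).1 (hrow i).ne₁₂ (hu0 i) (hgu i 0)
        (hgu i 1)]
    rw [hker] at hL hM hN hNL hNM
    have hNF : IsLineOn F (LinearMap.ker (u i) ⊓ LinearMap.ker n) := ⟨hN, fun x hx => by
      have h1 : x ∈ LinearMap.ker w := hker ▸ hx.1
      rw [hF x h1, show n x = 0 from hx.2, mul_zero]⟩
    have hN2 : g i 2 = LinearMap.ker (u i) ⊓ LinearMap.ker n := by
      rcases hT.eq_of_le_ker (hrow i) hNF (hu0 i) (hgu i 0) (hgu i 1) inf_le_left with h | h | h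
      exacts [absurd h hNL, absurd h hNM, h.symm]
    obtain ⟨s, hs⟩ := hprop i 0 l hL
    obtain ⟨t, ht⟩ := hprop i 1 m hM
    obtain ⟨r, hr⟩ := hprop i 2 n hN2
    refine ⟨s * t * r, fun x hx => ?_⟩
    have h1 : x ∈ LinearMap.ker w := hker ▸ hx
    rw [hF x h1, hs x hx, ht x hx, hr x hx, Fin.prod_univ_three]
    ring
  choose c hc using hrestrict
  -- The constants of two row planes can be compared on their line of intersection, where `∏ vⱼ` is
  -- not identically zero, since no line lies in two different rows of the grid.
  have hcc : ∀ i i', i ≠ i' → c i = c i' := by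
    intro i i' hi
    have h2 := finrank_ker_inf_ker (hindep i (u i') (hu0 i') ⟨i', 0, hi, hgu i' 0⟩)
    by_contra hne'
    have h3 : ∀ x ∈ LinearMap.ker (u i) ⊓ LinearMap.ker (u i'), v 0 x * v 1 x * v 2 x = 0 :=
      fun x hx => by
        have h4 := hc i x hx.1
        rw [hc i' x hx.2, Fin.prod_univ_three] at h4
        have h5 : (c i - c i') * (v 0 x * v 1 x * v 2 x) = 0 := by linear_combination -h4
        exact (mul_eq_zero.1 h5).resolve_left (sub_ne_zero.2 hne')
    have h4 : ∀ j, ¬ LinearMap.ker (u i) ⊓ LinearMap.ker (u i') ≤ LinearMap.ker (v j) := by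
      intro j hle
      have h5 := eq_of_le_of_finrank_two h2 (hg i j).1 (hcell i j ▸ le_inf inf_le_left hle)
      have h6 := eq_of_le_of_finrank_two h2 (hg i' j).1 (hcell i' j ▸ le_inf inf_le_right hle)
      exact hne i j i' j (fun e => hi (congrArg Prod.fst e)) (h5.symm.trans h6)
    rcases le_ker_of_mul_mul_eq_zero h3 with h5 | h5 | h5
    exacts [h4 _ h5, h4 _ h5, h4 _ h5]
  have hc0 : ∀ i, c i = c 0 := fun i => by
    by_cases hi : i = 0
    · rw [hi]
    · exact hcc i 0 hi
  obtain ⟨c', hc'⟩ := hT.exists_eq_mul_prod (u := u) (v := v) (c := c 0)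
    (fun i i' hi => hindep i (u i') (hu0 i') ⟨i', 0, hi, hgu i' 0⟩)
    (fun i x hx => by rw [hc i x hx, hc0])
  -- A product of three linear forms is singular where two of them vanish. Hence neither product may
  -- be absent from the equation.
  have hsing : ∀ (w : Fin 3 → Dual k (Fin 4 → k)) (d : k), ¬ ∀ x, eval x F = d * ∏ i, w i x := by
    intro w d hd
    obtain ⟨x, hx0, hx1, hx2⟩ : ∃ x, x ≠ 0 ∧ w 0 x = 0 ∧ w 1 x = 0 := by
      let φ : (Fin 4 → k) →ₗ[k] (Fin 2 → k) := LinearMap.pi ![w 0, w 1]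
      obtain ⟨x, hx, hx0⟩ := Submodule.exists_mem_ne_zero_of_ne_bot
        (LinearMap.ker_ne_bot_of_finrank_lt (f := φ) (by simp))
      exact ⟨x, hx0, congrFun hx 0, congrFun hx 1⟩
    obtain ⟨y, hy⟩ := hT.nonsingular x hx0
    refine hy ?_
    have h1 := hT.gradient x y
    rw [hd, hd, hd] at h1
    simp only [Fin.prod_univ_three, map_add, map_sub, hx1, hx2] at h1
    have : (6 : k) * T x x y = 0 := by linear_combination h1
    simpa using this
  have hd : c 0 ≠ 0 := fun h0 => hsing u c' fun x => by rw [hc', h0, zero_mul, add_zero]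
  have hd' : c' ≠ 0 := fun h0 => hsing v (c 0) fun x => by rw [hc', h0, zero_mul, zero_add]
  refine ⟨![(c' / c 0) • u 0, u 1, u 2], v, ⟨(c 0)⁻¹, inv_ne_zero hd, fun x => ?_⟩, fun i j => ?_⟩
  · rw [hc', Fin.prod_univ_three, Fin.prod_univ_three, Fin.prod_univ_three]
    simp only [Matrix.cons_val, LinearMap.smul_apply, smul_eq_mul]
    field_simp
  · rw [hcell]
    have hk : LinearMap.ker ((c' / c 0) • u 0) = LinearMap.ker (u 0) :=
      LinearMap.ker_smul _ _ (div_ne_zero hd' hd)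
    fin_cases i
    · exact congrArg (· ⊓ LinearMap.ker (v j)) hk.symm
    · rfl
    · rfl

end CubicSurface
end

/-! ### Hexahedral equations and markings -/

noncomputable section
namespace CubicSurface
open Module
variable {k : Type*} [Field k] {F : MvPolynomial (Fin 4) k}
  {T : (Fin 4 → k) →ₗ[k] (Fin 4 → k) →ₗ[k] (Fin 4 → k) →ₗ[k] k}
  {u v : Fin 3 → Dual k (Fin 4 → k)} {A B : Fin 3 → Fin 3 → k} {a b : Fin 3 → k}
  {Z : Fin 6 → Dual k (Fin 4 → k)} {β : Fin 6 → k}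

/-- The root lines of the relations other than the one with index `ρ`. -/
def rootSix (u v : Fin 3 → Dual k (Fin 4 → k)) (A B : Fin 3 → Fin 3 → k) (ρ : Fin 3) :
    Set (Submodule k (Fin 4 → k)) :=
  {L | ∃ ρ', ρ' ≠ ρ ∧ ∃ σ, L = rootLine u v (A ρ') (B ρ') σ}

theorem rootSix_comp_perm (s : Equiv.Perm (Fin 3)) (ρ : Fin 3) :
    rootSix u v (A ∘ s) (B ∘ s) ρ = rootSix u v A B (s ρ) := by
  ext L
  constructor
  · rintro ⟨ρ', h1, σ, rfl⟩
    exact ⟨s ρ', s.injective.ne h1, σ, rfl⟩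
  · rintro ⟨ρ', h1, σ, rfl⟩
    exact ⟨s.symm ρ', fun e => h1 (by rw [← e, Equiv.apply_symm_apply]), σ, by simp⟩

theorem rootLine_smul {c d : Fin 3 → k} (hc : ∀ i, c i ≠ 0) (hd : ∀ j, d j ≠ 0)
    (σ : Equiv.Perm (Fin 3)) :
    rootLine (fun i => c i • u i) (fun j => d j • v j) (fun i => a i / c i) (fun j => b j / d j) σ =
      rootLine u v a b σ := by
  ext x
  simp only [mem_rootLine, LinearMap.smul_apply, smul_eq_mul, ← mul_assoc,
    div_mul_cancel₀ _ (hc _), div_mul_cancel₀ _ (hd _)]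

theorem rootSix_smul {c d : Fin 3 → k} (hc : ∀ i, c i ≠ 0) (hd : ∀ j, d j ≠ 0) (ρ : Fin 3) :
    rootSix (fun i => c i • u i) (fun j => d j • v j) (fun ρ i => A ρ i / c i)
      (fun ρ j => B ρ j / d j) ρ = rootSix u v A B ρ := by
  simp only [rootSix, rootLine_smul hc hd]

theorem sixLines_eq_rootSix (ρ : Fin 3) :
    sixLines u v A B ⟨ρ.1, by omega⟩ = rootSix u v A B ρ := by
  ext L
  constructor
  · rintro ⟨x, hx, rfl⟩
    obtain ⟨h0, h1⟩ := (testBit_sixMask_of_lt ρ x).1 hx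
    rcases blk_cases x with h2 | h2 | h2
    · exact absurd h2 h0
    · exact ⟨row x, h1, _, mark_of_blk_one h2⟩
    · exact ⟨row x, h1, _, mark_of_blk_two h2⟩
  · rintro ⟨ρ', h1, σ, rfl⟩
    obtain ⟨s, q, rfl⟩ := exists_eq_shift σ
    cases s
    · refine ⟨label 1 ρ' q, (testBit_sixMask_of_lt ρ _).2 ⟨by rw [blk_label]; decide, by
        rwa [row_label]⟩, ?_⟩
      rw [mark_of_blk_one (blk_label _ _ _), row_label, col_label]
    · refine ⟨label 2 ρ' q, (testBit_sixMask_of_lt ρ _).2 ⟨by rw [blk_label]; decide, by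
        rwa [row_label]⟩, ?_⟩
      rw [mark_of_blk_two (blk_label _ _ _), row_label, col_label]

/-- The first three of the six indices, in the order adapted to the line `hexLine Z 1`. -/
def idxLeft : Fin 3 → Fin 6 := ![4, 0, 1]

/-- The complementary three indices. -/
def idxRight : Fin 3 → Fin 6 := ![5, 2, 3]

/-- The pairwise sums of the forms `Z₄, Z₀, Z₁`. -/
def hexLeft (Z : Fin 6 → Dual k (Fin 4 → k)) (i : Fin 3) : Dual k (Fin 4 → k) :=
  Z (idxLeft (i + 1)) + Z (idxLeft (i + 2))

/-- The pairwise sums of the forms `Z₅, Z₂, Z₃`. -/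
def hexRight (Z : Fin 6 → Dual k (Fin 4 → k)) (i : Fin 3) : Dual k (Fin 4 → k) :=
  Z (idxRight (i + 1)) + Z (idxRight (i + 2))

theorem sum_idx {M : Type*} [AddCommMonoid M] (f : Fin 6 → M) :
    ∑ i, f i = ∑ i, f (idxLeft i) + ∑ j, f (idxRight j) := by
  simp only [Fin.sum_univ_six, Fin.sum_univ_three, idxLeft, idxRight, Matrix.cons_val]
  abel

theorem IsHexahedral.sum_apply (h : IsHexahedral F Z β) (x : Fin 4 → k) :
    Z 0 x + Z 1 x + Z 2 x + Z 3 x + Z 4 x + Z 5 x = 0 := by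
  have := LinearMap.congr_fun h.sum_eq_zero x
  rwa [LinearMap.sum_apply, Fin.sum_univ_six] at this

/-- The sum of the cubes of three quantities is the cube of their sum minus three times the product
of their pairwise sums. The sums of the two triples are opposite, so their cubes cancel. -/
theorem IsHexahedral.isSteiner [CharZero k] (h : IsHexahedral F Z β) :
    IsSteiner F (hexLeft Z) (hexRight Z) := by
  obtain ⟨c, hc, hs⟩ := h.sum_cubes
  refine ⟨-c / 3, by simpa using hc, fun x => ?_⟩
  have h1 := hs x
  have h2 := h.sum_apply x
  simp only [Fin.sum_univ_six, Fin.prod_univ_three, hexLeft, hexRight, idxLeft, idxRight,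
    LinearMap.add_apply] at h1 ⊢
  change (Z 0 x + Z 1 x) * (Z 1 x + Z 4 x) * (Z 4 x + Z 0 x) +
    (Z 2 x + Z 3 x) * (Z 3 x + Z 5 x) * (Z 5 x + Z 2 x) = _
  generalize Z 0 x = z0 at *
  generalize Z 1 x = z1 at *
  generalize Z 2 x = z2 at *
  generalize Z 3 x = z3 at *
  generalize Z 4 x = z4 at *
  have h5 : Z 5 x = -(z0 + z1 + z2 + z3 + z4) := by linear_combination h2
  rw [h5] at h1 ⊢
  linear_combination -h1 / 3

theorem IsHexahedral.isRel_one (h : IsHexahedral F Z β) :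
    IsRel (hexLeft Z) (hexRight Z) 1 1 := by
  intro x
  have h2 := h.sum_apply x
  simp only [Fin.sum_univ_three, Pi.one_apply, one_mul]
  change (Z 0 x + Z 1 x) + (Z 1 x + Z 4 x) + (Z 4 x + Z 0 x) +
    ((Z 2 x + Z 3 x) + (Z 3 x + Z 5 x) + (Z 5 x + Z 2 x)) = 0
  linear_combination 2 * h2

theorem IsHexahedral.exists_isMarking [CharZero k] [IsAlgClosed k] (hT : IsPolar F T)
    (h : IsHexahedral F Z β) :
    ∃ A B, IsMarking F (hexLeft Z) (hexRight Z) A B ∧ A 0 = 1 ∧ B 0 = 1 :=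
  h.isSteiner.exists_isMarking_one hT h.isRel_one

/-- The partner of an index in the partition into pairs given by `s`. -/
def partner (s : Equiv.Perm (Fin 6)) (l : Fin 6) : Fin 6 :=
  s (![1, 0, 3, 2, 5, 4] (s.symm l))

theorem add_partner_eq_zero {s : Equiv.Perm (Fin 6)} {x : Fin 4 → k} (hx : x ∈ hexLine Z s)
    (l : Fin 6) : Z l x + Z (partner s l) x = 0 := by
  obtain ⟨⟨h1, h2⟩, h3⟩ := hx
  rw [SetLike.mem_coe, LinearMap.mem_ker, LinearMap.add_apply] at h1 h2 h3
  obtain ⟨i, rfl⟩ := s.surjective l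
  rw [partner, Equiv.symm_apply_apply]
  fin_cases i
  · exact h1
  · exact (add_comm _ _).trans h1
  · exact h2
  · exact (add_comm _ _).trans h2
  · exact h3
  · exact (add_comm _ _).trans h3

theorem two_le_finrank_hexLine (hZ : ∑ i, Z i = 0) (s : Equiv.Perm (Fin 6)) :
    2 ≤ finrank k (hexLine Z s) := by
  let φ : (Fin 4 → k) →ₗ[k] (Fin 2 → k) := LinearMap.pi ![Z (s 0) + Z (s 1), Z (s 2) + Z (s 3)]
  have hle : LinearMap.ker φ ≤ hexLine Z s := by
    intro x hx
    have h1 : Z (s 0) x + Z (s 1) x = 0 := congrFun hx 0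
    have h2 : Z (s 2) x + Z (s 3) x = 0 := congrFun hx 1
    refine ⟨⟨h1, h2⟩, ?_⟩
    have h3 := LinearMap.congr_fun hZ x
    rw [← Equiv.sum_comp s, LinearMap.sum_apply, Fin.sum_univ_six, LinearMap.zero_apply] at h3
    change Z (s 4) x + Z (s 5) x = 0
    linear_combination h3 - h1 - h2
  have h1 := φ.finrank_range_add_finrank_ker
  have h2 := (LinearMap.range φ).finrank_le
  have h3 := Submodule.finrank_mono hle
  rw [finrank_fin_fun] at h1 h2
  omega

/-- A partition into pairs either has one pair inside each triple, which happens for the nine cell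
lines, or matches the two triples, which happens for the six root lines of the relation `∑ uᵢ + ∑ vⱼ
= 0`. -/
theorem partner_cases (s : Equiv.Perm (Fin 6)) :
    (∃ i j, partner s (idxLeft (i + 1)) = idxLeft (i + 2) ∧
      partner s (idxRight (j + 1)) = idxRight (j + 2)) ∨
    ∃ σ : Equiv.Perm (Fin 3), ∀ i, partner s (idxLeft i) = idxRight (σ i) := by
  revert s; decide +kernel

theorem exists_partner_cell (i j : Fin 3) : ∃ s : Equiv.Perm (Fin 6),
    partner s (idxLeft (i + 1)) = idxLeft (i + 2) ∧
      partner s (idxRight (j + 1)) = idxRight (j + 2) := by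
  revert i j; decide +kernel

theorem exists_partner_root (σ : Equiv.Perm (Fin 3)) : ∃ s : Equiv.Perm (Fin 6),
    ∀ i, partner s (idxLeft i) = idxRight (σ i) := by
  revert σ; decide +kernel

theorem IsHexahedral.hexLine_eq_cellLine [CharZero k] (hT : IsPolar F T) (h : IsHexahedral F Z β)
    {s : Equiv.Perm (Fin 6)} {i j : Fin 3} (h1 : partner s (idxLeft (i + 1)) = idxLeft (i + 2))
    (h2 : partner s (idxRight (j + 1)) = idxRight (j + 2)) :
    hexLine Z s = cellLine (hexLeft Z) (hexRight Z) i j := by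
  refine Submodule.eq_of_le_of_finrank_le (fun x hx => ⟨?_, ?_⟩) ?_
  · have := add_partner_eq_zero hx (idxLeft (i + 1))
    rwa [h1] at this
  · have := add_partner_eq_zero hx (idxRight (j + 1))
    rwa [h2] at this
  · rw [(h.isSteiner.isLineOn_cellLine hT i j).1]
    exact two_le_finrank_hexLine h.sum_eq_zero s

/-- As all `Z` add up to zero, the sum of `uᵢ` and `v_{σ i}` is minus the sum of the two `Z` that
they omit. -/
theorem IsHexahedral.hexLine_eq_rootLine [CharZero k] (hT : IsPolar F T) (h : IsHexahedral F Z β)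
    (hm : IsMarking F (hexLeft Z) (hexRight Z) A B) (hA : A 0 = 1) (hB : B 0 = 1)
    {s : Equiv.Perm (Fin 6)} {σ : Equiv.Perm (Fin 3)}
    (h1 : ∀ i, partner s (idxLeft i) = idxRight (σ i)) :
    hexLine Z s = rootLine (hexLeft Z) (hexRight Z) (A 0) (B 0) σ := by
  refine Submodule.eq_of_le_of_finrank_le (fun x hx => ?_) ?_
  · rw [mem_rootLine]
    intro i
    rw [hA, hB]
    have h2 := add_partner_eq_zero hx (idxLeft i)
    rw [h1] at h2
    have h3 : ∑ i, Z (idxLeft i) x + ∑ j, Z (idxRight j) x = 0 := by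
      rw [← sum_idx fun l => Z l x, ← LinearMap.sum_apply, h.sum_eq_zero, LinearMap.zero_apply]
    rw [sum_rotate _ i, sum_rotate _ (σ i)] at h3
    simp only [Pi.one_apply, one_mul, hexLeft, hexRight, LinearMap.add_apply]
    linear_combination h3 - h2
  · rw [(hm.isLineOn_rootLine hT 0 σ).1]
    exact two_le_finrank_hexLine h.sum_eq_zero s

/-- The double-six determined by hexahedral equations consists of the root lines of the relations
other than `∑ uᵢ + ∑ vⱼ = 0`. -/
theorem IsHexahedral.hexDoubleSix_eq [CharZero k] [IsAlgClosed k] (hT : IsPolar F T)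
    (h : IsHexahedral F Z β) (hm : IsMarking F (hexLeft Z) (hexRight Z) A B) (hA : A 0 = 1)
    (hB : B 0 = 1) : hexDoubleSix F Z = rootSix (hexLeft Z) (hexRight Z) A B 0 := by
  ext L
  constructor
  · rintro ⟨hL, hne⟩
    rcases hm.eq_cellLine_or_eq_rootLine hT hL with ⟨i, j, rfl⟩ | ⟨ρ, σ, rfl⟩
    · obtain ⟨s, h1, h2⟩ := exists_partner_cell i j
      exact absurd (h.hexLine_eq_cellLine hT h1 h2).symm (hne s)
    · refine ⟨ρ, ?_, σ, rfl⟩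
      rintro rfl
      obtain ⟨s, h1⟩ := exists_partner_root σ
      exact hne s (h.hexLine_eq_rootLine hT hm hA hB h1).symm
  · rintro ⟨ρ, hρ, σ, rfl⟩
    refine ⟨hm.isLineOn_rootLine hT ρ σ, fun s he => ?_⟩
    rcases partner_cases s with ⟨i, j, h1, h2⟩ | ⟨τ, h1⟩
    · rw [h.hexLine_eq_cellLine hT h1 h2] at he
      exact hm.rootLine_ne_cellLine hT _ _ _ _ he
    · rw [h.hexLine_eq_rootLine hT hm hA hB h1] at he
      exact hρ (hm.rootLine_injective hT he).1

/-- The hexahedral linear forms obtained from a description `u₀u₁u₂ + v₀v₁v₂ = 0` in which the forms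
add up to zero. -/
def hexForms (u v : Fin 3 → Dual k (Fin 4 → k)) : Fin 6 → Dual k (Fin 4 → k) :=
  let s : Dual k (Fin 4 → k) := (1 / 2 : k) • ∑ i, u i
  let t : Dual k (Fin 4 → k) := (1 / 2 : k) • ∑ j, v j
  ![s - u 1, s - u 2, t - v 1, t - v 2, s - u 0, t - v 0]

/-- The constants of hexahedral equations obtained from a linear relation. -/
def hexConsts (a b : Fin 3 → k) : Fin 6 → k :=
  ![∑ i, a i - a 1, ∑ i, a i - a 2, ∑ j, b j - b 1, ∑ j, b j - b 2, ∑ i, a i - a 0,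
    ∑ j, b j - b 0]

theorem hexLeft_hexForms [CharZero k] : hexLeft (hexForms u v) = u := by
  funext i
  refine LinearMap.ext fun x => ?_
  rw [hexLeft]
  fin_cases i
  · change hexForms u v 0 x + hexForms u v 1 x = u 0 x
    simp [hexForms, Fin.sum_univ_three]; ring
  · change hexForms u v 1 x + hexForms u v 4 x = u 1 x
    simp [hexForms, Fin.sum_univ_three]; ring
  · change hexForms u v 4 x + hexForms u v 0 x = u 2 x
    simp [hexForms, Fin.sum_univ_three]; ring

theorem hexRight_hexForms [CharZero k] : hexRight (hexForms u v) = v := by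
  funext i
  refine LinearMap.ext fun x => ?_
  rw [hexRight]
  fin_cases i
  · change hexForms u v 2 x + hexForms u v 3 x = v 0 x
    simp [hexForms, Fin.sum_univ_three]; ring
  · change hexForms u v 3 x + hexForms u v 5 x = v 1 x
    simp [hexForms, Fin.sum_univ_three]; ring
  · change hexForms u v 5 x + hexForms u v 2 x = v 2 x
    simp [hexForms, Fin.sum_univ_three]; ring

/-- The relation with index `0` becomes `∑ Zᵢ = 0` and the one with index `1` becomes `∑ βᵢ Zᵢ = 0`.
The independence of the two relations prevents the `βᵢ` from being all equal. -/
theorem IsMarking.isHexahedral [CharZero k] (hT : IsPolar F T) (hm : IsMarking F u v A B)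
    (hA : A 0 = 1) (hB : B 0 = 1) : IsHexahedral F (hexForms u v) (hexConsts (A 1) (B 1)) := by
  have h0 := hm.rel 0
  rw [hA, hB] at h0
  have h0' : ∀ x, v 2 x = -(u 0 x + u 1 x + u 2 x + v 0 x + v 1 x) := fun x => by
    have := h0 x
    simp only [Fin.sum_univ_three, Pi.one_apply, one_mul] at this
    linear_combination this
  refine ⟨fun x hx => ?_, ?_, ?_, ?_, ?_⟩
  · have hu : ∀ i, u i x = 0 := fun i => by
      rw [← hexLeft_hexForms (u := u) (v := v), hexLeft, LinearMap.add_apply, hx, hx, add_zero]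
    have hv : ∀ i, v i x = 0 := fun i => by
      rw [← hexRight_hexForms (u := u) (v := v), hexRight, LinearMap.add_apply, hx, hx, add_zero]
    exact hm.steiner.eq_zero hT 0 0 (hu _) (hu _) (hv _) (hv _)
  · refine LinearMap.ext fun x => ?_
    simp [Fin.sum_univ_six, Fin.sum_univ_three, hexForms, h0']
    ring
  -- Each `Z` of the left triple occurs in the two `uᵢ` with the other indices, whence the
  -- coefficient `∑ aᵢ` minus one term; likewise on the right.
  · refine LinearMap.ext fun x => ?_
    have h1 := hm.rel 1 x
    simp [Fin.sum_univ_three, h0'] at h1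
    simp [Fin.sum_univ_six, Fin.sum_univ_three, hexForms, hexConsts, h0']
    linear_combination h1
  · by_contra hc
    push Not at hc
    have key : ∀ s, (∀ i, hexConsts (A 1) (B 1) i = s) → (∀ i, A 1 i = s / 2) ∧
        ∀ j, B 1 j = s / 2 := by
      intro s hs
      have e0 : ∑ i, A 1 i - A 1 0 = s := hs 4
      have e1 : ∑ i, A 1 i - A 1 1 = s := hs 0
      have e2 : ∑ i, A 1 i - A 1 2 = s := hs 1
      have f0 : ∑ i, B 1 i - B 1 0 = s := hs 5
      have f1 : ∑ i, B 1 i - B 1 1 = s := hs 2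
      have f2 : ∑ i, B 1 i - B 1 2 = s := hs 3
      rw [Fin.sum_univ_three] at e0 e1 e2 f0 f1 f2
      constructor
      · intro i
        fin_cases i
        · change A 1 0 = _; linear_combination (-e0 + e1 + e2) / 2
        · change A 1 1 = _; linear_combination (e0 - e1 + e2) / 2
        · change A 1 2 = _; linear_combination (e0 + e1 - e2) / 2
      · intro i
        fin_cases i
        · change B 1 0 = _; linear_combination (-f0 + f1 + f2) / 2
        · change B 1 1 = _; linear_combination (f0 - f1 + f2) / 2
        · change B 1 2 = _; linear_combination (f0 + f1 - f2) / 2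
    obtain ⟨h1, h2⟩ := key _ fun i => hc i 0
    have := hm.independent 0 1 (by decide) (-(hexConsts (A 1) (B 1) 0 / 2)) 1
      (fun i => by rw [hA, h1, Pi.one_apply]; ring) (fun i => by rw [hB, h2, Pi.one_apply]; ring)
    exact one_ne_zero this.2
  · obtain ⟨c, hc, h⟩ := hm.steiner
    refine ⟨-3 * c, mul_ne_zero (by norm_num) hc, fun x => ?_⟩
    rw [mul_assoc, ← h]
    simp [Fin.sum_univ_six, Fin.sum_univ_three, Fin.prod_univ_three, hexForms, h0']
    ring

theorem IsMarking.hexDoubleSix_hexForms [CharZero k] [IsAlgClosed k] (hT : IsPolar F T)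
    (hm : IsMarking F u v A B) (hA : A 0 = 1) (hB : B 0 = 1) : hexDoubleSix F (hexForms u v) = rootSix u v A B 0 := by
  have e1 := hexLeft_hexForms (u := u) (v := v)
  have e2 := hexRight_hexForms (u := u) (v := v)
  have hm' : IsMarking F (hexLeft (hexForms u v)) (hexRight (hexForms u v)) A B := by
    rw [e1, e2]; exact hm
  rw [(hm.isHexahedral hT hA hB).hexDoubleSix_eq hT hm' hA hB, e1, e2]

/-- Every double-six which avoids the lines of a grid consists of the root lines of two relations for
a marking with this grid. -/
theorem IsMarking.exists_remark [CharZero k] [IsAlgClosed k] (hT : IsPolar F T)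
    (h : IsMarking F u v A B) (g : Fin 17) : ∃ u' v' A' B', IsMarking F u' v' A' B' ∧
      ∀ r, (∀ i j, (sixMask r).testBit (grid g i j).1 = false) →
        ∃ ρ, sixLines u v A B r = rootSix u' v' A' B' ρ := by
  obtain ⟨u', v', hs, hcell⟩ := hT.exists_isSteiner_of_grid
    (g := fun i j => mark u v A B (grid g i j)) (fun i j => h.isLineOn_mark hT _)
    (fun i j i' j' hij => (h.mark_injective hT).ne (adj_grid g i i' j j' hij).1)
    (fun i j i' j' hij hor => (h.mark_inf_ne_bot hT (adj_grid g i i' j j' hij).1).2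
      ((adj_grid g i i' j j' hij).2 hor))
  obtain ⟨a, b, ha, hb, A', B', hm⟩ := hs.exists_isMarking hT
  refine ⟨_, _, A', B', hm, fun r hr => ?_⟩
  obtain ⟨r', hr'⟩ := hm.exists_eq_sixLines hT (h.isDoubleSix_sixLines hT r)
  -- In the new marking the grid consists of the cell lines, so `exists_eq_of_avoids` applies there.
  obtain ⟨ρ, rfl⟩ := exists_eq_of_avoids (r := r') fun i j => by
    by_contra hc
    rw [Bool.not_eq_false, ← hm.mark_mem_sixLines hT, ← hr', mark_of_blk_zero (blk_label _ _ _),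
      row_label, col_label, cellLine, LinearMap.ker_smul _ _ (ha i), LinearMap.ker_smul _ _ (hb j)]
      at hc
    change cellLine u' v' i j ∈ _ at hc
    rw [← hcell, h.mark_mem_sixLines hT, hr] at hc
    exact Bool.false_ne_true hc
  exact ⟨ρ, hr'.trans (sixLines_eq_rootSix ρ)⟩

/-- Markings can be normalized such that a given relation becomes `∑ uᵢ + ∑ vⱼ = 0`. -/
theorem IsMarking.exists_normalized (h : IsMarking F u v A B) (s : Equiv.Perm (Fin 3)) :
    ∃ u' v' A' B', IsMarking F u' v' A' B' ∧ A' 0 = 1 ∧ B' 0 = 1 ∧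
      ∀ ρ, rootSix u' v' A' B' ρ = rootSix u v A B (s ρ) := by
  have h1 := h.comp_perm s
  have h2 := h1.smul (h1.ne_zero_left 0) (h1.ne_zero_right 0) (h1.prod_eq 0)
  refine ⟨_, _, _, _, h2, funext fun i => div_self (h1.ne_zero_left 0 i),
    funext fun i => div_self (h1.ne_zero_right 0 i), fun ρ => ?_⟩
  rw [rootSix_smul (h1.ne_zero_left 0) (h1.ne_zero_right 0), rootSix_comp_perm]

/-- Every double-six is determined by hexahedral equations. -/
theorem IsMarking.exists_isHexahedral [CharZero k] [IsAlgClosed k] (hT : IsPolar F T)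
    (h : IsMarking F u v A B) {D : Set (Submodule k (Fin 4 → k))} (hD : IsDoubleSix F D) :
    ∃ Z β, IsHexahedral F Z β ∧ D = hexDoubleSix F Z := by
  obtain ⟨r, rfl⟩ := h.exists_eq_sixLines hT hD
  obtain ⟨g, hg⟩ := exists_grid r
  obtain ⟨u', v', A', B', hm, hrho⟩ := h.exists_remark hT g
  obtain ⟨ρ, hρ⟩ := hrho r hg
  obtain ⟨u₁, v₁, A₁, B₁, hm₁, hA, hB, hsix⟩ := hm.exists_normalized (Equiv.swap 0 ρ)
  exact ⟨_, _, hm₁.isHexahedral hT hA hB, by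
    rw [hm₁.hexDoubleSix_hexForms hT hA hB, hsix, Equiv.swap_apply_left, hρ]⟩

end CubicSurface
end

/-! ### The fifteen planes `Z_a + Z_b = 0` -/

noncomputable section
namespace CubicSurface
open Module
variable {k : Type*} [Field k] {F : MvPolynomial (Fin 4) k}
  {T : (Fin 4 → k) →ₗ[k] (Fin 4 → k) →ₗ[k] (Fin 4 → k) →ₗ[k] k}
  {u v u' v' : Fin 3 → Dual k (Fin 4 → k)} {A B : Fin 3 → Fin 3 → k} {a b : Fin 3 → k}
  {Z Z' : Fin 6 → Dual k (Fin 4 → k)} {β β' : Fin 6 → k}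

theorem exists_perm_four {a b c d : Fin 6} (h1 : a ≠ b) (h2 : a ≠ c) (h3 : a ≠ d) (h4 : b ≠ c)
    (h5 : b ≠ d) (h6 : c ≠ d) :
    ∃ s : Equiv.Perm (Fin 6), s 0 = a ∧ s 1 = b ∧ s 2 = c ∧ s 3 = d := by
  refine ⟨Equiv.swap (Equiv.swap (Equiv.swap (Equiv.swap 0 a 1) b (Equiv.swap 0 a 2)) c
    (Equiv.swap (Equiv.swap 0 a 1) b (Equiv.swap 0 a 3))) d *
    Equiv.swap (Equiv.swap (Equiv.swap 0 a 1) b (Equiv.swap 0 a 2)) c *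
    Equiv.swap (Equiv.swap 0 a 1) b * Equiv.swap 0 a, ?_⟩
  revert a b c d
  decide +kernel

/-- Two pairs have a common element. -/
def Share (a b c d : Fin 6) : Bool := a == c || a == d || b == c || b == d

set_option synthInstance.maxSize 2000 in
set_option synthInstance.maxHeartbeats 400000 in
set_option maxRecDepth 10000 in
/-- Three pairs of indices with pairwise common elements form a triangle if there are two further
pairs disjoint from them. -/
theorem duads_triangle : ∀ a₀ b₀ : Fin 6, a₀ < b₀ → ∀ a₁ b₁ : Fin 6, a₁ < b₁ →
    Share a₀ b₀ a₁ b₁ = true → ¬ (a₀ = a₁ ∧ b₀ = b₁) → ∀ a₂ b₂ : Fin 6, a₂ < b₂ →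
    Share a₀ b₀ a₂ b₂ = true → Share a₁ b₁ a₂ b₂ = true →
    ¬ (a₀ = a₂ ∧ b₀ = b₂) → ¬ (a₁ = a₂ ∧ b₁ = b₂) → ∀ c₀ d₀ : Fin 6, c₀ < d₀ →
    Share a₀ b₀ c₀ d₀ = false → Share a₁ b₁ c₀ d₀ = false → Share a₂ b₂ c₀ d₀ = false →
    ∀ c₁ d₁ : Fin 6, c₁ < d₁ →
    Share a₀ b₀ c₁ d₁ = false → Share a₁ b₁ c₁ d₁ = false → Share a₂ b₂ c₁ d₁ = false →
    ¬ (c₀ = c₁ ∧ d₀ = d₁) → ∃ p₀ p₁ p₂ : Fin 6, (a₀ = p₁ ∧ b₀ = p₂ ∨ a₀ = p₂ ∧ b₀ = p₁) ∧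
    (a₁ = p₂ ∧ b₁ = p₀ ∨ a₁ = p₀ ∧ b₁ = p₂) ∧ (a₂ = p₀ ∧ b₂ = p₁ ∨ a₂ = p₁ ∧ b₂ = p₀) := by
  decide +kernel

theorem share_comm (a b c d : Fin 6) : Share a b c d = Share c d a b := by
  revert a b c d; decide +kernel

theorem share_eq_false {a b c d : Fin 6} : Share a b c d = false ↔
    ((a ≠ c ∧ a ≠ d) ∧ b ≠ c) ∧ b ≠ d := by
  simp only [Share, Bool.or_eq_false_iff, beq_eq_false_iff_ne]

theorem ne_of_share_eq_false {a b c d p q r s : Fin 6} (h1 : a = p ∧ b = q ∨ a = q ∧ b = p)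
    (h2 : c = r ∧ d = s ∨ c = s ∧ d = r) (h3 : Share a b c d = false) :
    p ≠ r ∧ p ≠ s ∧ q ≠ r ∧ q ≠ s := by
  obtain ⟨⟨⟨h4, h5⟩, h6⟩, h7⟩ := share_eq_false.1 h3
  rcases h1 with ⟨rfl, rfl⟩ | ⟨rfl, rfl⟩ <;> rcases h2 with ⟨rfl, rfl⟩ | ⟨rfl, rfl⟩
  exacts [⟨h4, h5, h6, h7⟩, ⟨h5, h4, h7, h6⟩, ⟨h6, h7, h4, h5⟩, ⟨h7, h6, h5, h4⟩]

/-- Two triangles of pairs of indices that are disjoint from each other. -/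
theorem exists_perm_of_duads {a b c d : Fin 3 → Fin 6} (hab : ∀ i, a i < b i)
    (hcd : ∀ j, c j < d j) (h1 : ∀ i i', i ≠ i' → Share (a i) (b i) (a i') (b i') = true ∧
      ¬ (a i = a i' ∧ b i = b i'))
    (h2 : ∀ i i', i ≠ i' → Share (c i) (d i) (c i') (d i') = true ∧ ¬ (c i = c i' ∧ d i = d i'))
    (h3 : ∀ i j, Share (a i) (b i) (c j) (d j) = false) :
    ∃ s : Equiv.Perm (Fin 6), ∀ i,
      (a i = s (idxLeft (i + 1)) ∧ b i = s (idxLeft (i + 2)) ∨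
        a i = s (idxLeft (i + 2)) ∧ b i = s (idxLeft (i + 1))) ∧
      (c i = s (idxRight (i + 1)) ∧ d i = s (idxRight (i + 2)) ∨
        c i = s (idxRight (i + 2)) ∧ d i = s (idxRight (i + 1))) := by
  have h4 : ∀ i j, Share (c i) (d i) (a j) (b j) = false := fun i j => by rw [share_comm, h3]
  obtain ⟨p₀, p₁, p₂, hp₀, hp₁, hp₂⟩ := duads_triangle _ _ (hab 0) _ _ (hab 1)
    (h1 0 1 (by decide)).1 (h1 0 1 (by decide)).2 _ _ (hab 2) (h1 0 2 (by decide)).1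
    (h1 1 2 (by decide)).1 (h1 0 2 (by decide)).2 (h1 1 2 (by decide)).2 _ _ (hcd 0) (h3 _ _)
    (h3 _ _) (h3 _ _) _ _ (hcd 1) (h3 _ _) (h3 _ _) (h3 _ _) (h2 0 1 (by decide)).2
  obtain ⟨q₀, q₁, q₂, hq₀, hq₁, hq₂⟩ := duads_triangle _ _ (hcd 0) _ _ (hcd 1)
    (h2 0 1 (by decide)).1 (h2 0 1 (by decide)).2 _ _ (hcd 2) (h2 0 2 (by decide)).1
    (h2 1 2 (by decide)).1 (h2 0 2 (by decide)).2 (h2 1 2 (by decide)).2 _ _ (hab 0) (h4 _ _)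
    (h4 _ _) (h4 _ _) _ _ (hab 1) (h4 _ _) (h4 _ _) (h4 _ _) (h1 0 1 (by decide)).2
  have hp : p₀ ≠ p₁ ∧ p₀ ≠ p₂ ∧ p₁ ≠ p₂ := by
    have := hab 0
    have := hab 1
    have := hab 2
    omega
  have hq : q₀ ≠ q₁ ∧ q₀ ≠ q₂ ∧ q₁ ≠ q₂ := by
    have := hcd 0
    have := hcd 1
    have := hcd 2
    omega
  have hpq : (p₀ ≠ q₀ ∧ p₀ ≠ q₁ ∧ p₀ ≠ q₂) ∧ (p₁ ≠ q₀ ∧ p₁ ≠ q₁ ∧ p₁ ≠ q₂) ∧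
      (p₂ ≠ q₀ ∧ p₂ ≠ q₁ ∧ p₂ ≠ q₂) := by
    have e00 := ne_of_share_eq_false hp₀ hq₀ (h3 0 0)
    have e01 := ne_of_share_eq_false hp₀ hq₁ (h3 0 1)
    have e10 := ne_of_share_eq_false hp₁ hq₀ (h3 1 0)
    have e11 := ne_of_share_eq_false hp₁ hq₁ (h3 1 1)
    exact ⟨⟨e11.2.2.2, e10.2.2.1, e10.2.2.2⟩, ⟨e01.2.1, e00.1, e00.2.1⟩,
      ⟨e11.2.1, e10.1, e10.2.1⟩⟩
  obtain ⟨s, h5, h6, h7, h8, h9, h10⟩ : ∃ s : Equiv.Perm (Fin 6), s 0 = p₁ ∧ s 1 = p₂ ∧ s 2 = q₁ ∧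
      s 3 = q₂ ∧ s 4 = p₀ ∧ s 5 = q₀ := by
    obtain ⟨s, rfl, rfl, rfl, rfl⟩ := exists_perm_four hp.2.2 hpq.2.1.2.1 hpq.2.1.2.2 hpq.2.2.2.1
      hpq.2.2.2.2 hq.2.2
    obtain ⟨i, rfl⟩ := s.surjective p₀
    obtain ⟨j, rfl⟩ := s.surjective q₀
    simp only [ne_eq, s.injective.eq_iff] at hp hq hpq
    have : i = 4 ∧ j = 5 ∨ i = 5 ∧ j = 4 := by
      clear * - hp hq hpq; revert i j; decide
    rcases this with ⟨rfl, rfl⟩ | ⟨rfl, rfl⟩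
    · exact ⟨s, rfl, rfl, rfl, rfl, rfl, rfl⟩
    · exact ⟨s * Equiv.swap 4 5, rfl, rfl, rfl, rfl, rfl, rfl⟩
  refine ⟨s, fun i => ?_⟩
  fin_cases i
  · change (_ = s 0 ∧ _ = s 1 ∨ _ = s 1 ∧ _ = s 0) ∧ (_ = s 2 ∧ _ = s 3 ∨ _ = s 3 ∧ _ = s 2)
    rw [h5, h6, h7, h8]
    exact ⟨hp₀, hq₀⟩
  · change (_ = s 1 ∧ _ = s 4 ∨ _ = s 4 ∧ _ = s 1) ∧ (_ = s 3 ∧ _ = s 5 ∨ _ = s 5 ∧ _ = s 3)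
    rw [h6, h8, h9, h10]
    exact ⟨hp₁, hq₁⟩
  · change (_ = s 4 ∧ _ = s 0 ∨ _ = s 0 ∧ _ = s 4) ∧ (_ = s 5 ∧ _ = s 2 ∨ _ = s 2 ∧ _ = s 5)
    rw [h5, h7, h9, h10]
    exact ⟨hp₂, hq₂⟩

section

variable [CharZero k] (hT : IsPolar F T)

include hT

theorem IsSteiner.left_ne_zero (h : IsSteiner F u v) (i : Fin 3) : u i ≠ 0 := fun h0 => by
  obtain ⟨i', hi', -⟩ := exists_ne_ne i i
  obtain ⟨x, hx, -⟩ := h.exists_point_eq hT i' 0 (fun _ => 1) (fun _ => 0)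
  have := hx i hi'.symm
  rw [h0] at this
  exact one_ne_zero this.symm

/-- On such a line the product of the `vⱼ` vanishes too, so it would be a cell line of two different
rows. -/
theorem IsSteiner.false_of_le (h : IsSteiner F u v) {i i' : Fin 3} (hi : i ≠ i')
    {L : Submodule k (Fin 4 → k)} (hL : IsLineOn F L) (h1 : L ≤ LinearMap.ker (u i))
    (h2 : L ≤ LinearMap.ker (u i')) : False := by
  obtain ⟨c, hc, hs⟩ := h
  have key : ∀ j, ¬ L ≤ LinearMap.ker (v j) := by
    intro j hle
    have h5 := eq_of_le_of_finrank_two hL.1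
      (IsSteiner.isLineOn_cellLine hT ⟨c, hc, hs⟩ i j).1 (le_inf h1 hle)
    have h6 := eq_of_le_of_finrank_two hL.1
      (IsSteiner.isLineOn_cellLine hT ⟨c, hc, hs⟩ i' j).1 (le_inf h2 hle)
    exact hi (IsSteiner.cellLine_injective hT ⟨c, hc, hs⟩ (h5.symm.trans h6)).1
  have h3 : ∀ x ∈ L, v 0 x * v 1 x * v 2 x = 0 := fun x hx => by
    have := hs x
    rw [hL.2 x hx, Finset.prod_eq_zero (f := fun i => u i x) (Finset.mem_univ i) (h1 hx), mul_zero,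
      zero_add, Fin.prod_univ_three] at this
    exact this
  rcases le_ker_of_mul_mul_eq_zero h3 with h5 | h5 | h5
  exacts [key _ h5, key _ h5, key _ h5]

theorem IsSteiner.not_isLineOn (h : IsSteiner F u v) {i i' : Fin 3} (hi : i ≠ i') :
    ¬ IsLineOn F (LinearMap.ker (u i) ⊓ LinearMap.ker (u i')) :=
  fun hL => h.false_of_le hT hi hL inf_le_left inf_le_right

/-- Renumbering makes the line a cell line. Together with `IsHexahedral.not_isLineOn` this
recognises disjointness of two index pairs from the intersection of their planes. -/
theorem IsHexahedral.isLineOn_of_disjoint (h : IsHexahedral F Z β) {a b c d : Fin 6} (h1 : a ≠ b)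
    (h2 : c ≠ d) (h3 : Share a b c d = false) :
    IsLineOn F (LinearMap.ker (Z a + Z b) ⊓ LinearMap.ker (Z c + Z d)) := by
  obtain ⟨⟨⟨h4, h5⟩, h6⟩, h7⟩ := share_eq_false.1 h3
  obtain ⟨s, rfl, rfl, rfl, rfl⟩ := exists_perm_four h1 h4 h5 h6 h7 h2
  exact (h.comp_perm s).isSteiner.isLineOn_cellLine hT 0 0

theorem IsHexahedral.false_of_le (h : IsHexahedral F Z β) {a b c : Fin 6} (h1 : a ≠ b)
    (h2 : a ≠ c) (h3 : b ≠ c) {L : Submodule k (Fin 4 → k)} (hL : IsLineOn F L)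
    (h4 : L ≤ LinearMap.ker (Z b + Z a)) (h5 : L ≤ LinearMap.ker (Z a + Z c)) : False := by
  obtain ⟨d, hd⟩ : ∃ d : Fin 6, d ≠ a ∧ d ≠ b ∧ d ≠ c := by
    clear * -; revert a b c; decide +kernel
  obtain ⟨s, rfl, rfl, rfl, -⟩ := exists_perm_four h1.symm h3 hd.2.1.symm h2 hd.1.symm hd.2.2.symm
  have h6 := (h.comp_perm (s * Equiv.swap 2 4)).isSteiner.false_of_le hT
    (show (0 : Fin 3) ≠ 1 by decide) hL
  exact h6 h4 h5

theorem IsHexahedral.not_isLineOn (h : IsHexahedral F Z β) {a b c : Fin 6} (h1 : a ≠ b)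
    (h2 : a ≠ c) (h3 : b ≠ c) :
    ¬ IsLineOn F (LinearMap.ker (Z b + Z a) ⊓ LinearMap.ker (Z a + Z c)) :=
  fun hL => h.false_of_le hT h1 h2 h3 hL inf_le_left inf_le_right

theorem IsHexahedral.isLineOn_hexLine (h : IsHexahedral F Z β) (s : Equiv.Perm (Fin 6)) :
    IsLineOn F (hexLine Z s) := by
  have h1 := h.isLineOn_of_disjoint hT (s.injective.ne (show (0 : Fin 6) ≠ 1 by decide))
    (s.injective.ne (show (2 : Fin 6) ≠ 3 by decide)) (share_eq_false.2
      ⟨⟨⟨s.injective.ne (by decide), s.injective.ne (by decide)⟩, s.injective.ne (by decide)⟩,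
        s.injective.ne (by decide)⟩)
  refine ⟨le_antisymm ?_ (two_le_finrank_hexLine h.sum_eq_zero s), fun x hx => h1.2 x hx.1⟩
  rw [← h1.1]
  exact Submodule.finrank_mono inf_le_left

theorem IsHexahedral.add_ne_zero (h : IsHexahedral F Z β) {a b : Fin 6} (h1 : a ≠ b) :
    Z a + Z b ≠ 0 := by
  obtain ⟨s, rfl, rfl⟩ := exists_perm_apply a b h1
  have := (h.comp_perm (s * Equiv.swap 0 4 * Equiv.swap 1 5)).isSteiner.left_ne_zero hT 0
  exact this

/-- A plane containing two of the fifteen lines is one of the fifteen planes `Z_a + Z_b = 0`. -/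
theorem IsHexahedral.exists_add_ker [IsAlgClosed k] (h : IsHexahedral F Z β)
    {s t : Equiv.Perm (Fin 6)} (hne : hexLine Z s ≠ hexLine Z t)
    (hmeet : hexLine Z s ⊓ hexLine Z t ≠ ⊥) : ∃ a b, a < b ∧
      hexLine Z s ≤ LinearMap.ker (Z a + Z b) ∧ hexLine Z t ≤ LinearMap.ker (Z a + Z b) := by
  obtain ⟨A, B, hm, hA, hB⟩ := h.exists_isMarking hT
  suffices H : ∃ a b, a ≠ b ∧
      hexLine Z s ≤ LinearMap.ker (Z a + Z b) ∧ hexLine Z t ≤ LinearMap.ker (Z a + Z b) by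
    obtain ⟨a, b, hab, h1⟩ := H
    rcases lt_or_gt_of_ne hab with h2 | h2
    · exact ⟨a, b, h2, h1⟩
    · exact ⟨b, a, h2, by rwa [add_comm]⟩
  have hrow : ∀ i j, cellLine (hexLeft Z) (hexRight Z) i j ≤
      LinearMap.ker (Z (idxLeft (i + 1)) + Z (idxLeft (i + 2))) := fun i j => inf_le_left
  have hcol : ∀ i j, cellLine (hexLeft Z) (hexRight Z) i j ≤
      LinearMap.ker (Z (idxRight (j + 1)) + Z (idxRight (j + 2))) := fun i j => inf_le_right
  -- This shows that a cell line also lies in a third plane, one that mixes the two triples.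
  have hsum : ∀ i j x, hexLeft Z i x + hexRight Z j x =
      -(Z (idxLeft i) x + Z (idxRight j) x) := by
    intro i j x
    have h3 : ∑ i, Z (idxLeft i) x + ∑ j, Z (idxRight j) x = 0 := by
      rw [← sum_idx fun l => Z l x, ← LinearMap.sum_apply, h.sum_eq_zero, LinearMap.zero_apply]
    rw [sum_rotate _ i, sum_rotate _ j] at h3
    simp only [hexLeft, hexRight, LinearMap.add_apply]
    linear_combination h3
  have hcell : ∀ i j, cellLine (hexLeft Z) (hexRight Z) i j ≤
      LinearMap.ker (Z (idxLeft i) + Z (idxRight j)) := by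
    rintro i j x ⟨h1, h2⟩
    have h3 := hsum i j x
    rw [show hexLeft Z i x = 0 from h1, show hexRight Z j x = 0 from h2] at h3
    rw [LinearMap.mem_ker, LinearMap.add_apply]
    linear_combination h3
  have hroot : ∀ i σ, rootLine (hexLeft Z) (hexRight Z) (A 0) (B 0) σ ≤
      LinearMap.ker (Z (idxLeft i) + Z (idxRight (σ i))) := by
    intro i σ x hx
    have h2 := mem_rootLine.1 hx i
    rw [hA, hB, Pi.one_apply, Pi.one_apply, one_mul, one_mul, hsum] at h2
    rw [LinearMap.mem_ker, LinearMap.add_apply]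
    linear_combination -h2
  have n1 : ∀ i, idxLeft (i + 1) ≠ idxLeft (i + 2) := by decide
  have n2 : ∀ i, idxRight (i + 1) ≠ idxRight (i + 2) := by decide
  have n3 : ∀ i j, idxLeft i ≠ idxRight j := by decide
  rcases partner_cases s with ⟨i, j, h1, h2⟩ | ⟨σ, h1⟩ <;>
    rcases partner_cases t with ⟨i', j', h1', h2'⟩ | ⟨τ, h1'⟩
  · rw [h.hexLine_eq_cellLine hT h1 h2, h.hexLine_eq_cellLine hT h1' h2'] at *
    by_cases hi : i = i'
    · exact ⟨_, _, n1 i, hrow _ _, hi ▸ hrow _ _⟩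
    · by_cases hj : j = j'
      · exact ⟨_, _, n2 j, hcol _ _, hj ▸ hcol _ _⟩
      · exact absurd (h.isSteiner.cellLine_inf_eq_bot hT hi hj) hmeet
  · rw [h.hexLine_eq_cellLine hT h1 h2, h.hexLine_eq_rootLine hT hm hA hB h1'] at *
    obtain ⟨e, q, rfl⟩ := exists_eq_shift τ
    have := (hm.cellLine_inf_rootLine hT i j 0 e q).1 hmeet
    exact ⟨_, _, n3 i j, hcell _ _, this ▸ hroot _ _⟩
  · rw [h.hexLine_eq_rootLine hT hm hA hB h1, h.hexLine_eq_cellLine hT h1' h2'] at *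
    obtain ⟨e, q, rfl⟩ := exists_eq_shift σ
    rw [inf_comm] at hmeet
    have := (hm.cellLine_inf_rootLine hT i' j' 0 e q).1 hmeet
    exact ⟨_, _, n3 i' j', this ▸ hroot _ _, hcell _ _⟩
  · rw [h.hexLine_eq_rootLine hT hm hA hB h1, h.hexLine_eq_rootLine hT hm hA hB h1'] at *
    obtain ⟨e, q, rfl⟩ := exists_eq_shift σ
    obtain ⟨e', q', rfl⟩ := exists_eq_shift τ
    by_cases he : e' = e
    · subst he
      by_cases hq : q = q'
      · exact absurd (by rw [hq]) hne
      · exact absurd rfl ((hm.rootLine_inf_rootLine hT (Or.inr hq)).1 hmeet).1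
    · obtain ⟨i, hi⟩ := exists_shift_eq e q q'
      have he' : e' = !e := by revert he; cases e <;> cases e' <;> simp
      subst he'
      exact ⟨_, _, n3 i _, hroot i _, hi ▸ hroot i _⟩

end

end CubicSurface
end

/-! ### Uniqueness of the Cremona plane of a double-six -/

noncomputable section
namespace CubicSurface
open Module
variable {k : Type*} [Field k] {F : MvPolynomial (Fin 4) k}
  {T : (Fin 4 → k) →ₗ[k] (Fin 4 → k) →ₗ[k] (Fin 4 → k) →ₗ[k] k}
  {u v u' v' : Fin 3 → Dual k (Fin 4 → k)} {A B : Fin 3 → Fin 3 → k} {a b : Fin 3 → k}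
  {Z Z' : Fin 6 → Dual k (Fin 4 → k)} {β β' : Fin 6 → k}

theorem hexLine_comp (s t : Equiv.Perm (Fin 6)) : hexLine (Z ∘ s) t = hexLine Z (s * t) := rfl

theorem hexDoubleSix_comp (s : Equiv.Perm (Fin 6)) :
    hexDoubleSix F (Z ∘ s) = hexDoubleSix F Z := by
  ext L
  refine and_congr_right fun _ => ⟨fun h t => ?_, fun h t => ?_⟩
  · have := h (s⁻¹ * t)
    rwa [hexLine_comp, mul_inv_cancel_left] at this
  · rw [hexLine_comp]
    exact h _

theorem exists_eq_hexLine_of_eq (hD : hexDoubleSix F Z = hexDoubleSix F Z')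
    {t : Equiv.Perm (Fin 6)} (ht : IsLineOn F (hexLine Z' t)) : ∃ s, hexLine Z' t = hexLine Z s := by
  by_contra hc
  push Not at hc
  have h1 : hexLine Z' t ∈ hexDoubleSix F Z := ⟨ht, hc⟩
  rw [hD] at h1
  exact h1.2 t rfl

theorem exists_eq_smul_of_ker_eq {g h : Dual k (Fin 4 → k)} (hh : h ≠ 0)
    (hk : LinearMap.ker g = LinearMap.ker h) : ∃ t : k, g = t • h := by
  obtain ⟨e, he⟩ := LinearMap.surjective hh 1
  refine ⟨g e, LinearMap.ext fun x => ?_⟩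
  have h1 : x - h x • e ∈ LinearMap.ker h := by
    rw [LinearMap.mem_ker, map_sub, map_smul, he, smul_eq_mul, mul_one, sub_self]
  rw [← hk, LinearMap.mem_ker, map_sub, map_smul, sub_eq_zero] at h1
  rw [h1, LinearMap.smul_apply, smul_eq_mul, smul_eq_mul, mul_comm]

theorem hexForms_hexLeft_hexRight [CharZero k] (Z : Fin 6 → Dual k (Fin 4 → k)) :
    Z = hexForms (hexLeft Z) (hexRight Z) := by
  funext l
  refine LinearMap.ext fun x => ?_
  have e1 : ∀ i, hexLeft Z i x = Z (idxLeft (i + 1)) x + Z (idxLeft (i + 2)) x := fun i => rfl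
  have e2 : ∀ i, hexRight Z i x = Z (idxRight (i + 1)) x + Z (idxRight (i + 2)) x := fun i => rfl
  have l0 : hexLeft Z 0 x = Z 0 x + Z 1 x := e1 0
  have l1 : hexLeft Z 1 x = Z 1 x + Z 4 x := e1 1
  have l2 : hexLeft Z 2 x = Z 4 x + Z 0 x := e1 2
  have r0 : hexRight Z 0 x = Z 2 x + Z 3 x := e2 0
  have r1 : hexRight Z 1 x = Z 3 x + Z 5 x := e2 1
  have r2 : hexRight Z 2 x = Z 5 x + Z 2 x := e2 2
  fin_cases l <;>
  · simp [hexForms, Fin.sum_univ_three, l0, l1, l2, r0, r1, r2]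
    ring

section

variable [CharZero k] [IsAlgClosed k] (hT : IsPolar F T)

include hT

omit [IsAlgClosed k] in
theorem IsSteiner.exists_prod_ne_zero (h : IsSteiner F u v) :
    ∃ x, ∏ i, u i x = 0 ∧ ∏ j, v j x ≠ 0 := by
  by_contra hc
  push Not at hc
  have h1 : ∀ x ∈ LinearMap.ker (u 0), v 0 x * v 1 x * v 2 x = 0 := fun x hx => by
    rw [← Fin.prod_univ_three fun j => v j x]
    exact hc x (Finset.prod_eq_zero (Finset.mem_univ 0) hx)
  have key : ∀ j, ¬ LinearMap.ker (u 0) ≤ LinearMap.ker (v j) := fun j hle => by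
    have h2 := (h.isLineOn_cellLine hT 0 j).1
    rw [cellLine, inf_eq_left.2 hle, finrank_ker_eq_three (h.left_ne_zero hT 0)] at h2
    omega
  rcases le_ker_of_mul_mul_eq_zero h1 with h2 | h2 | h2
  exacts [key _ h2, key _ h2, key _ h2]

/-- Hexahedral equations that determine the same double-six have the same linear forms, up to
renumbering and a common factor. -/
theorem IsHexahedral.exists_perm_smul (h : IsHexahedral F Z β) (h' : IsHexahedral F Z' β')
    (hD : hexDoubleSix F Z = hexDoubleSix F Z') :
    ∃ (s : Equiv.Perm (Fin 6)) (t : k), t ≠ 0 ∧ ∀ l, Z' l = t • Z (s l) := by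
  have hs' := h'.isSteiner
  have hcl := hs'.isLineOn_cellLine hT
  -- The cell lines of the second system lie outside the common double-six, so they belong to the
  -- fifteen lines of the first. A plane through two of those that meet is a plane `Z_a + Z_b = 0`.
  have hhex : ∀ i j, ∃ s, cellLine (hexLeft Z') (hexRight Z') i j = hexLine Z s := fun i j => by
    obtain ⟨t, h1, h2⟩ := exists_partner_cell i j
    have h3 := h'.hexLine_eq_cellLine hT h1 h2
    rw [← h3]
    exact exists_eq_hexLine_of_eq hD (h3 ▸ hcl i j)
  have hrow : ∀ i, ∃ a b, a < b ∧ LinearMap.ker (hexLeft Z' i) = LinearMap.ker (Z a + Z b) := by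
    intro i
    obtain ⟨s, hs⟩ := hhex i 0
    obtain ⟨t, ht⟩ := hhex i 1
    have hne := hs'.cellLine_ne_of_ne hT i i (show (0 : Fin 3) ≠ 1 by decide)
    have hm := hs'.cellLine_inf_ne_bot hT i (show (0 : Fin 3) ≠ 1 by decide)
    obtain ⟨a, b, hab, h1, h2⟩ := h.exists_add_ker hT (hs ▸ ht ▸ hne) (hs ▸ ht ▸ hm)
    rw [← hs] at h1
    rw [← ht] at h2
    exact ⟨a, b, hab, by
      rw [← sup_eq_ker (hcl i 0).1 (hcl i 1).1 hne (hs'.left_ne_zero hT i) inf_le_left inf_le_left,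
        ← sup_eq_ker (hcl i 0).1 (hcl i 1).1 hne (h.add_ne_zero hT hab.ne) h1 h2]⟩
  have hcol : ∀ j, ∃ a b, a < b ∧ LinearMap.ker (hexRight Z' j) = LinearMap.ker (Z a + Z b) := by
    intro j
    obtain ⟨s, hs⟩ := hhex 0 j
    obtain ⟨t, ht⟩ := hhex 1 j
    have hne : cellLine (hexLeft Z') (hexRight Z') 0 j ≠ cellLine (hexLeft Z') (hexRight Z') 1 j :=
      fun e => absurd (hs'.cellLine_injective hT e).1 (by decide)
    have hm := hs'.symm.cellLine_inf_ne_bot hT j (show (0 : Fin 3) ≠ 1 by decide)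
    rw [cellLine_symm j 0, cellLine_symm j 1] at hm
    obtain ⟨a, b, hab, h1, h2⟩ := h.exists_add_ker hT (hs ▸ ht ▸ hne) (hs ▸ ht ▸ hm)
    rw [← hs] at h1
    rw [← ht] at h2
    exact ⟨a, b, hab, by
      rw [← sup_eq_ker (hcl 0 j).1 (hcl 1 j).1 hne (hs'.symm.left_ne_zero hT j) inf_le_right
        inf_le_right, ← sup_eq_ker (hcl 0 j).1 (hcl 1 j).1 hne (h.add_ne_zero hT hab.ne) h1 h2]⟩
  choose a b hab hk using hrow
  choose c d hcd hk' using hcol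
  have hshare : ∀ {a b c d : Fin 6}, a < b → c < d → Share a b c d = true →
      ¬ (a = c ∧ b = d) → ¬ IsLineOn F (LinearMap.ker (Z a + Z b) ⊓ LinearMap.ker (Z c + Z d)) := by
    intro a b c d hab hcd hsh hne
    simp only [Share, Bool.or_eq_true, beq_iff_eq] at hsh
    rcases hsh with ((rfl | rfl) | rfl) | rfl
    · have := h.not_isLineOn hT hab.ne hcd.ne (fun e => hne ⟨rfl, e⟩)
      rwa [add_comm] at this
    · have := h.not_isLineOn hT hab.ne hcd.ne' (by omega)
      rwa [add_comm (Z a) (Z c), add_comm (Z b) (Z a)] at this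
    · exact h.not_isLineOn hT hab.ne' hcd.ne (by omega)
    · have := h.not_isLineOn hT hab.ne' hcd.ne' (fun e => hne ⟨e, rfl⟩)
      rwa [add_comm (Z b) (Z c)] at this
  -- Whether two planes intersect in a line of the surface shows which index pairs are disjoint: the
  -- row pairs form one triangle and the column pairs the complementary one, as in the standard
  -- arrangement.
  obtain ⟨s, hs⟩ := exists_perm_of_duads hab hcd
    (fun i i' hi => by
      have h1 := hs'.not_isLineOn hT hi
      rw [hk, hk] at h1
      refine ⟨?_, fun e => ?_⟩
      · by_contra hc
        exact h1 (h.isLineOn_of_disjoint hT (hab i).ne (hab i').ne (by simpa using hc))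
      · have h2 : LinearMap.ker (hexLeft Z' i) = LinearMap.ker (hexLeft Z' i') := by
          rw [hk, hk, e.1, e.2]
        exact hi (hs'.cellLine_injective hT (j := 0) (j' := 0) (by rw [cellLine, cellLine, h2])).1)
    (fun i i' hi => by
      have h1 := hs'.symm.not_isLineOn hT hi
      rw [hk', hk'] at h1
      refine ⟨?_, fun e => ?_⟩
      · by_contra hc
        exact h1 (h.isLineOn_of_disjoint hT (hcd i).ne (hcd i').ne (by simpa using hc))
      · have h2 : LinearMap.ker (hexRight Z' i) = LinearMap.ker (hexRight Z' i') := by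
          rw [hk', hk', e.1, e.2]
        exact hi (hs'.cellLine_injective hT (i := 0) (i' := 0) (by rw [cellLine, cellLine, h2])).2)
    (fun i j => by
      by_contra hc
      rw [Bool.not_eq_false] at hc
      have h1 := hcl i j
      rw [cellLine, hk, hk'] at h1
      refine hshare (hab i) (hcd j) hc (fun e => ?_) h1
      rw [e.1, e.2, inf_idem] at h1
      have h2 := h1.1
      rw [finrank_ker_eq_three (h.add_ne_zero hT (hcd j).ne)] at h2
      omega)
  have h₀ := h.comp_perm s
  have hkl : ∀ i, LinearMap.ker (hexLeft Z' i) = LinearMap.ker (hexLeft (Z ∘ s) i) := fun i => by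
    rw [hk]
    rcases (hs i).1 with ⟨e1, e2⟩ | ⟨e1, e2⟩
    · rw [e1, e2]; rfl
    · rw [e1, e2, add_comm]; rfl
  have hkr : ∀ i, LinearMap.ker (hexRight Z' i) = LinearMap.ker (hexRight (Z ∘ s) i) := fun i => by
    rw [hk']
    rcases (hs i).2 with ⟨e1, e2⟩ | ⟨e1, e2⟩
    · rw [e1, e2]; rfl
    · rw [e1, e2, add_comm]; rfl
  have hs₀ := h₀.isSteiner
  choose l hl using fun i => exists_eq_smul_of_ker_eq (hs₀.left_ne_zero hT i) (hkl i)
  choose m hm using fun i => exists_eq_smul_of_ker_eq (hs₀.symm.left_ne_zero hT i) (hkr i)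
  have hl' : ∀ i x, hexLeft Z' i x = l i * hexLeft (Z ∘ s) i x := fun i x => by rw [hl]; rfl
  have hm' : ∀ i x, hexRight Z' i x = m i * hexRight (Z ∘ s) i x := fun i x => by rw [hm]; rfl
  obtain ⟨A, B, hM, hA, hB⟩ := h₀.exists_isMarking hT
  have hrel : IsRel (hexLeft (Z ∘ s)) (hexRight (Z ∘ s)) l m := fun x => by
    have := h'.isRel_one x
    simpa only [Pi.one_apply, one_mul, hl', hm'] using this
  -- The proportionality factors satisfy the root equation: evaluation where one of the two products
  -- vanishes and the other does not compares the two expressions of `F`.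
  have hprod : ∏ i, l i = ∏ j, m j := by
    obtain ⟨c₀, hc₀, e₀⟩ := hs₀
    obtain ⟨c', hc', e'⟩ := hs'
    have key : ∀ x, ((∏ i, l i) * c₀ - c') * ∏ i, hexLeft (Z ∘ s) i x +
        ((∏ j, m j) * c₀ - c') * ∏ j, hexRight (Z ∘ s) j x = 0 := fun x => by
      have h1 := e₀ x
      have h2 := e' x
      simp only [hl', hm', Finset.prod_mul_distrib] at h2
      linear_combination c₀ * h2 - c' * h1
    obtain ⟨x, hx1, hx2⟩ := IsSteiner.exists_prod_ne_zero hT ⟨c₀, hc₀, e₀⟩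
    obtain ⟨y, hy1, hy2⟩ := (IsSteiner.symm ⟨c₀, hc₀, e₀⟩).exists_prod_ne_zero hT
    have h3 := key x
    have h4 := key y
    rw [hx1, mul_zero, zero_add, mul_eq_zero, or_iff_left hx2] at h3
    rw [hy1, mul_zero, add_zero, mul_eq_zero, or_iff_left hy2] at h4
    exact mul_right_cancel₀ hc₀ (by linear_combination h4 - h3)
  obtain ⟨ρ, t, ht1, ht2⟩ := hM.complete l m hrel hprod
  have ht0 : t ≠ 0 := by
    rintro rfl
    refine hs'.left_ne_zero hT 0 ?_
    rw [hl, ht1, zero_mul, zero_smul]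
  -- Any other root would have its root lines in the double-six of the first system, whereas they
  -- are among the fifteen lines of the second.
  have hρ : ρ = 0 := by
    by_contra hc
    have h1 : rootLine (hexLeft (Z ∘ s)) (hexRight (Z ∘ s)) (A ρ) (B ρ) 1 ∈
        hexDoubleSix F (Z ∘ s) := by
      rw [h₀.hexDoubleSix_eq hT hM hA hB]
      exact ⟨ρ, hc, 1, rfl⟩
    rw [hexDoubleSix_comp, hD] at h1
    obtain ⟨A', B', hM', hA', hB'⟩ := h'.exists_isMarking hT
    obtain ⟨τ, hτ⟩ := exists_partner_root 1
    refine h1.2 τ ?_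
    rw [h'.hexLine_eq_rootLine hT hM' hA' hB' hτ]
    ext x
    rw [mem_rootLine, mem_rootLine]
    refine forall_congr' fun i => ?_
    rw [hA', hB', Pi.one_apply, Pi.one_apply, one_mul, one_mul, hl', hm', ht1, ht2, mul_assoc,
      mul_assoc, ← mul_add, mul_eq_zero, or_iff_right ht0]
  refine ⟨s, t, ht0, fun i => ?_⟩
  have e1 : hexLeft Z' = fun i => t • hexLeft (Z ∘ s) i := funext fun i => by
    rw [hl, ht1, hρ, hA, Pi.one_apply, mul_one]
  have e2 : hexRight Z' = fun i => t • hexRight (Z ∘ s) i := funext fun i => by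
    rw [hm, ht2, hρ, hB, Pi.one_apply, mul_one]
  have e3 := congrFun (hexForms_hexLeft_hexRight Z') i
  have e4 := congrFun (hexForms_hexLeft_hexRight (Z ∘ s)) i
  rw [e3]
  change _ = t • (Z ∘ s) i
  rw [e4, e1, e2]
  refine LinearMap.ext fun x => ?_
  fin_cases i <;>
  · simp [hexForms, Fin.sum_univ_three]
    ring

omit [IsAlgClosed k] in
/-- The relations among the forms of hexahedral equations. -/
theorem IsHexahedral.exists_affine (h : IsHexahedral F Z β) {γ : Fin 6 → k}
    (hγ : ∑ i, γ i • Z i = 0) : ∃ x y : k, ∀ i, γ i = x + y * β i := by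
  -- Inverts the passage to pairwise sums: the coefficients of a relation among the `Z` are
  -- expressed as sums of two coefficients at the `u` or at the `v`.
  have hrel : ∀ δ : Fin 6 → k, ∑ i, δ i • Z i = 0 → IsRel (hexLeft Z) (hexRight Z)
      (fun i => (δ 4 + δ 0 + δ 1) / 2 - δ (idxLeft i))
      (fun i => (δ 5 + δ 2 + δ 3) / 2 - δ (idxRight i)) := by
    intro δ hδ x
    have h1 := LinearMap.congr_fun hδ x
    have h2 := h.sum_apply x
    simp only [Fin.sum_univ_six, LinearMap.add_apply, LinearMap.smul_apply, smul_eq_mul,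
      LinearMap.zero_apply] at h1
    simp only [Fin.sum_univ_three]
    change ((δ 4 + δ 0 + δ 1) / 2 - δ 4) * (Z 0 x + Z 1 x) +
      ((δ 4 + δ 0 + δ 1) / 2 - δ 0) * (Z 1 x + Z 4 x) +
      ((δ 4 + δ 0 + δ 1) / 2 - δ 1) * (Z 4 x + Z 0 x) +
      (((δ 5 + δ 2 + δ 3) / 2 - δ 5) * (Z 2 x + Z 3 x) +
      ((δ 5 + δ 2 + δ 3) / 2 - δ 2) * (Z 3 x + Z 5 x) +
      ((δ 5 + δ 2 + δ 3) / 2 - δ 3) * (Z 5 x + Z 2 x)) = 0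
    linear_combination h1
  obtain ⟨i₀, j₀, hne⟩ := h.independent
  obtain ⟨s, t, hs, ht⟩ := h.isSteiner.exists_combination hT h.isRel_one
    (hrel β h.sum_smul_eq_zero) (hrel γ hγ) (by
      intro s t h1 h2
      have ht : t = 0 := by
        by_contra ht
        have key : ∀ l, t * β l = -(2 * s) := by
          simp only [Pi.one_apply] at h1 h2
          have s0 : s * 1 + t * ((β 4 + β 0 + β 1) / 2 - β 4) = 0 := h1 0
          have s1 : s * 1 + t * ((β 4 + β 0 + β 1) / 2 - β 0) = 0 := h1 1
          have s2 : s * 1 + t * ((β 4 + β 0 + β 1) / 2 - β 1) = 0 := h1 2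
          have t0 : s * 1 + t * ((β 5 + β 2 + β 3) / 2 - β 5) = 0 := h2 0
          have t1 : s * 1 + t * ((β 5 + β 2 + β 3) / 2 - β 2) = 0 := h2 1
          have t2 : s * 1 + t * ((β 5 + β 2 + β 3) / 2 - β 3) = 0 := h2 2
          intro i
          fin_cases i
          · change t * β 0 = _; linear_combination s0 + s2
          · change t * β 1 = _; linear_combination s0 + s1
          · change t * β 2 = _; linear_combination t0 + t2
          · change t * β 3 = _; linear_combination t0 + t1
          · change t * β 4 = _; linear_combination s1 + s2
          · change t * β 5 = _; linear_combination t1 + t2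
        refine hne (mul_left_cancel₀ ht ?_)
        rw [key i₀, key j₀]
      have := h1 0
      rw [ht] at this
      exact ⟨by simpa using this, ht⟩)
  refine ⟨2 * s, t, ?_⟩
  simp only [Pi.one_apply] at hs ht
  have s0 : (γ 4 + γ 0 + γ 1) / 2 - γ 4 = s * 1 + t * ((β 4 + β 0 + β 1) / 2 - β 4) := hs 0
  have s1 : (γ 4 + γ 0 + γ 1) / 2 - γ 0 = s * 1 + t * ((β 4 + β 0 + β 1) / 2 - β 0) := hs 1
  have s2 : (γ 4 + γ 0 + γ 1) / 2 - γ 1 = s * 1 + t * ((β 4 + β 0 + β 1) / 2 - β 1) := hs 2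
  have t0 : (γ 5 + γ 2 + γ 3) / 2 - γ 5 = s * 1 + t * ((β 5 + β 2 + β 3) / 2 - β 5) := ht 0
  have t1 : (γ 5 + γ 2 + γ 3) / 2 - γ 2 = s * 1 + t * ((β 5 + β 2 + β 3) / 2 - β 2) := ht 1
  have t2 : (γ 5 + γ 2 + γ 3) / 2 - γ 3 = s * 1 + t * ((β 5 + β 2 + β 3) / 2 - β 3) := ht 2
  intro i
  fin_cases i
  · change γ 0 = 2 * s + t * β 0; linear_combination s0 + s2
  · change γ 1 = 2 * s + t * β 1; linear_combination s0 + s1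
  · change γ 2 = 2 * s + t * β 2; linear_combination t0 + t2
  · change γ 3 = 2 * s + t * β 3; linear_combination t0 + t1
  · change γ 4 = 2 * s + t * β 4; linear_combination s1 + s2
  · change γ 5 = 2 * s + t * β 5; linear_combination t1 + t2

/-- Hexahedral equations that determine the same double-six have the same Cremona plane. -/
theorem IsHexahedral.ker_eq_of_hexDoubleSix_eq (h : IsHexahedral F Z β) (h' : IsHexahedral F Z' β')
    (hD : hexDoubleSix F Z = hexDoubleSix F Z') :
    LinearMap.ker (∑ i, β' i ^ 2 • Z' i) = LinearMap.ker (∑ i, β i ^ 2 • Z i) := by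
  obtain ⟨s, t, ht, hZ⟩ := h.exists_perm_smul hT h' hD
  have h₀ := h.comp_perm s
  obtain ⟨x, y, hxy⟩ := h₀.exists_affine hT (γ := β') (by
    have h1 := h'.sum_smul_eq_zero
    simp only [hZ, smul_comm _ t] at h1
    rw [← Finset.smul_sum] at h1
    exact (smul_eq_zero.1 h1).resolve_left ht)
  have hy : y ≠ 0 := by
    rintro rfl
    obtain ⟨i, j, hij⟩ := h'.independent
    exact hij (by rw [hxy, hxy, zero_mul, zero_mul])
  -- Squaring `β' = x + y β` produces the additional terms `x² ∑ Zᵢ` and `2xy ∑ βᵢ Zᵢ`, both zero.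
  have e : ∑ i, β' i ^ 2 • Z' i = (t * y ^ 2) • ∑ i, β i ^ 2 • Z i := by
    rw [← Equiv.sum_comp s fun i => β i ^ 2 • Z i]
    refine LinearMap.ext fun w => ?_
    have h1 := LinearMap.congr_fun h₀.sum_eq_zero w
    have h2 := LinearMap.congr_fun h₀.sum_smul_eq_zero w
    simp only [Fin.sum_univ_six, Function.comp_apply, LinearMap.add_apply, LinearMap.smul_apply,
      smul_eq_mul, LinearMap.zero_apply, hxy, hZ] at h1 h2 ⊢
    generalize Z (s 0) w = z0 at *
    generalize Z (s 1) w = z1 at *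
    generalize Z (s 2) w = z2 at *
    generalize Z (s 3) w = z3 at *
    generalize Z (s 4) w = z4 at *
    generalize Z (s 5) w = z5 at *
    linear_combination t * x ^ 2 * h1 + 2 * t * x * y * h2
  rw [e, LinearMap.ker_smul _ _ (mul_ne_zero ht (pow_ne_zero 2 hy))]

end

end CubicSurface
end

/-! ### Double-sixes that avoid a common grid -/

noncomputable section
namespace CubicSurface
open Module
variable {k : Type*} [Field k] {F : MvPolynomial (Fin 4) k}
  {T : (Fin 4 → k) →ₗ[k] (Fin 4 → k) →ₗ[k] (Fin 4 → k) →ₗ[k] k}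
  {u v : Fin 3 → Dual k (Fin 4 → k)} {A B : Fin 3 → Fin 3 → k} {a b : Fin 3 → k}
  {Z Z' : Fin 6 → Dual k (Fin 4 → k)} {β β' : Fin 6 → k}

/-- In the forms `u` and `v` the passage from one root to another is a mere rescaling, so two
Cremona planes of one pencil become comparable. -/
theorem sum_sq_hexForms_apply [CharZero k] (x : Fin 4 → k) :
    (∑ l, hexConsts a b l ^ 2 • hexForms u v l) x =
      ∑ i, ((∑ l, a l) * a i - a (i + 1) * a (i + 2)) * u i x +
      ∑ j, ((∑ l, b l) * b j - b (j + 1) * b (j + 2)) * v j x := by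
  have e : (1 : Fin 3) + 1 = 2 ∧ (1 : Fin 3) + 2 = 0 ∧ (2 : Fin 3) + 1 = 0 ∧ (2 : Fin 3) + 2 = 1 := by
    decide
  simp only [Fin.sum_univ_six, Fin.sum_univ_three, zero_add, e.1, e.2.1, e.2.2.1, e.2.2.2]
  simp [hexForms, hexConsts, Fin.sum_univ_three]
  ring

theorem eq_zero_of_quadratic {c₀ c₁ c₂ x y z : k} (hxy : x ≠ y) (hxz : x ≠ z) (hyz : y ≠ z)
    (hx : c₂ * x ^ 2 + c₁ * x + c₀ = 0) (hy : c₂ * y ^ 2 + c₁ * y + c₀ = 0)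
    (hz : c₂ * z ^ 2 + c₁ * z + c₀ = 0) : c₂ = 0 ∧ c₁ = 0 ∧ c₀ = 0 := by
  have h1 : c₂ * (x + y) + c₁ = 0 := mul_left_cancel₀ (sub_ne_zero.2 hxy) (by
    linear_combination hx - hy)
  have h2 : c₂ * (x + z) + c₁ = 0 := mul_left_cancel₀ (sub_ne_zero.2 hxz) (by
    linear_combination hx - hz)
  have h3 : c₂ = 0 := mul_left_cancel₀ (sub_ne_zero.2 hyz) (by linear_combination h1 - h2)
  have h4 : c₁ = 0 := by linear_combination h1 - (x + y) * h3
  exact ⟨h3, h4, by linear_combination hx - x ^ 2 * h3 - x * h4⟩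

/-- Multiplied by `p aᵢ`, and with `aᵢ₊₁ aᵢ₊₂` eliminated by means of `p` and the symmetric
functions, the three equations say that one quadratic polynomial vanishes at `a₀, a₁, a₂`. These are
distinct, so its coefficients are zero. -/
theorem exists_quadratic_relation {a : Fin 3 → k} (ha : ∀ i, a i ≠ 0) (hinj : Function.Injective a)
    {p t x y : k} (hp : ∏ i, a i = p)
    (h : ∀ i, a i * ((∑ l, (a l)⁻¹) * (a i)⁻¹ - (a (i + 1))⁻¹ * (a (i + 2))⁻¹) -
      t * ((∑ l, a l) * a i - a (i + 1) * a (i + 2)) = x + y * a i) :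
    t * p = 1 ∧ y * p = -(2 * ∑ l, a l) := by
  have hp0 : p ≠ 0 := hp ▸ Finset.prod_ne_zero_iff.2 fun i _ => ha i
  have hσ : p * ∑ l, (a l)⁻¹ = a 0 * a 1 + a 0 * a 2 + a 1 * a 2 := by
    rw [← hp, Fin.prod_univ_three, Fin.sum_univ_three]
    have h0 := ha 0
    have h1 := ha 1
    have h2 := ha 2
    field_simp
    ring
  obtain ⟨S, hS⟩ : ∃ S, S = ∑ l, a l := ⟨_, rfl⟩
  obtain ⟨S', hS'⟩ : ∃ S, S = ∑ l, (a l)⁻¹ := ⟨_, rfl⟩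
  rw [← hS'] at hσ h
  rw [← hS] at h ⊢
  have key : ∀ i, (t * p * S + y * p + S) * a i ^ 2 + (x * p - 2 * (p * S')) * a i +
      (1 - t * p) * p = 0 := by
    intro i
    have h1 := h i
    have h2 : a i * (a i)⁻¹ = 1 := mul_inv_cancel₀ (ha i)
    have h3 : p * ((a (i + 1))⁻¹ * (a (i + 2))⁻¹) = a i := by
      rw [← hp, prod_rotate _ i]
      have h0 := ha (i + 1)
      have h2 := ha (i + 2)
      field_simp
    have h4 : p = a i * a (i + 1) * a (i + 2) := by rw [← hp, prod_rotate _ i]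
    have h5 : S = a i + a (i + 1) + a (i + 2) := by rw [hS, sum_rotate _ i]
    have h6 : p * S' = a i * a (i + 1) + a i * a (i + 2) + a (i + 1) * a (i + 2) := by
      rw [hσ]
      fin_cases i
      · rfl
      · change _ = a 1 * a 2 + a 1 * a 0 + a 2 * a 0; ring
      · change _ = a 2 * a 0 + a 2 * a 1 + a 0 * a 1; ring
    linear_combination -(p * a i) * h1 + (p * S' * a i) * h2 - a i ^ 2 * h3
      + (1 - t * p) * h4 + a i ^ 2 * h5 - a i * h6
  obtain ⟨h1, h2, h3⟩ := eq_zero_of_quadratic (hinj.ne (show (0 : Fin 3) ≠ 1 by decide))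
    (hinj.ne (show (0 : Fin 3) ≠ 2 by decide)) (hinj.ne (show (1 : Fin 3) ≠ 2 by decide))
    (key 0) (key 1) (key 2)
  have h4 : t * p = 1 := by
    have := (mul_eq_zero.1 h3).resolve_right hp0
    linear_combination -this
  exact ⟨h4, by linear_combination h1 - S * h4⟩

section

variable [CharZero k] (hT : IsPolar F T)

include hT

/-- The Cremona planes of two double-sixes that avoid a common grid are different. -/
theorem IsMarking.ker_ne_ker (h : IsMarking F u v A B) (hA : A 0 = 1) (hB : B 0 = 1)
    (ha : Function.Injective (A 1)) (hb : Function.Injective (B 1))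
    (hne : ∑ l, hexConsts (A 1) (B 1) l ^ 2 • hexForms u v l ≠ 0) :
    LinearMap.ker (∑ l, hexConsts (fun i => (A 1 i)⁻¹) (fun j => (B 1 j)⁻¹) l ^ 2 •
      hexForms (fun i => A 1 i • u i) (fun j => B 1 j • v j) l) ≠
    LinearMap.ker (∑ l, hexConsts (A 1) (B 1) l ^ 2 • hexForms u v l) := by
  intro hk
  obtain ⟨t, ht⟩ := exists_eq_smul_of_ker_eq hne hk
  have h1 := h.rel 0
  rw [hA, hB] at h1
  have hind : ∀ s t : k, (∀ i, s * 1 + t * A 1 i = 0) → (∀ j, s * 1 + t * B 1 j = 0) →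
      s = 0 ∧ t = 0 := fun s t h2 h3 => h.independent 0 1 (by decide) s t
    (fun i => by rw [hA]; exact h2 i) (fun i => by rw [hB]; exact h3 i)
  have hsum := h.steiner.sum_ne_sum hT h1 (h.rel 1) hind
  -- Proportionality of the two Cremona forms is a linear relation among the `u` and `v`, hence lies
  -- in the pencil.
  obtain ⟨x, y, hx, hy⟩ := h.steiner.exists_combination hT h1 (h.rel 1)
    (a'' := fun i => A 1 i * ((∑ l, (A 1 l)⁻¹) * (A 1 i)⁻¹ - (A 1 (i + 1))⁻¹ * (A 1 (i + 2))⁻¹) -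
      t * ((∑ l, A 1 l) * A 1 i - A 1 (i + 1) * A 1 (i + 2)))
    (b'' := fun i => B 1 i * ((∑ l, (B 1 l)⁻¹) * (B 1 i)⁻¹ - (B 1 (i + 1))⁻¹ * (B 1 (i + 2))⁻¹) -
      t * ((∑ l, B 1 l) * B 1 i - B 1 (i + 1) * B 1 (i + 2)))
    (fun w => by
      have h2 := LinearMap.congr_fun ht w
      rw [LinearMap.smul_apply, sum_sq_hexForms_apply, sum_sq_hexForms_apply] at h2
      simp only [LinearMap.smul_apply, smul_eq_mul] at h2
      have e : (1 : Fin 3) + 1 = 2 ∧ (1 : Fin 3) + 2 = 0 ∧ (2 : Fin 3) + 1 = 0 ∧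
        (2 : Fin 3) + 2 = 1 := by decide
      generalize ∑ l, (A 1 l)⁻¹ = s₁ at h2 ⊢
      generalize ∑ l, (B 1 l)⁻¹ = s₂ at h2 ⊢
      generalize ∑ l, A 1 l = s₃ at h2 ⊢
      generalize ∑ l, B 1 l = s₄ at h2 ⊢
      simp only [Fin.sum_univ_three, zero_add, e.1, e.2.1, e.2.2.1, e.2.2.2] at h2 ⊢
      linear_combination h2) hind
  simp only [Pi.one_apply, mul_one] at hx hy
  have h2 := exists_quadratic_relation (h.ne_zero_left 1) ha rfl hx
  have h3 := exists_quadratic_relation (h.ne_zero_right 1) hb rfl hy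
  rw [← h.prod_eq] at h3
  -- Both sides have the same product, so `y` determines both `∑ aᵢ` and `∑ bⱼ`; their equality
  -- contradicts the simplicity of the root.
  have h4 : (2 : k) * (∑ l, A 1 l - ∑ l, B 1 l) = 0 := by linear_combination h2.2 - h3.2
  exact hsum (sub_eq_zero.1 ((mul_eq_zero.1 h4).resolve_left two_ne_zero))

end

end CubicSurface
end

/-! ### Comparison of two expressions `μ X₀X₁X₂ + ∑ XᵢYᵢ²` -/

noncomputable section
namespace CubicSurface
open Module
variable {k : Type*} [Field k]

section

variable {X Y Y' : Fin 3 → Dual k (Fin 4 → k)} {μ μ' : k} {δ δ' m m' : Fin 3 → k}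

/-- Two relations between the values of the forms on the fibres of `X`, from the comparison of two
expressions of a cubic form. -/
theorem sum_mul_eq_zero_of_cubic [CharZero k]
    (hc : ∀ w, μ * (X 0 w * X 1 w * X 2 w) + ∑ i, X i w * Y i w ^ 2 =
      μ' * (X 0 w * X 1 w * X 2 w) + ∑ i, X i w * Y' i w ^ 2)
    {e : Fin 4 → k} (he : ∀ i, X i e = 0) (w : Fin 4 → k) :
    ∑ i, X i w * (Y' i e ^ 2 - Y i e ^ 2) = 0 ∧
      ∑ i, X i w * (Y' i w * Y' i e - Y i w * Y i e) = 0 := by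
  have h0 := hc w
  have h1 := hc (w + e)
  have h2 := hc (w - e)
  simp only [Fin.sum_univ_three, map_add, map_sub, he, add_zero, sub_zero] at h0 h1 h2 ⊢
  have h4 : (2 : k) ≠ 0 := two_ne_zero
  exact ⟨mul_left_cancel₀ h4 (by linear_combination 2 * h0 - h1 - h2),
    mul_left_cancel₀ (mul_ne_zero h4 h4) (by linear_combination h2 - h1)⟩

theorem sum_three_eq_zero_apply (hX : ∑ i, X i = 0) (w : Fin 4 → k) :
    X 0 w = - X 1 w - X 2 w := by
  have := LinearMap.congr_fun hX w
  simp only [Fin.sum_univ_three, LinearMap.add_apply, LinearMap.zero_apply] at this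
  linear_combination this

theorem exists_forall_apply_eq (hX : ∑ i, X i = 0)
    (hr : ∀ w, ∑ i, δ i * Y i w = ∑ i, m i * X i w) (hδ : δ 0 ≠ 0)
    (hinj : ∀ w, (∀ i, X i w = 0) → (∀ i, Y i w = 0) → w = 0) (c : Fin 4 → k) :
    ∃ w, X 1 w = c 0 ∧ X 2 w = c 1 ∧ Y 1 w = c 2 ∧ Y 2 w = c 3 := by
  have h1 : Function.Injective (LinearMap.pi ![X 1, X 2, Y 1, Y 2]) := by
    rw [← LinearMap.ker_eq_bot, LinearMap.ker_eq_bot']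
    intro w hw
    have h2 : X 1 w = 0 := congr_fun hw 0
    have h3 : X 2 w = 0 := congr_fun hw 1
    have h4 : Y 1 w = 0 := congr_fun hw 2
    have h5 : Y 2 w = 0 := congr_fun hw 3
    have h6 : X 0 w = 0 := by rw [sum_three_eq_zero_apply hX, h2, h3]; simp
    have h7 := hr w
    simp only [Fin.sum_univ_three, h2, h3, h4, h5, h6, mul_zero, add_zero] at h7
    have h8 := (mul_eq_zero.1 h7).resolve_left hδ
    refine hinj w (fun i => ?_) fun i => ?_ <;> fin_cases i <;> assumption
  obtain ⟨w, hw⟩ := LinearMap.surjective_of_injective h1 c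
  exact ⟨w, congr_fun hw 0, congr_fun hw 1, congr_fun hw 2, congr_fun hw 3⟩

/-- Put `Dᵢ = Y'ᵢ - Yᵢ`, which by assumption depends on the `X` only. On the fibre the `Yᵢ` take all
values with `∑ δᵢ Yᵢ = 0`, so `∑ Xᵢ Dᵢ Yᵢ = 0` makes `Xᵢ Dᵢ` proportional to `δᵢ`. A binary
quadratic form divisible by `X₀`, `X₁` and `X₂` is zero. -/
theorem eq_of_eq_of_fiber [CharZero k] (hX : ∑ i, X i = 0)
    (hc : ∀ w, μ * (X 0 w * X 1 w * X 2 w) + ∑ i, X i w * Y i w ^ 2 =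
      μ' * (X 0 w * X 1 w * X 2 w) + ∑ i, X i w * Y' i w ^ 2)
    (hr : ∀ w, ∑ i, δ i * Y i w = ∑ i, m i * X i w) (hδ : ∀ i, δ i ≠ 0)
    (hinj : ∀ w, (∀ i, X i w = 0) → (∀ i, Y i w = 0) → w = 0)
    (h : ∀ w, (∀ i, X i w = 0) → ∀ i, Y' i w = Y i w) (i : Fin 3) (w : Fin 4 → k) :
    Y' i w = Y i w := by
  have hw := exists_forall_apply_eq hX hr (hδ 0) hinj
  have key : ∀ e, (∀ i, X i e = 0) → ∀ w, ∑ i, X i w * (Y' i w - Y i w) * Y i e = 0 := by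
    intro e he w
    rw [← (sum_mul_eq_zero_of_cubic hc he w).2]
    refine Finset.sum_congr rfl fun i _ => ?_
    rw [h e he i]
    ring
  have hz : ∀ e, X 1 e = 0 → X 2 e = 0 → ∀ i, X i e = 0 := by
    intro e h1 h2 i
    fin_cases i
    · change X 0 e = 0
      rw [sum_three_eq_zero_apply hX, h1, h2]; simp
    · exact h1
    · exact h2
  have k1 : ∀ w, δ 0 * (X 1 w * (Y' 1 w - Y 1 w)) = δ 1 * (X 0 w * (Y' 0 w - Y 0 w)) := by
    intro w
    obtain ⟨e, h1, h2, h3, h4⟩ := hw ![0, 0, 1, 0]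
    have h5 := key e (hz e h1 h2) w
    have h6 := hr e
    simp only [Fin.sum_univ_three, hz e h1 h2, h3, h4] at h5 h6
    simp at h5 h6
    linear_combination δ 0 * h5 - X 0 w * (Y' 0 w - Y 0 w) * h6
  have k2 : ∀ w, δ 0 * (X 2 w * (Y' 2 w - Y 2 w)) = δ 2 * (X 0 w * (Y' 0 w - Y 0 w)) := by
    intro w
    obtain ⟨e, h1, h2, h3, h4⟩ := hw ![0, 0, 0, 1]
    have h5 := key e (hz e h1 h2) w
    have h6 := hr e
    simp only [Fin.sum_univ_three, hz e h1 h2, h3, h4] at h5 h6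
    simp at h5 h6
    linear_combination δ 0 * h5 - X 0 w * (Y' 0 w - Y 0 w) * h6
  obtain ⟨e₁, a1, a2, -, -⟩ := hw ![1, 0, 0, 0]
  obtain ⟨e₂, b1, b2, -, -⟩ := hw ![0, 1, 0, 0]
  have a0 : X 0 e₁ = -1 := by rw [sum_three_eq_zero_apply hX, a1, a2]; simp
  have b0 : X 0 e₂ = -1 := by rw [sum_three_eq_zero_apply hX, b1, b2]; simp
  simp at a1 a2 b1 b2
  have p1 := k1 e₁
  have p2 := k2 e₁
  have q1 := k1 e₂
  have q2 := k2 e₂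
  have r1 := k1 (e₁ - e₂)
  have r2 := k2 (e₁ - e₂)
  simp only [map_sub, a0, a1, a2, b0, b1, b2, zero_mul, one_mul, mul_zero, sub_zero, zero_sub,
    sub_self, neg_mul, mul_neg] at p1 p2 q1 q2 r1 r2
  have f0e1 : Y' 0 e₁ - Y 0 e₁ = 0 :=
    (mul_eq_zero.1 (neg_eq_zero.1 p2.symm)).resolve_left (hδ 2)
  have f0e2 : Y' 0 e₂ - Y 0 e₂ = 0 :=
    (mul_eq_zero.1 (neg_eq_zero.1 q1.symm)).resolve_left (hδ 1)
  have f1e1 : Y' 1 e₁ - Y 1 e₁ = 0 := by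
    rw [f0e1, mul_zero, neg_zero] at p1
    exact (mul_eq_zero.1 p1).resolve_left (hδ 0)
  have f2e2 : Y' 2 e₂ - Y 2 e₂ = 0 := by
    rw [f0e2, mul_zero, neg_zero] at q2
    exact (mul_eq_zero.1 q2).resolve_left (hδ 0)
  have f1e2 : Y' 1 e₂ - Y 1 e₂ = 0 := by
    have := (mul_eq_zero.1 r1).resolve_left (hδ 0)
    linear_combination f1e1 - this
  have f2e1 : Y' 2 e₁ - Y 2 e₁ = 0 := by
    have := (mul_eq_zero.1 (neg_eq_zero.1 r2)).resolve_left (hδ 0)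
    linear_combination f2e2 + this
  have hd := h (w - X 1 w • e₁ - X 2 w • e₂) (hz _ (by simp [a1, b1]) (by simp [a2, b2])) i
  simp only [map_sub, map_smul, smul_eq_mul] at hd
  have h1 : ∀ i, Y' i e₁ - Y i e₁ = 0 := fun i => by fin_cases i <;> assumption
  have h2 : ∀ i, Y' i e₂ - Y i e₂ = 0 := fun i => by fin_cases i <;> assumption
  linear_combination hd + X 1 w * h1 i + X 2 w * h2 i

end

/-- The closing computation for `false_of_fiber`. The conditions `h2` and `h3` make `a` and `b`
annihilate `ν + t²`, so `ν = -t²` because `M₁ ≠ 0`. Then `h1` makes the quantity in `hE` vanish. -/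
theorem false_of_planes_eq [CharZero k] {κ₁ κ₂ l₁ l₂ a b t M₁ M₂ M₁' M₂' μ μ' ν : k}
    {d₀ d₁ d₂ : k} (hk₁ : κ₁ * l₁ = 1) (hk₂ : κ₂ * l₂ = 1) (hμ : μ' - μ = 4 * (a * b))
    (hd₁ : d₁ ≠ 0) (hd₂ : d₂ ≠ 0) (ht : t ≠ 0)
    (hr : d₀ + κ₁ * d₁ + κ₂ * d₂ = 0) (hs : d₀ + l₁ * d₁ + l₂ * d₂ = 0)
    (hne : κ₁ * l₂ - κ₂ * l₁ ≠ 0)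
    (hM₁ : d₂ * (l₂ * b - κ₂ * a) = M₁) (hM₂ : d₁ * (κ₁ * a - l₁ * b) = M₂)
    (hM₁' : t * d₂ * (l₂ * b + κ₂ * a) = M₁') (hM₂' : t * d₁ * (-(κ₁ * a) - l₁ * b) = M₂')
    (hE : M₁ ^ 2 - 2 * M₁ * M₂ + μ * (d₁ ^ 2 - d₀ ^ 2) ≠ 0) (hM : M₁ ≠ 0)
    (h1 : M₁' ^ 2 - 2 * M₁' * M₂' + μ' * ((t * d₁) ^ 2 - (t * d₀) ^ 2) =
      ν * (M₁ ^ 2 - 2 * M₁ * M₂ + μ * (d₁ ^ 2 - d₀ ^ 2)))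
    (h2 : M₁' * (t * d₁) * l₁ + M₂' * (t * d₂) * l₂ = ν * (M₁ * d₁ * l₁ + M₂ * d₂ * l₂))
    (h3 : M₁' * (t * d₁) * κ₁ + M₂' * (t * d₂) * κ₂ = -(ν * (M₁ * d₁ * κ₁ + M₂ * d₂ * κ₂))) :
    False := by
  subst hM₁ hM₂ hM₁' hM₂'
  have ha : a * (ν + t ^ 2) = 0 := by
    refine (mul_eq_zero.1 (?_ : d₁ * d₂ * (κ₁ * l₂ - κ₂ * l₁) * (a * (ν + t ^ 2)) = 0)).resolve_left
      (mul_ne_zero (mul_ne_zero hd₁ hd₂) hne)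
    linear_combination -h2
  have hb : b * (ν + t ^ 2) = 0 := by
    refine (mul_eq_zero.1 (?_ : d₁ * d₂ * (κ₁ * l₂ - κ₂ * l₁) * (b * (ν + t ^ 2)) = 0)).resolve_left
      (mul_ne_zero (mul_ne_zero hd₁ hd₂) hne)
    linear_combination h3
  have hν : ν + t ^ 2 = 0 := by
    by_contra hν
    apply hM
    rw [(mul_eq_zero.1 ha).resolve_right hν, (mul_eq_zero.1 hb).resolve_right hν]
    ring
  have hd : d₀ ^ 2 = d₁ ^ 2 + d₂ ^ 2 + d₁ * d₂ * (κ₁ * l₂ + κ₂ * l₁) := by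
    linear_combination d₀ * hr - (κ₁ * d₁ + κ₂ * d₂) * hs + d₁ ^ 2 * hk₁ + d₂ ^ 2 * hk₂
  refine hE ((mul_eq_zero.1 (?_ : 2 * t ^ 2 * _ = 0)).resolve_left
    (mul_ne_zero two_ne_zero (pow_ne_zero 2 ht)))
  linear_combination h1 + ((d₂ * (l₂ * b - κ₂ * a)) ^ 2 - 2 * (d₂ * (l₂ * b - κ₂ * a)) *
    (d₁ * (κ₁ * a - l₁ * b)) + μ * (d₁ ^ 2 - d₀ ^ 2)) * hν
    - t ^ 2 * (d₁ ^ 2 - d₀ ^ 2) * hμ - 4 * t ^ 2 * a * b * (d₂ ^ 2 * hk₂ - hd)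

end CubicSurface
end

/-! ### The exceptional configuration on the fibre -/

noncomputable section
namespace CubicSurface
open Module
variable {k : Type*} [Field k]

section

variable [CharZero k] {X Y Y' : Fin 3 → Dual k (Fin 4 → k)} {μ μ' ν : k} {δ δ' m m' : Fin 3 → k}

theorem exists_apply_eq_of_frame (hX : ∑ i, X i = 0)
    (hr : ∀ w, ∑ i, δ i * Y i w = ∑ i, m i * X i w) (hδ : δ 0 ≠ 0)
    (hinj : ∀ w, (∀ i, X i w = 0) → (∀ i, Y i w = 0) → w = 0)
    {p q : Fin 4 → k} (hp : ∀ i, X i p = 0) (hq : ∀ i, X i q = 0)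
    (hp' : Y 0 p = -1) (hq' : Y 0 q = 1) (hpY : Y' 0 p = 1) (hqY : Y' 0 q = 1) (c₁ c₂ : k) :
    ∃ w, X 1 w = c₁ ∧ X 2 w = c₂ ∧ Y 0 w = 0 ∧ Y' 0 w = 0 := by
  obtain ⟨w, h1, h2, -, -⟩ := exists_forall_apply_eq hX hr hδ hinj ![c₁, c₂, 0, 0]
  refine ⟨w - ((Y' 0 w - Y 0 w) / 2) • p - ((Y' 0 w + Y 0 w) / 2) • q, ?_, ?_, ?_, ?_⟩
  · simpa [hp, hq] using h1
  · simpa [hp, hq] using h2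
  · simp [hp', hq']; ring
  · simp [hpY, hqY]; ring

/-- Excludes the case in which the two systems are opposite at one point `p` of the line `X = 0` and
equal at another point `q`. The frame `p, q, e₁, e₂`, with `Y₀ = Y'₀ = 0` at `e₁, e₂`, leaves few
unknowns; the cubic, the relations and the plane determine them up to what `false_of_planes_eq`
excludes. -/
theorem false_of_fiber (hX : ∑ i, X i = 0)
    (hc : ∀ w, μ * (X 0 w * X 1 w * X 2 w) + ∑ i, X i w * Y i w ^ 2 =
      μ' * (X 0 w * X 1 w * X 2 w) + ∑ i, X i w * Y' i w ^ 2)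
    (hr : ∀ w, ∑ i, δ i * Y i w = ∑ i, m i * X i w) (hδ : ∀ i, δ i ≠ 0)
    (hr' : ∀ w, ∑ i, δ' i * Y' i w = ∑ i, m' i * X i w) (hδ' : δ' 0 ≠ 0)
    (hinj : ∀ w, (∀ i, X i w = 0) → (∀ i, Y i w = 0) → w = 0)
    (hE : (m 1 - m 0) ^ 2 - 2 * (m 1 - m 0) * (m 2 - m 0) + μ * (δ 1 ^ 2 - δ 0 ^ 2) ≠ 0)
    (hM : m 1 - m 0 ≠ 0)
    (hW : ∀ w, ∑ i, (m' i ^ 2 + μ' * δ' i ^ 2) * X i w - 2 * ∑ i, m' i * δ' i * Y' i w =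
      ν * (∑ i, (m i ^ 2 + μ * δ i ^ 2) * X i w - 2 * ∑ i, m i * δ i * Y i w))
    {p q : Fin 4 → k} (hp : ∀ i, X i p = 0) (hq : ∀ i, X i q = 0)
    (hp' : Y 0 p = -1) (hq' : Y 0 q = 1) (hpY : ∀ i, Y' i p = - Y i p)
    (hqY : ∀ i, Y' i q = Y i q) (hpq : ∀ i, Y i p * Y i q = -1) : False := by
  have hex := exists_apply_eq_of_frame (Y' := Y') hX hr (hδ 0) hinj hp hq hp' hq'
    (by rw [hpY, hp']; simp) (by rw [hqY, hq'])
  obtain ⟨e₁, a1, a2, a3, a4⟩ := hex 1 0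
  obtain ⟨e₂, b1, b2, b3, b4⟩ := hex 0 1
  have a0 : X 0 e₁ = -1 := by rw [sum_three_eq_zero_apply hX, a1, a2]; simp
  have b0 : X 0 e₂ = -1 := by rw [sum_three_eq_zero_apply hX, b1, b2]; simp
  obtain ⟨κ₁, hκ₁⟩ : ∃ x, Y 1 p = -x := ⟨- Y 1 p, by simp⟩
  obtain ⟨κ₂, hκ₂⟩ : ∃ x, Y 2 p = -x := ⟨- Y 2 p, by simp⟩
  obtain ⟨l₁, hl₁⟩ : ∃ x, Y 1 q = x := ⟨_, rfl⟩
  obtain ⟨l₂, hl₂⟩ : ∃ x, Y 2 q = x := ⟨_, rfl⟩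
  have hk₁ : κ₁ * l₁ = 1 := by
    have := hpq 1
    rw [hκ₁, hl₁] at this
    linear_combination -this
  have hk₂ : κ₂ * l₂ = 1 := by
    have := hpq 2
    rw [hκ₂, hl₂] at this
    linear_combination -this
  have hp₁ := fun w => (sum_mul_eq_zero_of_cubic hc hp w).2
  have hq₁ := fun w => (sum_mul_eq_zero_of_cubic hc hq w).2
  simp only [hpY, hqY, Fin.sum_univ_three, hp', hq', hκ₁, hκ₂, hl₁, hl₂] at hp₁ hq₁
  have r1 := hp₁ e₁
  have r2 := hp₁ e₂
  have r3 := hp₁ (e₁ + e₂)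
  have s1 := hq₁ e₁
  have s2 := hq₁ e₂
  have s3 := hq₁ (e₁ + e₂)
  have d3 := hc (e₁ + e₂)
  have c1 := hr e₁
  have c2 := hr e₂
  have c3 := hr p
  have c4 := hr q
  have c1' := hr' e₁
  have c2' := hr' e₂
  have c3' := hr' p
  have c4' := hr' q
  have w1 := hW e₁
  have w3 := hW p
  have w4 := hW q
  simp only [Fin.sum_univ_three, map_add, a0, a1, a2, a3, a4, b0, b1, b2, b3, b4, hp, hq, hp', hq',
    hpY, hqY, hκ₁, hκ₂, hl₁, hl₂] at r1 r2 r3 s1 s2 s3 d3 c1 c2 c3 c4 c1' c2' c3' c4' w1 w3 w4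
  have hκ₁0 : κ₁ ≠ 0 := left_ne_zero_of_mul_eq_one hk₁
  have hκ₂0 : κ₂ ≠ 0 := left_ne_zero_of_mul_eq_one hk₂
  have hl₁0 : l₁ ≠ 0 := right_ne_zero_of_mul_eq_one hk₁
  have hl₂0 : l₂ ≠ 0 := right_ne_zero_of_mul_eq_one hk₂
  have h2 : (2 : k) ≠ 0 := two_ne_zero
  have z1 : Y' 1 e₁ + Y 1 e₁ = 0 := mul_left_cancel₀ hκ₁0 (by linear_combination r1)
  have z2 : Y' 1 e₁ - Y 1 e₁ = 0 := mul_left_cancel₀ hl₁0 (by linear_combination s1)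
  have z3 : Y' 2 e₂ + Y 2 e₂ = 0 := mul_left_cancel₀ hκ₂0 (by linear_combination r2)
  have z4 : Y' 2 e₂ - Y 2 e₂ = 0 := mul_left_cancel₀ hl₂0 (by linear_combination s2)
  have y1 : Y 1 e₁ = 0 := mul_left_cancel₀ h2 (by linear_combination z1 - z2)
  have y1' : Y' 1 e₁ = 0 := by linear_combination z1 - y1
  have y2 : Y 2 e₂ = 0 := mul_left_cancel₀ h2 (by linear_combination z3 - z4)
  have y2' : Y' 2 e₂ = 0 := by linear_combination z3 - y2
  rw [y1] at c1
  -- Two parameters that describe all values of the `Y` and `Y'` at `e₁` and `e₂` which are not yet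
  -- known to be zero.
  obtain ⟨a, ha⟩ : ∃ a, a = l₂ * (Y' 2 e₁ - Y 2 e₁) / 2 := ⟨_, rfl⟩
  obtain ⟨b, hb⟩ : ∃ b, b = κ₂ * (Y' 2 e₁ + Y 2 e₁) / 2 := ⟨_, rfl⟩
  simp only [y1, y1', y2, y2'] at r3 s3 d3 c1 c2 c1' c2' w1
  have f1 : Y 2 e₁ = l₂ * b - κ₂ * a := by
    linear_combination -Y 2 e₁ * hk₂ - l₂ * hb + κ₂ * ha
  have f1' : Y' 2 e₁ = l₂ * b + κ₂ * a := by
    linear_combination -Y' 2 e₁ * hk₂ - l₂ * hb - κ₂ * ha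
  have g1 : κ₁ * (Y' 1 e₂ + Y 1 e₂) = -2 * b := by
    linear_combination r3 + 2 * hb
  have g2 : l₁ * (Y' 1 e₂ - Y 1 e₂) = -2 * a := by
    linear_combination s3 + 2 * ha
  have f2 : Y 1 e₂ = κ₁ * a - l₁ * b := mul_left_cancel₀ h2 (by
    linear_combination l₁ * g1 - κ₁ * g2 - 2 * Y 1 e₂ * hk₁)
  have f2' : Y' 1 e₂ = -(κ₁ * a) - l₁ * b := mul_left_cancel₀ h2 (by
    linear_combination l₁ * g1 + κ₁ * g2 - 2 * Y' 1 e₂ * hk₁)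
  rw [f1] at c1 w1
  rw [f1'] at c1' w1
  rw [f2] at c2
  rw [f2'] at c2'
  simp only [f1, f1', f2, f2'] at d3
  have hμ : μ' - μ = 4 * (a * b) := mul_left_cancel₀ h2 (by
    linear_combination d3 + 4 * a * b * (hk₁ + hk₂))
  have hcr : δ 0 + κ₁ * δ 1 + κ₂ * δ 2 = 0 := by linear_combination -c3
  have hcs : δ 0 + l₁ * δ 1 + l₂ * δ 2 = 0 := by linear_combination c4
  have hcr' : δ' 0 + κ₁ * δ' 1 + κ₂ * δ' 2 = 0 := by linear_combination c3'
  have hcs' : δ' 0 + l₁ * δ' 1 + l₂ * δ' 2 = 0 := by linear_combination c4'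
  -- Otherwise all `Xᵢ` and `Yᵢ` vanish at `p + q`, so `p = -q`; but `Y'₀` equals `1` at both
  -- points.
  have hne : κ₁ * l₂ - κ₂ * l₁ ≠ 0 := by
    intro h
    have hsq : (l₂ - l₁) * (l₂ + l₁) = 0 := by
      linear_combination l₁ * l₂ * h - l₂ ^ 2 * hk₁ + l₁ ^ 2 * hk₂
    have hkl : κ₁ = l₁ ∧ κ₂ = l₂ := by
      rcases mul_eq_zero.1 hsq with h3 | h3
      · have h4 : κ₂ = κ₁ := mul_right_cancel₀ hl₁0 (by linear_combination -h + κ₁ * h3)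
        have h5 : l₁ * (δ 1 + δ 2) ≠ 0 := fun h6 => hδ 0 (by linear_combination hcs - h6 - δ 2 * h3)
        have h6 : κ₁ = l₁ := mul_right_cancel₀ (right_ne_zero_of_mul h5) (by
          linear_combination hcr - hcs - δ 2 * h4 + δ 2 * h3)
        exact ⟨h6, by linear_combination h4 + h6 - h3⟩
      · have h4 : κ₂ = -κ₁ := mul_right_cancel₀ hl₁0 (by linear_combination -h + κ₁ * h3)
        have h5 : l₁ * (δ 1 - δ 2) ≠ 0 := fun h6 => hδ 0 (by linear_combination hcs - h6 - δ 2 * h3)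
        have h6 : κ₁ = l₁ := mul_right_cancel₀ (right_ne_zero_of_mul h5) (by
          linear_combination hcr - hcs - δ 2 * h4 + δ 2 * h3)
        exact ⟨h6, by linear_combination h4 - h6 - h3⟩
    have h3 : p + q = 0 := hinj _ (fun i => by rw [map_add, hp, hq, add_zero]) fun i => by
      rw [map_add]
      fin_cases i
      · change Y 0 p + Y 0 q = 0
        rw [hp', hq']; simp
      · change Y 1 p + Y 1 q = 0
        rw [hκ₁, hl₁, hkl.1]; simp
      · change Y 2 p + Y 2 q = 0
        rw [hκ₂, hl₂, hkl.2]; simp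
    have h4 : Y' 0 (p + q) = 0 := by rw [h3, map_zero]
    rw [map_add, hpY, hqY, hp', hq'] at h4
    exact h2 (by linear_combination h4)
  -- `δ` and `δ'` solve the same two independent linear equations in three unknowns, so they are
  -- proportional.
  obtain ⟨t, ht⟩ : ∃ t, t = δ' 0 / δ 0 := ⟨_, rfl⟩
  have t0 : δ' 0 = t * δ 0 := by rw [ht, div_mul_cancel₀ _ (hδ 0)]
  have t1 : δ' 1 = t * δ 1 := sub_eq_zero.1 (mul_left_cancel₀ hne (by
    linear_combination l₂ * (hcr' - t * hcr) - κ₂ * (hcs' - t * hcs) - (l₂ - κ₂) * t0))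
  have t2 : δ' 2 = t * δ 2 := sub_eq_zero.1 (mul_left_cancel₀ hne (by
    linear_combination κ₁ * (hcs' - t * hcs) - l₁ * (hcr' - t * hcr) - (κ₁ - l₁) * t0))
  simp only [t0, t1, t2] at c1' c2' w1 w3 w4
  refine false_of_planes_eq (t := t) (M₁ := m 1 - m 0) (M₂ := m 2 - m 0) (M₁' := m' 1 - m' 0)
    (M₂' := m' 2 - m' 0) (ν := ν) hk₁ hk₂ hμ (hδ 1) (hδ 2)
    (fun h => hδ' (by rw [t0, h, zero_mul])) hcr hcs hne ?_ ?_ ?_ ?_ hE hM ?_ ?_ ?_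
  · linear_combination c1
  · linear_combination c2
  · linear_combination c1'
  · linear_combination c2'
  · linear_combination w1 + 2 * m' 2 * c1' - 2 * ν * m 2 * c1
  · refine mul_left_cancel₀ h2 ?_
    linear_combination -w4 - 2 * m' 0 * t * hcs + ν * 2 * m 0 * hcs
  · refine mul_left_cancel₀ h2 ?_
    linear_combination -w3 - 2 * m' 0 * t * hcr - ν * 2 * m 0 * hcr

end

end CubicSurface
end

/-! ### The forms `Yᵢ` are determined up to sign -/

noncomputable section
namespace CubicSurface
open Module
variable {k : Type*} [Field k]

section

variable {X Y Y' : Fin 3 → Dual k (Fin 4 → k)} {μ μ' ν : k} {δ δ' m m' : Fin 3 → k}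

theorem exists_fiber (hX : ∑ i, X i = 0)
    (hr : ∀ w, ∑ i, δ i * Y i w = ∑ i, m i * X i w) (hδ : δ 0 ≠ 0)
    (hinj : ∀ w, (∀ i, X i w = 0) → (∀ i, Y i w = 0) → w = 0) :
    ∃ L : Submodule k (Fin 4 → k), finrank k L = 2 ∧ ∀ w, w ∈ L ↔ ∀ i, X i w = 0 := by
  refine ⟨LinearMap.ker (X 1) ⊓ LinearMap.ker (X 2), finrank_ker_inf_ker fun a b hab => ?_,
    fun w => ⟨fun hw i => ?_, fun hw => ⟨hw 1, hw 2⟩⟩⟩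
  · have hw := exists_forall_apply_eq hX hr hδ hinj
    obtain ⟨e₁, a1, a2, -, -⟩ := hw ![1, 0, 0, 0]
    obtain ⟨e₂, b1, b2, -, -⟩ := hw ![0, 1, 0, 0]
    have h1 := LinearMap.congr_fun hab e₁
    have h2 := LinearMap.congr_fun hab e₂
    simp at a1 a2 b1 b2
    simp [a1, a2, b1, b2] at h1 h2
    exact ⟨h1, h2⟩
  · have h1 : X 1 w = 0 := hw.1
    have h2 : X 2 w = 0 := hw.2
    fin_cases i
    · change X 0 w = 0
      rw [sum_three_eq_zero_apply hX, h1, h2]; simp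
    · exact h1
    · exact h2

variable [CharZero k]

/-- The second order terms at a point of the fibre give `∑ Xᵢ (Y'ᵢ² - Yᵢ²) = 0`, where the `Xᵢ` are
arbitrary with sum zero. -/
theorem sq_sub_sq_eq_of_fiber (hX : ∑ i, X i = 0)
    (hc : ∀ w, μ * (X 0 w * X 1 w * X 2 w) + ∑ i, X i w * Y i w ^ 2 =
      μ' * (X 0 w * X 1 w * X 2 w) + ∑ i, X i w * Y' i w ^ 2)
    (hr : ∀ w, ∑ i, δ i * Y i w = ∑ i, m i * X i w) (hδ : δ 0 ≠ 0)
    (hinj : ∀ w, (∀ i, X i w = 0) → (∀ i, Y i w = 0) → w = 0)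
    {e : Fin 4 → k} (he : ∀ i, X i e = 0) (i : Fin 3) :
    Y' i e ^ 2 - Y i e ^ 2 = Y' 0 e ^ 2 - Y 0 e ^ 2 := by
  have hw := exists_forall_apply_eq hX hr hδ hinj
  obtain ⟨e₁, a1, a2, -, -⟩ := hw ![1, 0, 0, 0]
  obtain ⟨e₂, b1, b2, -, -⟩ := hw ![0, 1, 0, 0]
  have a0 : X 0 e₁ = -1 := by rw [sum_three_eq_zero_apply hX, a1, a2]; simp
  have b0 : X 0 e₂ = -1 := by rw [sum_three_eq_zero_apply hX, b1, b2]; simp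
  simp at a1 a2 b1 b2
  have h1 := (sum_mul_eq_zero_of_cubic hc he e₁).1
  have h2 := (sum_mul_eq_zero_of_cubic hc he e₂).1
  simp only [Fin.sum_univ_three, a0, a1, a2, b0, b1, b2] at h1 h2
  fin_cases i
  · rfl
  · change Y' 1 e ^ 2 - Y 1 e ^ 2 = _
    linear_combination h1
  · change Y' 2 e ^ 2 - Y 2 e ^ 2 = _
    linear_combination h2

/-- For a second point `e` of the fibre, `(Y'ᵢ(e) - Yᵢ(e)) Yᵢ(p)` does not depend on `i`. If it is
zero, the forms agree up to sign on the fibre, and `eq_of_eq_of_fiber` extends this. If not, a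
suitable point of the fibre has `Y' = -Y`, and `false_of_fiber` applies. -/
theorem exists_sign_of_eq_on_point (hX : ∑ i, X i = 0)
    (hc : ∀ w, μ * (X 0 w * X 1 w * X 2 w) + ∑ i, X i w * Y i w ^ 2 =
      μ' * (X 0 w * X 1 w * X 2 w) + ∑ i, X i w * Y' i w ^ 2)
    (hr : ∀ w, ∑ i, δ i * Y i w = ∑ i, m i * X i w) (hδ : ∀ i, δ i ≠ 0)
    (hr' : ∀ w, ∑ i, δ' i * Y' i w = ∑ i, m' i * X i w) (hδ' : δ' 0 ≠ 0)
    (hinj : ∀ w, (∀ i, X i w = 0) → (∀ i, Y i w = 0) → w = 0)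
    (hE : (m 1 - m 0) ^ 2 - 2 * (m 1 - m 0) * (m 2 - m 0) + μ * (δ 1 ^ 2 - δ 0 ^ 2) ≠ 0)
    (hM : m 1 - m 0 ≠ 0)
    (hW : ∀ w, ∑ i, (m' i ^ 2 + μ' * δ' i ^ 2) * X i w - 2 * ∑ i, m' i * δ' i * Y' i w =
      ν * (∑ i, (m i ^ 2 + μ * δ i ^ 2) * X i w - 2 * ∑ i, m i * δ i * Y i w))
    {p : Fin 4 → k} (hp : ∀ i, X i p = 0) (hp0 : p ≠ 0) (hpY : ∀ i, Y' i p = Y i p) :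
    ∃ ε : Fin 3 → k, (∀ i, ε i ^ 2 = 1) ∧ ∀ i w, Y' i w = ε i * Y i w := by
  obtain ⟨L, hL, hmem⟩ := exists_fiber hX hr (hδ 0) hinj
  obtain ⟨e, heL, -, hspan⟩ := exists_span_pair hL ((hmem p).2 hp) hp0
  have he := (hmem e).1 heL
  have hsq := fun {e} he i => sq_sub_sq_eq_of_fiber (e := e) hX hc hr (hδ 0) hinj he i
  have hγ : ∀ i, (Y' i e - Y i e) * Y i p = (Y' 0 e - Y 0 e) * Y 0 p := by
    intro i
    have h1 := hsq he i
    have h2 := hsq (e := e + p) (fun i => by rw [map_add, he, hp, add_zero]) i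
    simp only [map_add, hpY] at h2
    exact mul_left_cancel₀ (two_ne_zero (α := k)) (by linear_combination h2 - h1)
  by_cases hγ0 : (Y' 0 e - Y 0 e) * Y 0 p = 0
  · have hcase : ∀ i, ∃ s : k, s ^ 2 = 1 ∧ Y' i p = s * Y i p ∧ Y' i e = s * Y i e := by
      intro i
      by_cases h1 : Y' i e - Y i e = 0
      · exact ⟨1, by simp, by simp [hpY], by linear_combination h1⟩
      · have h2 : Y i p = 0 := (mul_eq_zero.1 ((hγ i).trans hγ0)).resolve_left h1
        have h3 : Y' 0 e ^ 2 - Y 0 e ^ 2 = 0 := by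
          by_contra h4
          refine hp0 (hinj p hp fun j => ?_)
          refine (mul_eq_zero.1 ((hγ j).trans hγ0)).resolve_left fun h5 => h4 ?_
          rw [← hsq he j]
          linear_combination (Y' j e + Y j e) * h5
        have h4 : (Y' i e - Y i e) * (Y' i e + Y i e) = 0 := by
          linear_combination hsq he i + h3
        exact ⟨-1, by simp, by rw [hpY, h2]; simp,
          by linear_combination (mul_eq_zero.1 h4).resolve_left h1⟩
    choose ε hε hεp hεe using hcase
    refine ⟨ε, hε, fun i w => ?_⟩
    have h1 : ∀ i w, ε i * Y' i w = Y i w := fun i w => by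
      refine eq_of_eq_of_fiber (Y' := fun i => ε i • Y' i) hX (μ := μ) (μ' := μ')
        (fun w => ?_) hr hδ hinj
        (fun w hw i => ?_) i w
      · rw [hc w]
        congr 1
        refine Finset.sum_congr rfl fun i _ => ?_
        rw [LinearMap.smul_apply, smul_eq_mul]
        linear_combination -X i w * Y' i w ^ 2 * hε i
      · obtain ⟨a, b, rfl⟩ := hspan w ((hmem w).2 hw)
        simp only [LinearMap.smul_apply, map_add, map_smul, smul_eq_mul, hεp, hεe]
        linear_combination (a * Y i p + b * Y i e) * hε i
    linear_combination -Y' i w * hε i + ε i * h1 i w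
  · exfalso
    have hYp : Y 0 p ≠ 0 := right_ne_zero_of_mul hγ0
    -- Chosen so that `Y'₀ + Y₀` vanishes at `f = e - c p`; the other indices follow since `Y'ᵢ -
    -- Yᵢ` is nonzero there.
    obtain ⟨c, hc'⟩ : ∃ c, c = (Y' 0 e + Y 0 e) / (2 * Y 0 p) := ⟨_, rfl⟩
    obtain ⟨f, hf⟩ : ∃ f, f = e - c • p := ⟨_, rfl⟩
    have hfX : ∀ i, X i f = 0 := fun i => by rw [hf, map_sub, map_smul, he, hp]; simp
    have hf0 : Y' 0 f + Y 0 f = 0 := by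
      rw [hf, map_sub, map_sub, map_smul, map_smul, hpY, hc', smul_eq_mul]
      field_simp
      ring
    have hfd : ∀ i, Y' i f - Y i f = Y' i e - Y i e := fun i => by
      rw [hf, map_sub, map_sub, map_smul, map_smul, hpY]; ring
    have hfY : ∀ i, Y' i f = - Y i f := fun i => by
      have h1 : (Y' i e - Y i e) * (Y' i f + Y i f) = 0 := by
        rw [← hfd]
        linear_combination hsq hfX i + (Y' 0 f - Y 0 f) * hf0
      have h2 := (mul_eq_zero.1 h1).resolve_left (left_ne_zero_of_mul (hγ i ▸ hγ0))
      linear_combination h2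
    have hprod : ∀ i, Y i f * Y i p = Y 0 f * Y 0 p := fun i => by
      have h1 := hγ i
      rw [← hfd, ← hfd, hfY, hfY] at h1
      exact mul_left_cancel₀ (two_ne_zero (α := k)) (by linear_combination -h1)
    have hYf : Y 0 f ≠ 0 := fun h => hγ0 (by rw [← hfd, hfY, h]; simp)
    refine false_of_fiber (p := -(Y 0 f)⁻¹ • f) (q := (Y 0 p)⁻¹ • p) hX hc hr hδ hr' hδ' hinj hE hM
      hW (fun i => by simp [hfX]) (fun i => by simp [hp]) ?_ ?_ (fun i => by simp [hfY])
      (fun i => by simp [hpY]) fun i => ?_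
    · simp [hYf]
    · simp [hYp]
    · have := hprod i
      simp only [map_smul, smul_eq_mul]
      field_simp
      linear_combination -this

/-- A cubic form `μ X₀X₁X₂ + ∑ Xᵢ Yᵢ²`, together with a relation `∑ δᵢ Yᵢ = ∑ mᵢ Xᵢ` and the plane
`∑ (mᵢ² + μ δᵢ²) Xᵢ = 2 ∑ mᵢ δᵢ Yᵢ`, determines the forms `Yᵢ` up to sign. -/
theorem exists_sign (hX : ∑ i, X i = 0)
    (hc : ∀ w, μ * (X 0 w * X 1 w * X 2 w) + ∑ i, X i w * Y i w ^ 2 =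
      μ' * (X 0 w * X 1 w * X 2 w) + ∑ i, X i w * Y' i w ^ 2)
    (hr : ∀ w, ∑ i, δ i * Y i w = ∑ i, m i * X i w) (hδ : ∀ i, δ i ≠ 0)
    (hr' : ∀ w, ∑ i, δ' i * Y' i w = ∑ i, m' i * X i w) (hδ' : δ' 0 ≠ 0)
    (hinj : ∀ w, (∀ i, X i w = 0) → (∀ i, Y i w = 0) → w = 0)
    (hE : (m 1 - m 0) ^ 2 - 2 * (m 1 - m 0) * (m 2 - m 0) + μ * (δ 1 ^ 2 - δ 0 ^ 2) ≠ 0)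
    (hM : m 1 - m 0 ≠ 0)
    (hW : ∀ w, ∑ i, (m' i ^ 2 + μ' * δ' i ^ 2) * X i w - 2 * ∑ i, m' i * δ' i * Y' i w =
      ν * (∑ i, (m i ^ 2 + μ * δ i ^ 2) * X i w - 2 * ∑ i, m i * δ i * Y i w)) :
    ∃ ε : Fin 3 → k, (∀ i, ε i ^ 2 = 1) ∧ ∀ i w, Y' i w = ε i * Y i w := by
  obtain ⟨L, hL, hmem⟩ := exists_fiber hX hr (hδ 0) hinj
  -- A form has a zero on the two-dimensional fibre. Where `Y'₀ = Y₀`, all squares agree, so that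
  -- after sign changes `Y' = Y` at `p`.
  obtain ⟨p, hp0, hpL, hpY⟩ := exists_mem_ne_zero (inf_ker_ne_bot hL (Y' 0 - Y 0))
  have hp := (hmem p).1 hpL
  have h0 : Y' 0 p - Y 0 p = 0 := hpY
  have h1 : ∀ i, ∃ s : k, s ^ 2 = 1 ∧ s * Y' i p = Y i p := by
    intro i
    have h2 : (Y' i p - Y i p) * (Y' i p + Y i p) = 0 := by
      linear_combination sq_sub_sq_eq_of_fiber hX hc hr (hδ 0) hinj hp i + (Y' 0 p + Y 0 p) * h0
    rcases mul_eq_zero.1 h2 with h3 | h3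
    · exact ⟨1, by simp, by linear_combination h3⟩
    · exact ⟨-1, by simp, by linear_combination -h3⟩
  choose s hs hsp using h1
  have key : ∃ ε : Fin 3 → k, (∀ i, ε i ^ 2 = 1) ∧ ∀ i w, (s i • Y' i) w = ε i * Y i w := by
    refine exists_sign_of_eq_on_point (Y' := fun i => s i • Y' i) (μ := μ)
      (δ' := fun i => s i * δ' i) (μ' := μ') (m' := m') (ν := ν) hX (fun w => ?_) hr hδ
      (fun w => ?_) (mul_ne_zero (fun h => by simpa [h] using hs 0) hδ') hinj hE hM (fun w => ?_)
      hp hp0 hsp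
    · rw [hc w]
      congr 1
      refine Finset.sum_congr rfl fun i _ => ?_
      rw [LinearMap.smul_apply, smul_eq_mul]
      linear_combination -X i w * Y' i w ^ 2 * hs i
    · rw [← hr' w]
      refine Finset.sum_congr rfl fun i _ => ?_
      rw [LinearMap.smul_apply, smul_eq_mul]
      linear_combination δ' i * Y' i w * hs i
    · rw [← hW w]
      refine congrArg₂ _ (Finset.sum_congr rfl fun i _ => ?_)
        (congrArg _ (Finset.sum_congr rfl fun i _ => ?_))
      · linear_combination μ' * δ' i ^ 2 * X i w * hs i
      · rw [LinearMap.smul_apply, smul_eq_mul]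
        linear_combination m' i * δ' i * Y' i w * hs i
  obtain ⟨ε, hε, hY⟩ := key
  refine ⟨fun i => s i * ε i, fun i => by rw [mul_pow, hs, hε, one_mul], fun i w => ?_⟩
  have h2 := hY i w
  rw [LinearMap.smul_apply, smul_eq_mul] at h2
  linear_combination s i * h2 - Y' i w * hs i

end

end CubicSurface
end

/-! ### Hexahedral equations in sums and differences of pairs -/

noncomputable section
namespace CubicSurface
open Module
variable {k : Type*} [Field k] {F : MvPolynomial (Fin 4) k}
  {T : (Fin 4 → k) →ₗ[k] (Fin 4 → k) →ₗ[k] (Fin 4 → k) →ₗ[k] k}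
  {Z Z' : Fin 6 → Dual k (Fin 4 → k)} {β β' : Fin 6 → k}

theorem injective_of_hexDisc_ne_zero (h : ∀ s : Equiv.Perm (Fin 6), hexDisc (β ∘ s) ≠ 0) :
    Function.Injective β := by
  intro i j hij
  by_contra hne
  obtain ⟨s, hi, hj⟩ := exists_perm_apply i j hne
  refine h (s * Equiv.swap 0 4 * Equiv.swap 1 5) ?_
  have h0 : (β ∘ (s * Equiv.swap 0 4 * Equiv.swap 1 5 : Equiv.Perm (Fin 6))) 0 = β i :=
    congrArg β hi
  have h1 : (β ∘ (s * Equiv.swap 0 4 * Equiv.swap 1 5 : Equiv.Perm (Fin 6))) 1 = β j :=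
    congrArg β hj
  rw [hexDisc, h0, h1, hij]
  ring

theorem hexDoubleSix_eq_of_smul {t : k} (ht : t ≠ 0) (s : Equiv.Perm (Fin 6))
    (h : ∀ l, Z' l = t • Z (s l)) : hexDoubleSix F Z' = hexDoubleSix F Z := by
  rw [← hexDoubleSix_comp (Z := Z) s]
  have h1 : ∀ r, hexLine Z' r = hexLine (Z ∘ s) r := fun r => by
    simp only [hexLine, h, ← smul_add, LinearMap.ker_smul _ _ ht]
    rfl
  simp only [hexDoubleSix, h1]

/-- The first indices of the three standard pairs. -/
def pairFst : Fin 3 → Fin 6 := ![0, 2, 4]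

/-- The second indices of the three standard pairs. -/
def pairSnd : Fin 3 → Fin 6 := ![1, 3, 5]

theorem exists_perm_pair (π : Equiv.Perm (Fin 3)) : ∃ s : Equiv.Perm (Fin 6),
    ∀ i, s (pairFst i) = pairFst (π i) ∧ s (pairSnd i) = pairSnd (π i) := by
  revert π; decide +kernel

theorem exists_perm_flip (f : Fin 3 → Bool) : ∃ s : Equiv.Perm (Fin 6), ∀ i,
    s (pairFst i) = (if f i then pairSnd i else pairFst i) ∧
      s (pairSnd i) = (if f i then pairFst i else pairSnd i) := by
  revert f; decide +kernel

theorem forall_fin_six_iff_pair {p : Fin 6 → Prop} :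
    (∀ l, p l) ↔ ∀ i, p (pairFst i) ∧ p (pairSnd i) := by
  refine ⟨fun h i => ⟨h _, h _⟩, fun h l => ?_⟩
  fin_cases l
  exacts [(h 0).1, (h 0).2, (h 1).1, (h 1).2, (h 2).1, (h 2).2]

/-- The sums of the standard pairs of forms. -/
def pairSum (Z : Fin 6 → Dual k (Fin 4 → k)) (i : Fin 3) : Dual k (Fin 4 → k) :=
  Z (pairFst i) + Z (pairSnd i)

/-- The differences of the standard pairs of forms. -/
def pairDiff (Z : Fin 6 → Dual k (Fin 4 → k)) (i : Fin 3) : Dual k (Fin 4 → k) :=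
  Z (pairFst i) - Z (pairSnd i)

/-- The negatives of the means of the standard pairs of constants. -/
def pairMean (β : Fin 6 → k) (i : Fin 3) : k := -(β (pairFst i) + β (pairSnd i)) / 2

/-- The half differences of the standard pairs of constants. -/
def pairDev (β : Fin 6 → k) (i : Fin 3) : k := (β (pairFst i) - β (pairSnd i)) / 2

theorem sum_eq_sum_pair {M : Type*} [AddCommMonoid M] (f : Fin 6 → M) :
    ∑ l, f l = ∑ i, (f (pairFst i) + f (pairSnd i)) := by
  rw [Fin.sum_univ_six, Fin.sum_univ_three]
  change _ = f 0 + f 1 + (f 2 + f 3) + (f 4 + f 5)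
  simp only [add_assoc]

theorem IsHexahedral.sum_pairSum (h : IsHexahedral F Z β) : ∑ i, pairSum Z i = 0 := by
  rw [← h.sum_eq_zero, sum_eq_sum_pair]
  rfl

/-- With sum `X` and difference `Y`, a pair of cubes is `(X³ + 3XY²)/4`, and `∑ Xᵢ³ = 3 X₀X₁X₂`
because the `Xᵢ` add up to zero. -/
theorem IsHexahedral.sum_cubes_pair (h : IsHexahedral F Z β) (w : Fin 4 → k) :
    3 * (pairSum Z 0 w * pairSum Z 1 w * pairSum Z 2 w +
      ∑ i, pairSum Z i w * pairDiff Z i w ^ 2) = 4 * ∑ l, Z l w ^ 3 := by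
  have h1 := sum_three_eq_zero_apply h.sum_pairSum w
  have h2 : ∀ i, pairSum Z i w ^ 3 + 3 * (pairSum Z i w * pairDiff Z i w ^ 2) =
      4 * (Z (pairFst i) w ^ 3 + Z (pairSnd i) w ^ 3) := fun i => by
    simp only [pairDiff, pairSum, LinearMap.add_apply, LinearMap.sub_apply]
    ring
  have h3 : ∑ i, pairSum Z i w ^ 3 = 3 * (pairSum Z 0 w * pairSum Z 1 w * pairSum Z 2 w) := by
    rw [Fin.sum_univ_three, h1]; ring
  rw [sum_eq_sum_pair, Finset.mul_sum, mul_add, ← h3, Finset.mul_sum, ← Finset.sum_add_distrib]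
  exact Finset.sum_congr rfl fun i _ => h2 i

section

variable [CharZero k]

/-- Otherwise `βᵢ²` would be an affine function of `βᵢ`, so that a monic quadratic polynomial would
vanish at all `βᵢ`. -/
theorem IsHexahedral.sum_sq_ne_zero (hT : IsPolar F T) (h : IsHexahedral F Z β)
    (hβ : Function.Injective β) : ∑ i, β i ^ 2 • Z i ≠ 0 := by
  intro h0
  obtain ⟨x, y, hxy⟩ := h.exists_affine hT h0
  have h1 : ∀ i, 1 * β i ^ 2 + -y * β i + -x = 0 := fun i => by linear_combination hxy i
  exact one_ne_zero (eq_zero_of_quadratic (hβ.ne (show (0 : Fin 6) ≠ 1 by decide))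
    (hβ.ne (show (0 : Fin 6) ≠ 2 by decide)) (hβ.ne (show (1 : Fin 6) ≠ 2 by decide))
    (h1 0) (h1 1) (h1 2)).1

theorem IsHexahedral.sum_pairDev (h : IsHexahedral F Z β) (w : Fin 4 → k) :
    ∑ i, pairDev β i * pairDiff Z i w = ∑ i, pairMean β i * pairSum Z i w := by
  have h1 := LinearMap.congr_fun h.sum_smul_eq_zero w
  rw [LinearMap.sum_apply, sum_eq_sum_pair] at h1
  rw [LinearMap.zero_apply] at h1
  rw [← sub_eq_zero, ← Finset.sum_sub_distrib, ← h1]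
  refine Finset.sum_congr rfl fun i _ => ?_
  simp only [pairDev, pairDiff, pairMean, pairSum, LinearMap.add_apply, LinearMap.sub_apply,
    LinearMap.smul_apply, smul_eq_mul]
  ring

/-- The factor `1` is the `μ` of `exists_sign`. -/
theorem sum_sq_smul_apply (w : Fin 4 → k) : (∑ l, β l ^ 2 • Z l) w =
    ∑ i, (pairMean β i ^ 2 + 1 * pairDev β i ^ 2) * pairSum Z i w -
      2 * ∑ i, pairMean β i * pairDev β i * pairDiff Z i w := by
  rw [LinearMap.sum_apply, sum_eq_sum_pair, Finset.mul_sum, ← Finset.sum_sub_distrib]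
  refine Finset.sum_congr rfl fun i _ => ?_
  simp only [pairDev, pairDiff, pairMean, pairSum, LinearMap.add_apply, LinearMap.sub_apply,
    LinearMap.smul_apply, smul_eq_mul]
  ring

theorem IsHexahedral.eq_zero_of_pair (h : IsHexahedral F Z β) (w : Fin 4 → k)
    (hX : ∀ i, pairSum Z i w = 0) (hY : ∀ i, pairDiff Z i w = 0) : w = 0 := by
  refine h.injective w (forall_fin_six_iff_pair.2 fun i => ?_)
  have h1 : Z (pairFst i) w + Z (pairSnd i) w = 0 := hX i
  have h2 : Z (pairFst i) w - Z (pairSnd i) w = 0 := hY i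
  exact ⟨by linear_combination h1 / 2 + h2 / 2, by linear_combination h1 / 2 - h2 / 2⟩

theorem pairDev_ne_zero (hβ : Function.Injective β) (i : Fin 3) : pairDev β i ≠ 0 := by
  have h1 : pairFst i ≠ pairSnd i := by revert i; decide
  exact div_ne_zero (sub_ne_zero.2 (hβ.ne h1)) two_ne_zero

/-- The `Xᵢ` of the two systems differ by a common factor and the `Yᵢ`, by `exists_sign`, by that
factor and signs. A change of sign exchanges the members of a pair, so the second system is a
renumbered multiple of the first. -/
theorem IsHexahedral.hexDoubleSix_eq_of_planes (hT : IsPolar F T) [IsAlgClosed k]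
    (h : IsHexahedral F Z β) (h' : IsHexahedral F Z' β')
    (hβ : Function.Injective β) (hβ' : Function.Injective β') (hd : hexDisc β ≠ 0)
    (hk : ∀ i, LinearMap.ker (pairSum Z' i) = LinearMap.ker (pairSum Z i))
    (hW : LinearMap.ker (∑ i, β' i ^ 2 • Z' i) = LinearMap.ker (∑ i, β i ^ 2 • Z i)) :
    hexDoubleSix F Z' = hexDoubleSix F Z := by
  have hX := h.sum_pairSum
  have hX' := h'.sum_pairSum
  have hδ := pairDev_ne_zero hβ
  have hδ' := pairDev_ne_zero hβ'
  obtain ⟨ν, hν⟩ := exists_eq_smul_of_ker_eq (h.sum_sq_ne_zero hT hβ) hW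
  have hpt := exists_forall_apply_eq hX h.sum_pairDev (hδ 0) h.eq_zero_of_pair
  obtain ⟨e₁, a1, a2, -, -⟩ := hpt ![1, 0, 0, 0]
  obtain ⟨e₂, b1, b2, -, -⟩ := hpt ![0, 1, 0, 0]
  have a0 : pairSum Z 0 e₁ = -1 := by rw [sum_three_eq_zero_apply hX, a1, a2]; simp
  have b0 : pairSum Z 0 e₂ = -1 := by rw [sum_three_eq_zero_apply hX, b1, b2]; simp
  simp at a1 a2 b1 b2
  have hne : ∀ i, pairSum Z i ≠ 0 := fun i hi => by
    have h1 := LinearMap.congr_fun hi e₁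
    have h2 := LinearMap.congr_fun hi e₂
    rw [LinearMap.zero_apply] at h1 h2
    fin_cases i
    · exact neg_ne_zero.2 one_ne_zero (a0.symm.trans h1)
    · exact one_ne_zero (a1.symm.trans h1)
    · exact one_ne_zero (b2.symm.trans h2)
  choose l hl using fun i => exists_eq_smul_of_ker_eq (hne i) (hk i)
  -- Both triples of `X` add up to zero and two of them are independent, so the three factors
  -- coincide.
  obtain ⟨t, hlt⟩ : ∃ t, ∀ i, l i = t := by
    refine ⟨l 0, fun i => ?_⟩
    have h1 := sum_three_eq_zero_apply hX' e₁
    have h2 := sum_three_eq_zero_apply hX' e₂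
    simp only [hl, LinearMap.smul_apply, a0, a1, a2, b0, b1, b2, smul_eq_mul] at h1 h2
    fin_cases i
    · rfl
    · change l 1 = _
      linear_combination h1
    · change l 2 = _
      linear_combination h2
  have hXX : ∀ i w, pairSum Z' i w = t * pairSum Z i w := fun i w => by rw [hl, hlt]; rfl
  have ht : t ≠ 0 := by
    rintro rfl
    have h1 := hk 0
    rw [LinearMap.ext (hXX 0 · |>.trans (zero_mul _)) (g := 0), LinearMap.ker_zero] at h1
    exact hne 0 (LinearMap.ker_eq_top.1 h1.symm)
  obtain ⟨c, hc, hcF⟩ := h.sum_cubes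
  obtain ⟨c', hc', hcF'⟩ := h'.sum_cubes
  -- Scales the `Y'ᵢ` such that the two expressions of the cubic have the same terms `XᵢYᵢ²` up to
  -- the replacement of `Y` by `Y'`.
  obtain ⟨η, hη⟩ := IsAlgClosed.exists_pow_nat_eq (t * c / c') (n := 2) two_pos
  have hη0 : η ≠ 0 := by
    rintro rfl
    exact div_ne_zero (mul_ne_zero ht hc) hc' (by rw [← hη]; simp)
  have hη' : η ^ 2 * c' = t * c := by rw [hη]; field_simp
  have hcub : ∀ w, 1 * (pairSum Z 0 w * pairSum Z 1 w * pairSum Z 2 w) +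
      ∑ i, pairSum Z i w * pairDiff Z i w ^ 2 =
      t ^ 2 * η ^ 2 * (pairSum Z 0 w * pairSum Z 1 w * pairSum Z 2 w) +
      ∑ i, pairSum Z i w * (η • pairDiff Z' i) w ^ 2 := by
    intro w
    have h1 := h.sum_cubes_pair w
    have h2 := h'.sum_cubes_pair w
    rw [hcF] at h1
    rw [hcF'] at h2
    simp only [hXX, Fin.sum_univ_three, LinearMap.smul_apply, smul_eq_mul] at h1 h2 ⊢
    refine mul_left_cancel₀ (mul_ne_zero three_ne_zero hc') ?_
    linear_combination c' * h1 - c * h2 - 3 * (t ^ 2 * (pairSum Z 0 w * pairSum Z 1 w *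
      pairSum Z 2 w) + (pairSum Z 0 w * pairDiff Z' 0 w ^ 2 + pairSum Z 1 w * pairDiff Z' 1 w ^ 2 +
      pairSum Z 2 w * pairDiff Z' 2 w ^ 2)) * hη'
  have key : ∃ ε : Fin 3 → k, (∀ i, ε i ^ 2 = 1) ∧
      ∀ i w, (η • pairDiff Z' i) w = ε i * pairDiff Z i w := by
    refine exists_sign (X := pairSum Z) (Y := pairDiff Z)
      (Y' := fun i => η • pairDiff Z' i) (μ := 1) (μ' := t ^ 2 * η ^ 2) (δ := pairDev β)
      (δ' := fun i => η⁻¹ * pairDev β' i) (m := pairMean β) (m' := fun i => t * pairMean β' i)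
      (ν := t * ν) hX hcub h.sum_pairDev hδ (fun w => ?_) (mul_ne_zero (inv_ne_zero hη0) (hδ' 0))
      h.eq_zero_of_pair (fun h0 => hd ?_) (fun h0 => hd ?_) fun w => ?_
    · refine (Eq.trans (Finset.sum_congr rfl fun i _ => ?_) (h'.sum_pairDev w)).trans
        (Finset.sum_congr rfl fun i _ => ?_)
      · rw [LinearMap.smul_apply, smul_eq_mul]
        field_simp
      · rw [hXX]; ring
    -- The two quantities that `exists_sign` requires to be nonzero are, up to constants, factors of
    -- `hexDisc`.
    · change (-(β 2 + β 3) / 2 - -(β 0 + β 1) / 2) ^ 2 -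
        2 * (-(β 2 + β 3) / 2 - -(β 0 + β 1) / 2) * (-(β 4 + β 5) / 2 - -(β 0 + β 1) / 2) +
        1 * (((β 2 - β 3) / 2) ^ 2 - ((β 0 - β 1) / 2) ^ 2) = 0 at h0
      rw [hexDisc]
      linear_combination 4 * (β 0 - β 1) * (β 2 + β 3 - (β 0 + β 1)) * h0
    · change -(β 2 + β 3) / 2 - -(β 0 + β 1) / 2 = 0 at h0
      have h1 : β 2 + β 3 - (β 0 + β 1) = 0 := by linear_combination -2 * h0
      rw [hexDisc, h1]
      ring
    · have h1 := LinearMap.congr_fun hν w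
      rw [LinearMap.smul_apply, sum_sq_smul_apply, sum_sq_smul_apply, smul_eq_mul] at h1
      rw [mul_assoc, ← h1, mul_sub, mul_left_comm t 2, Finset.mul_sum _ _ t, Finset.mul_sum _ _ t]
      refine congrArg₂ _ (Finset.sum_congr rfl fun i _ => ?_)
        (congrArg _ (Finset.sum_congr rfl fun i _ => ?_))
      · rw [hXX]
        field_simp
      · rw [LinearMap.smul_apply, smul_eq_mul]
        field_simp
  obtain ⟨ε, hε, hY⟩ := key
  -- Once the squares `Yᵢ²` agree, the coefficients of `X₀X₁X₂` must agree too; they are compared at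
  -- `e₁ + e₂`.
  have hηt : (t * η) ^ 2 = 1 := by
    have h1 := hcub (e₁ + e₂)
    have h2 : ∀ i w, (η • pairDiff Z' i) w ^ 2 = pairDiff Z i w ^ 2 := fun i w => by
      rw [hY, mul_pow, hε, one_mul]
    simp only [h2] at h1
    rw [add_left_inj] at h1
    simp only [map_add, a0, a1, a2, b0, b1, b2] at h1
    refine mul_left_cancel₀ (two_ne_zero (α := k)) ?_
    linear_combination h1
  have hσ : ∀ i, ∃ b : Bool, t * η * ε i = if b then -1 else 1 := fun i => by
    have h1 : (t * η * ε i) * (t * η * ε i) = 1 := by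
      linear_combination hηt + (t * η) ^ 2 * hε i
    rcases mul_self_eq_one_iff.1 h1 with h2 | h2
    · exact ⟨false, by simpa using h2⟩
    · exact ⟨true, by simpa using h2⟩
  choose f hf using hσ
  obtain ⟨s, hs⟩ := exists_perm_flip f
  have hYY : ∀ i w, pairDiff Z' i w = t * (if f i then -1 else 1) * pairDiff Z i w := fun i w => by
    have h1 := hY i w
    rw [LinearMap.smul_apply, smul_eq_mul] at h1
    rw [← hf]
    linear_combination -pairDiff Z' i w * hηt + t ^ 2 * η * h1
  refine hexDoubleSix_eq_of_smul ht s (forall_fin_six_iff_pair.2 fun i => ?_)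
  have h1 : ∀ w, Z' (pairFst i) w + Z' (pairSnd i) w =
      t * (Z (pairFst i) w + Z (pairSnd i) w) := hXX i
  have h2 : ∀ w, Z' (pairFst i) w - Z' (pairSnd i) w =
      t * (if f i then -1 else 1) * (Z (pairFst i) w - Z (pairSnd i) w) := hYY i
  rw [(hs i).1, (hs i).2]
  cases hi : f i <;> simp only [hi, Bool.false_eq_true, if_false, if_true] at h2 ⊢
  · exact ⟨LinearMap.ext fun w => by
      rw [LinearMap.smul_apply, smul_eq_mul]; linear_combination (h1 w + h2 w) / 2,
      LinearMap.ext fun w => by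
      rw [LinearMap.smul_apply, smul_eq_mul]; linear_combination (h1 w - h2 w) / 2⟩
  · exact ⟨LinearMap.ext fun w => by
      rw [LinearMap.smul_apply, smul_eq_mul]; linear_combination (h1 w + h2 w) / 2,
      LinearMap.ext fun w => by
      rw [LinearMap.smul_apply, smul_eq_mul]; linear_combination (h1 w - h2 w) / 2⟩

end

end CubicSurface
end

/-! ### Double-sixes with a common line of comparison -/

noncomputable section
namespace CubicSurface
open Module
variable {k : Type*} [Field k] {F : MvPolynomial (Fin 4) k}
  {T : (Fin 4 → k) →ₗ[k] (Fin 4 → k) →ₗ[k] (Fin 4 → k) →ₗ[k] k}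
  {Z Z' : Fin 6 → Dual k (Fin 4 → k)} {β β' : Fin 6 → k}

theorem hexLine_le_pairSum (i : Fin 3) : hexLine Z 1 ≤ LinearMap.ker (pairSum Z i) := by
  fin_cases i
  · exact fun x hx => hx.1.1
  · exact fun x hx => hx.1.2
  · exact fun x hx => hx.2

/-- A partition that shares with the standard one just the `i`-th pair. -/
def recouple : Fin 3 → Equiv.Perm (Fin 6) := ![Equiv.swap 2 4, Equiv.swap 0 4, Equiv.swap 0 2]

theorem hexLine_recouple_le (i : Fin 3) :
    hexLine Z (recouple i) ≤ LinearMap.ker (pairSum Z i) := by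
  fin_cases i
  · exact fun x hx => hx.1.1
  · exact fun x hx => hx.1.2
  · exact fun x hx => hx.2

theorem eq_pair_or (a b : Fin 6) (hab : a < b) :
    (∃ j, a = pairFst j ∧ b = pairSnd j) ∨ ∃ j,
      (a = pairFst j ∧ b ≠ pairSnd j) ∨ (a = pairSnd j ∧ b ≠ pairFst j) := by
  revert a b; decide

section

variable [CharZero k] (hT : IsPolar F T)

include hT

theorem IsHexahedral.eq_pair_of_le (h : IsHexahedral F Z β) {a b : Fin 6} (hab : a < b)
    (hle : hexLine Z 1 ≤ LinearMap.ker (Z a + Z b)) : ∃ j, a = pairFst j ∧ b = pairSnd j := by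
  have hne : ∀ j, pairFst j ≠ pairSnd j := by decide
  have hL := h.isLineOn_hexLine hT 1
  rcases eq_pair_or a b hab with h1 | ⟨j, ⟨rfl, h1⟩ | ⟨rfl, h1⟩⟩
  · exact h1
  · refine (h.false_of_le hT (hne j) hab.ne h1.symm hL ?_ hle).elim
    rw [add_comm]
    exact hexLine_le_pairSum j
  · exact (h.false_of_le hT (hne j).symm hab.ne h1.symm hL (hexLine_le_pairSum j) hle).elim

theorem IsHexahedral.hexLine_recouple_ne (h : IsHexahedral F Z β) (i : Fin 3) :
    hexLine Z 1 ≠ hexLine Z (recouple i) := by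
  intro he
  have hL := h.isLineOn_hexLine hT 1
  fin_cases i
  · exact h.false_of_le hT (a := 3) (b := 2) (c := 4) (by decide) (by decide) (by decide) hL
      (hexLine_le_pairSum 1) (he.le.trans fun x hx => by
        have : (Z 4 + Z 3) x = 0 := hx.1.2
        rwa [add_comm] at this)
  · exact h.false_of_le hT (a := 1) (b := 0) (c := 4) (by decide) (by decide) (by decide) hL
      (hexLine_le_pairSum 0) (he.le.trans fun x hx => by
        have : (Z 4 + Z 1) x = 0 := hx.1.1
        rwa [add_comm] at this)
  · exact h.false_of_le hT (a := 1) (b := 0) (c := 2) (by decide) (by decide) (by decide) hL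
      (hexLine_le_pairSum 0) (he.le.trans fun x hx => by
        have : (Z 2 + Z 1) x = 0 := hx.1.1
        rwa [add_comm] at this)

theorem IsHexahedral.pairSum_ne_zero (h : IsHexahedral F Z β) (i : Fin 3) : pairSum Z i ≠ 0 :=
  h.add_ne_zero hT (by revert i; decide)

theorem IsHexahedral.ker_pairSum_injective (h : IsHexahedral F Z β) {i j : Fin 3}
    (hij : LinearMap.ker (pairSum Z i) = LinearMap.ker (pairSum Z j)) : i = j := by
  by_contra hne
  have h1 : ∀ i, pairFst i ≠ pairSnd i := by decide
  have h2 : ∀ i j, i ≠ j → Share (pairFst i) (pairSnd i) (pairFst j) (pairSnd j) = false := by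
    decide
  have h3 := (h.isLineOn_of_disjoint hT (a := pairFst i) (b := pairSnd i) (c := pairFst j)
    (d := pairSnd j) (h1 i) (h1 j) (h2 i j hne)).1
  change finrank k (LinearMap.ker (pairSum Z i) ⊓ LinearMap.ker (pairSum Z j) :
    Submodule k (Fin 4 → k)) = 2 at h3
  rw [hij, inf_idem, finrank_ker_eq_three (h.pairSum_ne_zero hT j)] at h3
  omega

/-- The plane is spanned by the common line and a second line among the fifteen of the first system.
By assumption the latter also belongs to the fifteen of the second system, so the plane is one of
its planes through the common line, of which there are just the three pair planes. -/
theorem IsHexahedral.exists_ker_pairSum_eq [IsAlgClosed k]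
    (h : IsHexahedral F Z β) (h' : IsHexahedral F Z' β') (h1 : hexLine Z 1 = hexLine Z' 1)
    (hmeet : ∀ M, IsLineOn F M → M ≠ hexLine Z 1 → hexLine Z 1 ⊓ M ≠ ⊥ → M ∉ hexDoubleSix F Z →
      ∃ t, M = hexLine Z' t) (i : Fin 3) :
    ∃ j, LinearMap.ker (pairSum Z' j) = LinearMap.ker (pairSum Z i) := by
  have hL := h.isLineOn_hexLine hT 1
  have hM := h.isLineOn_hexLine hT (recouple i)
  have hne := h.hexLine_recouple_ne hT i
  have hX0 := h.pairSum_ne_zero hT i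
  have h2 := inf_ne_bot_of_le_ker hL.1 hM.1 hX0 (hexLine_le_pairSum i) (hexLine_recouple_le i)
  obtain ⟨t, ht⟩ := hmeet _ hM hne.symm h2 fun hc => hc.2 _ rfl
  obtain ⟨a, b, hab, h3, h4⟩ := h'.exists_add_ker hT (s := 1) (t := t)
    (by rw [← h1, ← ht]; exact hne) (by rw [← h1, ← ht]; exact h2)
  obtain ⟨j, rfl, rfl⟩ := h'.eq_pair_of_le hT hab h3
  refine ⟨j, ?_⟩
  rw [← h1] at h3
  rw [← ht] at h4
  rw [← sup_eq_ker hL.1 hM.1 hne hX0 (hexLine_le_pairSum i) (hexLine_recouple_le i)]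
  exact (sup_eq_ker hL.1 hM.1 hne (h'.pairSum_ne_zero hT j) h3 h4).symm

/-- Hexahedral equations with the same Cremona plane determine the same double-six, if a line outside
the two double-sixes meets the same lines of each of them. -/
theorem IsHexahedral.hexDoubleSix_eq_of_line [IsAlgClosed k]
    (h : IsHexahedral F Z β) (h' : IsHexahedral F Z' β')
    (hd : ∀ s : Equiv.Perm (Fin 6), hexDisc (β ∘ s) ≠ 0)
    (hβ' : Function.Injective β') {L : Submodule k (Fin 4 → k)} (hL : IsLineOn F L)
    (hLD : L ∉ hexDoubleSix F Z) (hLD' : L ∉ hexDoubleSix F Z')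
    (hmeet : ∀ M, IsLineOn F M → M ≠ L → L ⊓ M ≠ ⊥ →
      (M ∈ hexDoubleSix F Z' ↔ M ∈ hexDoubleSix F Z))
    (hW : LinearMap.ker (∑ i, β' i ^ 2 • Z' i) = LinearMap.ker (∑ i, β i ^ 2 • Z i)) :
    hexDoubleSix F Z' = hexDoubleSix F Z := by
  have hex : ∀ {Z : Fin 6 → Dual k (Fin 4 → k)} {M}, IsLineOn F M → M ∉ hexDoubleSix F Z →
      ∃ s, M = hexLine Z s := fun hM hD => by
    by_contra hc
    push Not at hc
    exact hD ⟨hM, hc⟩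
  obtain ⟨s, hs⟩ := hex hL hLD
  obtain ⟨s', hs'⟩ := hex hL hLD'
  have h₁ := h.comp_perm s
  have h₁' := h'.comp_perm s'
  have hs : L = hexLine (Z ∘ s) 1 := hs
  have hs' : L = hexLine (Z' ∘ s') 1 := hs'
  have key := h₁.exists_ker_pairSum_eq hT h₁' (hs.symm.trans hs') fun M hM hne hm hMD =>
    hex hM (by
      rw [hexDoubleSix_comp] at hMD ⊢
      rwa [hmeet M hM (hs ▸ hne) (hs ▸ hm)])
  choose π hπ using key
  have hinj : Function.Injective π := fun i j hij =>
    h₁.ker_pairSum_injective hT (by rw [← hπ, ← hπ, hij])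
  -- Renumbers the pairs of the second system such that its three planes through `L` are in the
  -- order of the first.
  obtain ⟨τ, hτ⟩ := exists_perm_pair (Equiv.ofBijective π (Finite.injective_iff_bijective.1 hinj))
  have h₂' := h₁'.comp_perm τ
  have hp : ∀ i, pairSum ((Z' ∘ s') ∘ τ) i = pairSum (Z' ∘ s') (π i) := fun i => by
    simp only [pairSum, Function.comp_apply, (hτ i).1, (hτ i).2]
    rfl
  have hβ := injective_of_hexDisc_ne_zero hd
  have hfin := h₁.hexDoubleSix_eq_of_planes hT h₂' (hβ.comp s.injective)
    ((hβ'.comp s'.injective).comp τ.injective) (hd s) (fun i => by rw [hp, hπ]) (by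
      have e : ∀ {β : Fin 6 → k} {Z : Fin 6 → Dual k (Fin 4 → k)} (s : Equiv.Perm (Fin 6)),
        ∑ i, (β ∘ s) i ^ 2 • (Z ∘ s) i = ∑ i, β i ^ 2 • Z i := fun {β Z} s =>
          Equiv.sum_comp s fun i => β i ^ 2 • Z i
      rw [e, e, e, hW])
  rwa [hexDoubleSix_comp, hexDoubleSix_comp, hexDoubleSix_comp] at hfin

end

end CubicSurface
end

/-! ### Distinctness of the Cremona planes, and the conclusion -/

noncomputable section
namespace CubicSurface
open Module
variable {k : Type*} [Field k] {F : MvPolynomial (Fin 4) k}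
  {T : (Fin 4 → k) →ₗ[k] (Fin 4 → k) →ₗ[k] (Fin 4 → k) →ₗ[k] k}
  {u v : Fin 3 → Dual k (Fin 4 → k)} {A B : Fin 3 → Fin 3 → k}
  {Z Z' : Fin 6 → Dual k (Fin 4 → k)} {β β' : Fin 6 → k}

theorem injective_of_hexConsts_injective {a b : Fin 3 → k}
    (h : Function.Injective (hexConsts a b)) :
    Function.Injective a ∧ Function.Injective b := by
  have hl : ∀ i, hexConsts a b (idxLeft i) = ∑ l, a l - a i := fun i => by
    fin_cases i <;> rfl
  have hr : ∀ i, hexConsts a b (idxRight i) = ∑ l, b l - b i := fun i => by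
    fin_cases i <;> rfl
  have hil : Function.Injective idxLeft := by decide
  have hir : Function.Injective idxRight := by decide
  exact ⟨fun i j hij => hil (h (by rw [hl, hl, hij])),
    fun i j hij => hir (h (by rw [hr, hr, hij]))⟩

theorem exists_perm_three {i j : Fin 3} (h : i ≠ j) :
    ∃ s : Equiv.Perm (Fin 3), s 0 = i ∧ s 1 = j := by
  revert i j; decide

/-- Linear independence of the `cᵢ` recovers the linear forms vanishing on the plane from the pulled
back cubics. -/
theorem pullbackCubic_injective {c : Fin 4 → MvPolynomial (Fin 3) k}
    (hc : LinearIndependent k c) : Function.Injective (pullbackCubic c) := by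
  intro Ξ Ξ' h
  refine Subspace.dualAnnihilator_inj.1 (Submodule.map_injective_of_injective ?_ h)
  rw [← LinearMap.ker_eq_bot, LinearMap.ker_eq_bot']
  intro f hf
  simp only [LinearMap.sum_apply, LinearMap.smulRight_apply, LinearMap.applyₗ_apply_apply] at hf
  have h1 := Fintype.linearIndependent_iff.1 hc _ hf
  refine LinearMap.pi_ext' fun i => LinearMap.ext_ring ?_
  simpa using h1 i

section

variable [CharZero k] [IsAlgClosed k] (hT : IsPolar F T)

include hT

/-- Double-sixes that avoid a common grid have different Cremona planes. -/
theorem IsMarking.ker_ne_of_rootSix (hm : IsMarking F u v A B) {ρ ρ' : Fin 3} (hne : ρ ≠ ρ')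
    (hinj : ∀ Z β, IsHexahedral F Z β → Function.Injective β)
    (h : IsHexahedral F Z β) (h' : IsHexahedral F Z' β')
    (hD : hexDoubleSix F Z = rootSix u v A B ρ) (hD' : hexDoubleSix F Z' = rootSix u v A B ρ') :
    LinearMap.ker (∑ i, β' i ^ 2 • Z' i) ≠ LinearMap.ker (∑ i, β i ^ 2 • Z i) := by
  obtain ⟨s, rfl, rfl⟩ := exists_perm_three hne
  obtain ⟨u₁, v₁, A₁, B₁, h₁, hA, hB, hsix⟩ := hm.exists_normalized s
  rw [← hsix] at hD hD'
  have hex := h₁.isHexahedral hT hA hB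
  have hi := injective_of_hexConsts_injective (hinj _ _ hex)
  have hc := h₁.comp_perm (Equiv.swap 0 1)
  -- Exchanging the two relations and rescaling by the new first one makes that one `(1, 1)` and the
  -- other one the inverses, the situation of `IsMarking.ker_ne_ker`.
  have h₂ := hc.smul (hc.ne_zero_left 0) (hc.ne_zero_right 0) (hc.prod_eq 0)
  have hA₂ : (fun i => (A₁ ∘ Equiv.swap 0 1) 0 i / (A₁ ∘ Equiv.swap 0 1) 0 i) = 1 :=
    funext fun i => div_self (hc.ne_zero_left 0 i)
  have hB₂ : (fun i => (B₁ ∘ Equiv.swap 0 1) 0 i / (B₁ ∘ Equiv.swap 0 1) 0 i) = 1 :=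
    funext fun i => div_self (hc.ne_zero_right 0 i)
  have hex₂ := h₂.isHexahedral hT hA₂ hB₂
  have hd₂ := h₂.hexDoubleSix_hexForms hT hA₂ hB₂
  rw [rootSix_smul (hc.ne_zero_left 0) (hc.ne_zero_right 0), rootSix_comp_perm,
    Equiv.swap_apply_left, ← hD'] at hd₂
  rw [hex.ker_eq_of_hexDoubleSix_eq hT h ((h₁.hexDoubleSix_hexForms hT hA hB).trans hD.symm),
    hex₂.ker_eq_of_hexDoubleSix_eq hT h' hd₂]
  have key := h₁.ker_ne_ker hT hA hB hi.1 hi.2 (hex.sum_sq_ne_zero hT (hinj _ _ hex))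
  have e1 : (fun i => (A₁ ∘ Equiv.swap 0 1) 1 i / (A₁ ∘ Equiv.swap 0 1) 0 i) =
      fun i => (A₁ 1 i)⁻¹ := funext fun i => by
    simp [hA]
  have e2 : (fun i => (B₁ ∘ Equiv.swap 0 1) 1 i / (B₁ ∘ Equiv.swap 0 1) 0 i) =
      fun i => (B₁ 1 i)⁻¹ := funext fun i => by
    simp [hB]
  rw [e1, e2]
  exact key

/-- Different double-sixes have different Cremona planes. -/
theorem IsHexahedral.ker_ne_of_hexDoubleSix_ne
    (hd : ∀ Z β, IsHexahedral F Z β → ∀ s : Equiv.Perm (Fin 6), hexDisc (β ∘ s) ≠ 0)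
    (h : IsHexahedral F Z β) (h' : IsHexahedral F Z' β') (hsix : IsDoubleSix F (hexDoubleSix F Z'))
    (hne : hexDoubleSix F Z' ≠ hexDoubleSix F Z) :
    LinearMap.ker (∑ i, β' i ^ 2 • Z' i) ≠ LinearMap.ker (∑ i, β i ^ 2 • Z i) := by
  have hinj := fun Z β hZ => injective_of_hexDisc_ne_zero (hd Z β hZ)
  obtain ⟨A, B, hm, hA, hB⟩ := h.exists_isMarking hT
  obtain ⟨r, hr⟩ := hm.exists_eq_sixLines hT hsix
  have h0 : hexDoubleSix F Z = sixLines (hexLeft Z) (hexRight Z) A B 0 :=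
    (h.hexDoubleSix_eq hT hm hA hB).trans (sixLines_eq_rootSix 0).symm
  have hr0 : r ≠ 0 := by
    rintro rfl
    exact hne (hr.trans h0.symm)
  -- The labelling comes from the first system, so its double-six has index `0`. Either both
  -- double-sixes avoid a common grid, or a line outside both meets the same lines of each.
  rcases double_six_types hr0 with ⟨g, hg⟩ | ⟨l, hl, hl0, hadj⟩
  · obtain ⟨u, v, A', B', hm', hrho⟩ := hm.exists_remark hT g
    obtain ⟨ρ', hρ'⟩ := hrho r fun i j => (hg i j).1
    obtain ⟨ρ, hρ⟩ := hrho 0 fun i j => (hg i j).2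
    refine hm'.ker_ne_of_rootSix hT ?_ hinj h h' (h0.trans hρ) (hr.trans hρ')
    rintro rfl
    exact hne (by rw [hr, h0, hρ, hρ'])
  · intro hW
    refine hne (h.hexDoubleSix_eq_of_line hT h' (hd _ _ h) (hinj _ _ h') (hm.isLineOn_mark hT l)
      ?_ ?_ (fun M hM hML hmeet => ?_) hW)
    · rw [h0, hm.mark_mem_sixLines hT, hl0]
      exact Bool.false_ne_true
    · rw [hr, hm.mark_mem_sixLines hT, hl]
      exact Bool.false_ne_true
    · obtain ⟨x, rfl⟩ := hm.exists_mark_eq hT hM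
      rw [hm.mark_inf_ne_bot hT (fun e => hML (by rw [e]))] at hmeet
      rw [h0, hr, hm.mark_mem_sixLines hT, hm.mark_mem_sixLines hT, hadj x hmeet]

end

end CubicSurface
end

theorem propositionP {k : Type*} [Field k] [IsAlgClosed k] [CharZero k] :
    CubicSurface.ForGeneralCubic (k := k) fun F => CubicSurface.Nonsingular F →
      {D | CubicSurface.IsDoubleSix F D}.ncard = 36 ∧
      (∀ D, CubicSurface.IsDoubleSix F D → ∃! Ξ, CubicSurface.IsCremonaPlane F D Ξ) ∧
      (∀ D D' Ξ Ξ', CubicSurface.IsDoubleSix F D → CubicSurface.IsDoubleSix F D' → D ≠ D' →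
        CubicSurface.IsCremonaPlane F D Ξ → CubicSurface.IsCremonaPlane F D' Ξ' → Ξ ≠ Ξ') ∧
      (∀ P c, CubicSurface.IsImage F P c →
        ∀ D D' Ξ Ξ', CubicSurface.IsDoubleSix F D → CubicSurface.IsDoubleSix F D' → D ≠ D' →
          CubicSurface.IsCremonaPlane F D Ξ → CubicSurface.IsCremonaPlane F D' Ξ' →
          CubicSurface.pullbackCubic c Ξ ≠ CubicSurface.pullbackCubic c Ξ') := by
  obtain ⟨G, hG, hgen⟩ := CubicSurface.exists_generic_hexahedral (k := k)
  refine ⟨G, hG, fun F hF hGF hns => ?_⟩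
  obtain ⟨⟨Z₀, β₀, h₀⟩, hd⟩ := hgen F hF hGF hns
  obtain ⟨T, hT⟩ := CubicSurface.exists_isPolar hF hns
  -- One system of hexahedral equations suffices to label all lines of the surface.
  obtain ⟨A, B, hm, -, -⟩ := h₀.exists_isMarking hT
  have hdist : ∀ D D' Ξ Ξ', CubicSurface.IsDoubleSix F D → CubicSurface.IsDoubleSix F D' →
      D ≠ D' → CubicSurface.IsCremonaPlane F D Ξ → CubicSurface.IsCremonaPlane F D' Ξ' →
      Ξ ≠ Ξ' := by
    rintro D D' Ξ Ξ' hD - hne ⟨-, Z, β, h, rfl, rfl⟩ ⟨-, Z', β', h', rfl, rfl⟩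
    exact h'.ker_ne_of_hexDoubleSix_ne hT hd h hD hne
  refine ⟨hm.ncard_isDoubleSix hT, fun D hD => ?_, hdist,
    fun P c hc D D' Ξ Ξ' hD hD' hne hΞ hΞ' he =>
      hdist D D' Ξ Ξ' hD hD' hne hΞ hΞ'
        (CubicSurface.pullbackCubic_injective hc.linearIndependent he)⟩
  obtain ⟨Z, β, h, rfl⟩ := hm.exists_isHexahedral hT hD
  refine ⟨_, ⟨CubicSurface.finrank_ker_eq_three (h.sum_sq_ne_zero hT
    (CubicSurface.injective_of_hexDisc_ne_zero (hd _ _ h))), Z, β, h, rfl, rfl⟩, ?_⟩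
  rintro Ξ ⟨-, Z', β', h', hD', rfl⟩
  exact h.ker_eq_of_hexDoubleSix_eq hT h' hD'
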